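/- Let $\tau\in\mathbb C$ with $\operatorname{Im}\tau>0$, let $n\ge 1$ be an integer, put $r=\sqrt{2\pi/\operatorname{Im}\tau}$ and $\mathcal L=r(\mathbb Z+\tau\mathbb Z)$, and identify $\mathbb R^2$ with $\mathbb C$ through $(x_1,x_2)\mapsto x_1+ix_2$. Let $\Omega$ be the elementary cell of $\mathcal L$ spanned by $r$ and $r\tau$ (so $|\Omega|=2\pi$), $J(x_1,x_2)=(-x_2,x_1)$, and $a^n(x)=\frac n2 Jx$. Let $(c_t)_{t\in\mathcal L}$ be real numbers with $c_{s+t}-c_s-c_t-\frac n2\,s\wedge t\in 2\pi\mathbb Z$ for all $s,t\in\mathcal L$, where $s\wedge t=s_1t_2-s_2t_1$. Let $L^2_n$ be the Hilbert space of measurable functions $\psi:\mathbb R^2\to\mathbb C$ (modulo equality a.e.) that are square integrable on $\Omega$ and gauge-periodic, that is, for every $t\in\mathcal L$, $$\psi(x+t)=e^{i\left(\frac n2 x\cdot Jt+c_t\right)}\psi(x)\quad\text{for a.e. }x,$$ with the inner product of $L^2(\Omega)$. Consider on $L^2_n$ the operator $-\Delta_{a^n}=-\sum_{j=1}^2(\partial_{x_j}-ia^n_j)^2$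 whose domain is the set of all $\psi\in L^2_n$ in $H^2_{\mathrm{loc}}(\mathbb R^2)$. Then: 1. $-\Delta_{a^n}$ is a well-defined self-adjoint operator in $L^2_n$. 2. Its spectrum is $\sigma(-\Delta_{a^n})=\{(2m+1)n : m=0,1,2,\dots\}$, and each of these numbers is an eigenvalue of multiplicity $n$. 3. Let $V_n$ be the space of $n$-theta functions, that is, of the functions $\theta:\mathbb C\to\mathbb C$ of the form $$\theta(z)=\sum_{m\in\mathbb Z}b_m e^{2\pi i m z},\qquad b_{m+n}=e^{i\pi n\tau}e^{2\pi i m\tau}b_m\quad(m\in\mathbb Z),$$ with a series of complex coefficients that converges absolutely for every $z\in\mathbb C$. Each $\theta\in V_n$ is determined by the coefficients $b_0,\dots,b_{n-1}$, which can be prescribed arbitrarily; the map $\theta\mapsto(b_0,\dots,b_{n-1})$ is a linear isomorphism $V_n\to\mathbb C^n$, and $\dim_{\mathbb C}V_n=n$. 4. If $c_t=0$ for the two basis vectors $t=r$ and $t=r\tau$ of $\mathcal L$, then $$\operatorname{Null}(-\Delta_{a^n}-n)=e^{\frac{in}{2}x_2(x_1+ix_2)}V_n,$$ that is, the null space consists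 exactly of the functions $x\mapsto e^{\frac{in}{2}x_2(x_1+ix_2)}\,\theta\big((x_1+ix_2)/r\big)$ with $\theta\in V_n$. -/

import Mathlib

open MeasureTheory
open scoped ContDiff ComplexConjugate UpperHalfPlane

noncomputable section

namespace Landau

/-! The plane `ℝ²` is identified with `ℂ` through `(x₁, x₂) ↦ x₁ + i x₂`, so that `x.re` and `x.im`
are the coordinates of `x`; Lebesgue measure on `ℂ` is `volume`. -/

/-! ### Plane geometry and the normalized lattice -/

/-- The dot product of `ℝ²`. -/
def dot (x y : ℂ) : ℝ := x.re * y.re + x.im * y.im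

/-- `J x = x^⊥ = (-x₂, x₁)`. -/
def perp (x : ℂ) : ℂ := ⟨-x.im, x.re⟩

/-- `s ∧ t = s₁ t₂ - s₂ t₁`. -/
def wedge (s t : ℂ) : ℝ := s.re * t.im - s.im * t.re

/-- The scale `√(2π / Im τ)`, which makes the cell of the lattice have area `2π`. -/
def scale (τ : ℍ) : ℝ := √(2 * Real.pi / τ.im)

/-- The point `√(2π / Im τ) (p + q τ)`. -/
def pt (τ : ℍ) (p q : ℝ) : ℂ := (scale τ : ℂ) * ((p : ℂ) + (q : ℂ) * (τ : ℂ))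

lemma pt_add (τ : ℍ) (p q p' q' : ℝ) : pt τ (p + p') (q + q') = pt τ p q + pt τ p' q' := by
  simp only [pt]; push_cast; ring

lemma pt_neg (τ : ℍ) (p q : ℝ) : pt τ (-p) (-q) = -pt τ p q := by
  simp only [pt]; push_cast; ring

/-- The normalized lattice `√(2π / Im τ) (ℤ + τ ℤ)`. -/
def lattice (τ : ℍ) : AddSubgroup ℂ where
  carrier := {t | ∃ p q : ℤ, t = pt τ p q}
  zero_mem' := ⟨0, 0, by simp [pt]⟩
  add_mem' := by
    rintro _ _ ⟨p, q, rfl⟩ ⟨p', q', rfl⟩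
    exact ⟨p + p', q + q', by push_cast; rw [pt_add]⟩
  neg_mem' := by
    rintro _ ⟨p, q, rfl⟩
    exact ⟨-p, -q, by push_cast; rw [pt_neg]⟩

/-- The lattice vector `√(2π / Im τ) (p + q τ)`. -/
def latticePt (τ : ℍ) (p q : ℤ) : lattice τ := ⟨pt τ p q, p, q, rfl⟩

/-- The elementary cell of the lattice spanned by its two basis vectors. -/
def cell (τ : ℍ) : Set ℂ :=
  {x | ∃ p ∈ Set.Ico (0 : ℝ) 1, ∃ q ∈ Set.Ico (0 : ℝ) 1, x = pt τ p q}

/-! ### Gauge-periodic functions -/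

/-- The constants `c_t`, `t` in the lattice, that enter the gauge-periodic boundary condition with
`n` flux quanta per cell; they satisfy `c_{s+t} - c_s - c_t - ½ n s ∧ t ∈ 2πℤ`. -/
structure GaugePhase (τ : ℍ) (n : ℕ) where
  /-- The constants. -/
  c : lattice τ → ℝ
  /-- The compatibility condition. -/
  cocycle : ∀ s t : lattice τ, ∃ k : ℤ,
    c (s + t) - c s - c t - (n : ℝ) / 2 * wedge s t = 2 * Real.pi * k

variable {τ : ℍ} {n : ℕ}

/-- The factor `exp (i ((n/2) x · J t + c_t))`. -/
def gaugeFactor (γ : GaugePhase τ n) (t : lattice τ) (x : ℂ) : ℂ :=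
  Complex.exp (Complex.I * (((n : ℝ) / 2 * dot x (perp t) + γ.c t : ℝ) : ℂ))

/-- The gauge-periodic boundary condition
`ψ (x + t) = exp (i ((n/2) x · J t + c_t)) ψ x`, for every lattice vector `t` and almost every `x`. -/
def IsGaugePeriodic (γ : GaugePhase τ n) (ψ : ℂ → ℂ) : Prop :=
  ∀ t : lattice τ, ∀ᵐ x, ψ (x + (t : ℂ)) = gaugeFactor γ t x * ψ x

/-- The space of (classes of) gauge-periodic functions on the plane that are square integrable on
the elementary cell. -/
def gaugeL2Submodule (γ : GaugePhase τ n) : Submodule ℂ (ℂ →ₘ[(volume : Measure ℂ)] ℂ) where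
  carrier := {ψ | IsGaugePeriodic γ ψ ∧ MemLp ψ 2 (volume.restrict (cell τ))}
  zero_mem' := by
    have h0 : ((0 : ℂ →ₘ[(volume : Measure ℂ)] ℂ) : ℂ → ℂ) =ᵐ[volume] 0 := AEEqFun.coeFn_zero
    refine ⟨fun t => ?_, ?_⟩
    · have h1 := (measurePreserving_add_right (volume : Measure ℂ) (t : ℂ)).quasiMeasurePreserving.ae
        h0
      filter_upwards [h0, h1] with x hx hx1
      simp [hx, hx1]
    · exact (memLp_congr_ae (ae_restrict_of_ae h0)).2 MemLp.zero
  add_mem' := by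
    rintro a b ⟨ha, ha'⟩ ⟨hb, hb'⟩
    have h0 := AEEqFun.coeFn_add a b
    refine ⟨fun t => ?_, ?_⟩
    · have h1 := (measurePreserving_add_right (volume : Measure ℂ) (t : ℂ)).quasiMeasurePreserving.ae
        h0
      filter_upwards [h0, h1, ha t, hb t] with x hx hx1 hxa hxb
      simp [hx, hx1, hxa, hxb, mul_add]
    · exact (memLp_congr_ae (ae_restrict_of_ae h0)).2 (ha'.add hb')
  smul_mem' := by
    rintro z a ⟨ha, ha'⟩
    have h0 := AEEqFun.coeFn_smul z a
    refine ⟨fun t => ?_, ?_⟩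
    · have h1 := (measurePreserving_add_right (volume : Measure ℂ) (t : ℂ)).quasiMeasurePreserving.ae
        h0
      filter_upwards [h0, h1, ha t] with x hx hx1 hxa
      simp only [hx, hx1, Pi.smul_apply, smul_eq_mul, hxa]
      ring
    · exact (memLp_congr_ae (ae_restrict_of_ae h0)).2 (ha'.const_smul z)

/-- The Hilbert space of gauge-periodic functions. -/
abbrev GaugeL2 (γ : GaugePhase τ n) : Type := gaugeL2Submodule γ

/-- Restriction of a gauge-periodic function to the elementary cell. -/
def restrictCell (γ : GaugePhase τ n) :
    GaugeL2 γ →ₗ[ℂ] Lp ℂ 2 ((volume : Measure ℂ).restrict (cell τ)) where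
  toFun ψ := ψ.2.2.toLp _
  map_add' a b := by
    rw [← MemLp.toLp_add a.2.2 b.2.2]
    exact MemLp.toLp_congr _ _ (ae_restrict_of_ae (AEEqFun.coeFn_add _ _))
  map_smul' z a := by
    rw [RingHom.id_apply, ← MemLp.toLp_const_smul z a.2.2]
    exact MemLp.toLp_congr _ _ (ae_restrict_of_ae (AEEqFun.coeFn_smul _ _))

/-! The restriction to the cell is a bijection: this makes the space a Hilbert space. -/

lemma scale_pos (τ : ℍ) : 0 < scale τ := Real.sqrt_pos.2 (by have := τ.im_pos; positivity)

lemma scale_sq (τ : ℍ) : scale τ ^ 2 * τ.im = 2 * Real.pi := by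
  have := τ.im_pos
  rw [scale, Real.sq_sqrt (by positivity)]
  field_simp

lemma pt_re (τ : ℍ) (p q : ℝ) : (pt τ p q).re = scale τ * (p + q * τ.re) := by
  simp [pt]

lemma pt_im (τ : ℍ) (p q : ℝ) : (pt τ p q).im = scale τ * (q * τ.im) := by
  simp [pt]

/-- The second coordinate of a point in the basis of the lattice. -/
def coordQ (τ : ℍ) (x : ℂ) : ℝ := x.im / (scale τ * τ.im)

/-- The first coordinate of a point in the basis of the lattice. -/
def coordP (τ : ℍ) (x : ℂ) : ℝ := x.re / scale τ - coordQ τ x * τ.re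

lemma pt_coord (τ : ℍ) (x : ℂ) : pt τ (coordP τ x) (coordQ τ x) = x := by
  have h1 := (scale_pos τ).ne'
  have h2 := τ.im_pos.ne'
  apply Complex.ext
  · rw [pt_re, coordP, coordQ]; field_simp; ring
  · rw [pt_im, coordQ]; field_simp

lemma coordQ_pt (τ : ℍ) (p q : ℝ) : coordQ τ (pt τ p q) = q := by
  have h1 := (scale_pos τ).ne'
  have h2 := τ.im_pos.ne'
  simp [pt, coordQ]; field_simp

lemma coordP_pt (τ : ℍ) (p q : ℝ) : coordP τ (pt τ p q) = p := by
  have h1 := (scale_pos τ).ne'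
  rw [coordP, coordQ_pt]
  simp [pt]; field_simp; ring

lemma mem_cell_iff (τ : ℍ) (x : ℂ) :
    x ∈ cell τ ↔ coordP τ x ∈ Set.Ico (0 : ℝ) 1 ∧ coordQ τ x ∈ Set.Ico (0 : ℝ) 1 := by
  constructor
  · rintro ⟨p, hp, q, hq, rfl⟩
    rw [coordP_pt, coordQ_pt]
    exact ⟨hp, hq⟩
  · rintro ⟨hp, hq⟩
    exact ⟨_, hp, _, hq, (pt_coord τ x).symm⟩

lemma measurable_coordQ (τ : ℍ) : Measurable (coordQ τ) := by
  unfold coordQ; fun_prop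

lemma measurable_coordP (τ : ℍ) : Measurable (coordP τ) := by
  have := measurable_coordQ τ
  unfold coordP; fun_prop

lemma measurableSet_cell (τ : ℍ) : MeasurableSet (cell τ) := by
  have : cell τ = coordP τ ⁻¹' Set.Ico (0 : ℝ) 1 ∩ coordQ τ ⁻¹' Set.Ico (0 : ℝ) 1 := by
    ext x; exact mem_cell_iff τ x
  rw [this]
  exact (measurable_coordP τ measurableSet_Ico).inter (measurable_coordQ τ measurableSet_Ico)

/-- The lattice vector whose translate of the cell contains `x`. -/
def latticeFloor (τ : ℍ) (x : ℂ) : lattice τ := latticePt τ ⌊coordP τ x⌋ ⌊coordQ τ x⌋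

lemma coord_add_lattice (τ : ℍ) (x : ℂ) (p q : ℤ) :
    coordP τ (x + latticePt τ p q) = coordP τ x + p ∧
      coordQ τ (x + latticePt τ p q) = coordQ τ x + q := by
  have h : x + (latticePt τ p q : ℂ) = pt τ (coordP τ x + p) (coordQ τ x + q) := by
    rw [pt_add, pt_coord]; rfl
  rw [h, coordP_pt, coordQ_pt]
  exact ⟨rfl, rfl⟩

lemma sub_latticeFloor_mem (τ : ℍ) (x : ℂ) : x - latticeFloor τ x ∈ cell τ := by
  refine ⟨Int.fract (coordP τ x), ⟨Int.fract_nonneg _, Int.fract_lt_one _⟩,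
    Int.fract (coordQ τ x), ⟨Int.fract_nonneg _, Int.fract_lt_one _⟩, ?_⟩
  rw [sub_eq_iff_eq_add]
  change x = _ + pt τ _ _
  rw [← pt_add, Int.fract_add_floor, Int.fract_add_floor, pt_coord]

lemma latticeFloor_add (τ : ℍ) (x : ℂ) (t : lattice τ) :
    latticeFloor τ (x + t) = latticeFloor τ x + t := by
  obtain ⟨_, p, q, rfl⟩ := t
  obtain ⟨h1, h2⟩ := coord_add_lattice τ x p q
  apply Subtype.ext
  change pt τ (⌊coordP τ (x + latticePt τ p q)⌋ : ℤ) (⌊coordQ τ (x + latticePt τ p q)⌋ : ℤ) =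
    pt τ (⌊coordP τ x⌋ : ℤ) (⌊coordQ τ x⌋ : ℤ) + pt τ p q
  rw [h1, h2, Int.floor_add_intCast, Int.floor_add_intCast, ← pt_add]
  push_cast
  rfl

lemma latticeFloor_of_mem {x : ℂ} (hx : x ∈ cell τ) : latticeFloor τ x = 0 := by
  obtain ⟨h1, h2⟩ := (mem_cell_iff τ x).1 hx
  apply Subtype.ext
  simp [latticeFloor, latticePt, Int.floor_eq_zero_iff.2 h1, Int.floor_eq_zero_iff.2 h2, pt]

instance instCountableLattice (τ : ℍ) : Countable (lattice τ) := by
  have : Function.Surjective (fun pq : ℤ × ℤ => latticePt τ pq.1 pq.2) := by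
    rintro ⟨_, p, q, rfl⟩
    exact ⟨(p, q), rfl⟩
  exact this.countable

lemma wedge_lattice (s t : lattice τ) : ∃ k : ℤ, wedge s t = 2 * Real.pi * k := by
  obtain ⟨_, p, q, rfl⟩ := s
  obtain ⟨_, p', q', rfl⟩ := t
  refine ⟨p * q' - q * p', ?_⟩
  rw [← scale_sq τ]
  simp [wedge, pt]
  ring

lemma gaugeFactor_ne_zero (γ : GaugePhase τ n) (t : lattice τ) (x : ℂ) : gaugeFactor γ t x ≠ 0 :=
  Complex.exp_ne_zero _

lemma gaugeFactor_zero (γ : GaugePhase τ n) (x : ℂ) : gaugeFactor γ 0 x = 1 := by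
  obtain ⟨k, hk⟩ := γ.cocycle 0 0
  rw [gaugeFactor, Complex.exp_eq_one_iff]
  refine ⟨-k, ?_⟩
  have : γ.c 0 = -(2 * Real.pi * k) := by
    simp [wedge] at hk; linarith
  simp [dot, perp, this]
  ring

lemma gaugeFactor_add (γ : GaugePhase τ n) (s t : lattice τ) (x : ℂ) :
    gaugeFactor γ (s + t) x = gaugeFactor γ t (x + s) * gaugeFactor γ s x := by
  obtain ⟨k, hk⟩ := γ.cocycle s t
  obtain ⟨l, hl⟩ := wedge_lattice s t
  rw [gaugeFactor, gaugeFactor, gaugeFactor, ← Complex.exp_add, Complex.exp_eq_exp_iff_exists_int]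
  refine ⟨k + n * l, ?_⟩
  have : (n : ℝ) / 2 * dot x (perp ((s + t : lattice τ) : ℂ)) + γ.c (s + t) =
      ((n : ℝ) / 2 * dot (x + s) (perp t) + γ.c t) + ((n : ℝ) / 2 * dot x (perp s) + γ.c s)
        + 2 * Real.pi * (k + n * l) := by
    have e : γ.c (s + t) = γ.c s + γ.c t + (n : ℝ) / 2 * wedge s t + 2 * Real.pi * k := by
      linarith
    have e2 : 2 * Real.pi * ((k : ℝ) + n * l) = 2 * Real.pi * k + n * wedge s t := by
      rw [hl]; ring
    rw [e, e2]
    simp [dot, perp, wedge]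
    ring
  rw [this]
  push_cast
  ring

lemma measurable_gaugeFactor (γ : GaugePhase τ n) (t : lattice τ) :
    Measurable (gaugeFactor γ t) := by
  unfold gaugeFactor dot; fun_prop

/-- The gauge-periodic extension to the plane of a function on the cell. -/
def gaugeExtend (γ : GaugePhase τ n) (u : ℂ → ℂ) (x : ℂ) : ℂ :=
  gaugeFactor γ (latticeFloor τ x) (x - latticeFloor τ x) * u (x - latticeFloor τ x)

lemma gaugeExtend_add (γ : GaugePhase τ n) (u : ℂ → ℂ) (x : ℂ) (t : lattice τ) :
    gaugeExtend γ u (x + t) = gaugeFactor γ t x * gaugeExtend γ u x := by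
  have h : x + (t : ℂ) - (latticeFloor τ (x + t) : ℂ) = x - latticeFloor τ x := by
    rw [latticeFloor_add]; push_cast; ring
  rw [gaugeExtend, h, latticeFloor_add, gaugeFactor_add, gaugeExtend, sub_add_cancel, mul_assoc]

lemma gaugeExtend_of_mem (γ : GaugePhase τ n) (u : ℂ → ℂ) {x : ℂ} (hx : x ∈ cell τ) :
    gaugeExtend γ u x = u x := by
  rw [gaugeExtend, latticeFloor_of_mem hx, gaugeFactor_zero]; simp

lemma measurable_gaugeExtend (γ : GaugePhase τ n) {u : ℂ → ℂ} (hu : Measurable u) :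
    Measurable (gaugeExtend γ u) := by
  have hF : Measurable (fun x : ℂ => (⌊coordP τ x⌋, ⌊coordQ τ x⌋)) :=
    (measurable_coordP τ).floor.prodMk (measurable_coordQ τ).floor
  have h : Measurable (Function.uncurry fun (x : ℂ) (pq : ℤ × ℤ) =>
      gaugeFactor γ (latticePt τ pq.1 pq.2) (x - latticePt τ pq.1 pq.2) *
        u (x - latticePt τ pq.1 pq.2)) := by
    refine measurable_from_prod_countable_left fun pq => ?_
    have hs : Measurable fun x : ℂ => x - (latticePt τ pq.1 pq.2 : ℂ) :=
      measurable_id.sub measurable_const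
    have h1 := (measurable_gaugeFactor γ (latticePt τ pq.1 pq.2)).comp hs
    have h2 := hu.comp hs
    exact h1.mul h2
  have e : gaugeExtend γ u = fun x => (Function.uncurry fun (x : ℂ) (pq : ℤ × ℤ) =>
      gaugeFactor γ (latticePt τ pq.1 pq.2) (x - latticePt τ pq.1 pq.2) *
        u (x - latticePt τ pq.1 pq.2)) (x, (⌊coordP τ x⌋, ⌊coordQ τ x⌋)) := by
    funext x
    simp only [gaugeExtend, latticeFloor, Function.uncurry_apply_pair]
  rw [e]
  exact h.comp (measurable_id.prodMk hF)

lemma eq_zero_of_cell {γ : GaugePhase τ n} {ψ : ℂ → ℂ} (hψ : IsGaugePeriodic γ ψ)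
    (h : ψ =ᵐ[volume.restrict (cell τ)] 0) : ψ =ᵐ[volume] 0 := by
  have h1 : ∀ᵐ x, x ∈ cell τ → ψ x = 0 := (ae_restrict_iff' (measurableSet_cell τ)).1 h
  have h2 : ∀ᵐ x : ℂ, ∀ t : lattice τ, x + (t : ℂ) ∈ cell τ → ψ (x + t) = 0 :=
    ae_all_iff.2 fun t =>
      (measurePreserving_add_right (volume : Measure ℂ) (t : ℂ)).quasiMeasurePreserving.ae h1
  filter_upwards [h2, ae_all_iff.2 hψ] with x hx hx'
  have h3 := hx (-latticeFloor τ x) (by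
    have := sub_latticeFloor_mem τ x
    simpa [sub_eq_add_neg] using this)
  rw [hx'] at h3
  exact (mul_eq_zero.1 h3).resolve_left (gaugeFactor_ne_zero _ _ _)

lemma restrictCell_injective (γ : GaugePhase τ n) : Function.Injective (restrictCell γ) := by
  rw [injective_iff_map_eq_zero]
  intro ψ h
  have h1 : ((ψ : ℂ →ₘ[(volume : Measure ℂ)] ℂ) : ℂ → ℂ) =ᵐ[volume.restrict (cell τ)] 0 :=
    (MemLp.coeFn_toLp ψ.2.2).symm.trans (Lp.eq_zero_iff_ae_eq_zero.1 h)
  have h2 := eq_zero_of_cell ψ.2.1 h1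
  exact Subtype.ext (AEEqFun.ext (h2.trans AEEqFun.coeFn_zero.symm))

lemma restrictCell_surjective (γ : GaugePhase τ n) : Function.Surjective (restrictCell γ) := by
  intro u
  have hm := measurable_gaugeExtend γ (Lp.stronglyMeasurable u).measurable
  set e := gaugeExtend γ u
  have hc : e =ᵐ[volume.restrict (cell τ)] u := by
    filter_upwards [ae_restrict_mem (measurableSet_cell τ)] with x hx
    exact gaugeExtend_of_mem γ _ hx
  have h0 := AEEqFun.coeFn_mk e hm.aestronglyMeasurable (μ := (volume : Measure ℂ))
  have hL : MemLp (AEEqFun.mk e hm.aestronglyMeasurable : ℂ →ₘ[(volume : Measure ℂ)] ℂ) 2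
      (volume.restrict (cell τ)) :=
    (memLp_congr_ae (Filter.EventuallyEq.trans (ae_restrict_of_ae h0) hc)).2 (Lp.memLp u)
  refine ⟨⟨AEEqFun.mk e hm.aestronglyMeasurable, fun t => ?_, hL⟩, ?_⟩
  · have h1 := (measurePreserving_add_right (volume : Measure ℂ) (t : ℂ)).quasiMeasurePreserving.ae
      h0
    filter_upwards [h0, h1] with x hx hx1
    rw [hx, hx1]
    exact gaugeExtend_add γ _ x t
  · refine Lp.ext ?_
    exact (MemLp.coeFn_toLp hL).trans (Filter.EventuallyEq.trans (ae_restrict_of_ae h0) hc)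

instance instNormedAddCommGroup (γ : GaugePhase τ n) : NormedAddCommGroup (GaugeL2 γ) :=
  NormedAddCommGroup.induced _ _ (restrictCell γ) (restrictCell_injective γ)

/-- The inner product of `L²` of the cell. -/
instance instInnerProductSpace (γ : GaugePhase τ n) : InnerProductSpace ℂ (GaugeL2 γ) :=
  InnerProductSpace.induced (restrictCell γ)

lemma inner_eq_integral (γ : GaugePhase τ n) (φ ψ : GaugeL2 γ) :
    inner ℂ φ ψ = ∫ x in cell τ, conj ((φ : ℂ →ₘ[(volume : Measure ℂ)] ℂ) x) *
      (ψ : ℂ →ₘ[(volume : Measure ℂ)] ℂ) x := by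
  change inner ℂ (restrictCell γ φ) (restrictCell γ ψ) = _
  rw [L2.inner_def]
  refine integral_congr_ae ?_
  filter_upwards [MemLp.coeFn_toLp φ.2.2, MemLp.coeFn_toLp ψ.2.2] with x h1 h2
  have h1' : restrictCell γ φ x = (φ : ℂ →ₘ[(volume : Measure ℂ)] ℂ) x := h1
  have h2' : restrictCell γ ψ x = (ψ : ℂ →ₘ[(volume : Measure ℂ)] ℂ) x := h2
  rw [h1', h2', RCLike.inner_apply']

instance instCompleteSpace (γ : GaugePhase τ n) : CompleteSpace (GaugeL2 γ) := by
  have hi : Isometry (restrictCell γ) := AddMonoidHomClass.isometry_of_norm _ fun _ => rfl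
  exact (IsometryEquiv.mk' (restrictCell γ) (Function.surjInv (restrictCell_surjective γ))
    (Function.surjInv_eq (restrictCell_surjective γ)) hi).completeSpace

/-! ### Weak derivatives -/

/-- The coordinate vectors of the plane. -/
def basisVec : Fin 2 → ℂ := ![1, Complex.I]

/-- `g` is the weak partial derivative `∂f/∂x_j` on the plane. -/
def HasWeakPartial (j : Fin 2) (f g : ℂ → ℂ) : Prop :=
  LocallyIntegrable f ∧ LocallyIntegrable g ∧
    ∀ φ : ℂ → ℝ, ContDiff ℝ ∞ φ → HasCompactSupport φ →
      ∫ x, fderiv ℝ φ x (basisVec j) • f x = -∫ x, φ x • g x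

/-- `f ∈ L²_loc(ℝ²)`. -/
def MemL2Loc (f : ℂ → ℂ) : Prop :=
  ∀ K : Set ℂ, IsCompact K → MemLp f 2 (volume.restrict K)

/-- `f ∈ H²_loc(ℝ²)`: all weak partial derivatives of order at most two are in `L²_loc`. -/
def MemH2Loc (f : ℂ → ℂ) : Prop :=
  MemL2Loc f ∧ ∃ (g : Fin 2 → ℂ → ℂ) (h : Fin 2 → Fin 2 → ℂ → ℂ),
    (∀ j, MemL2Loc (g j) ∧ HasWeakPartial j f (g j)) ∧
      ∀ j k, MemL2Loc (h j k) ∧ HasWeakPartial k (g j) (h j k)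

lemma HasWeakPartial.congr {j : Fin 2} {f f' g g' : ℂ → ℂ} (h : HasWeakPartial j f g)
    (hf : f =ᵐ[volume] f') (hg : g =ᵐ[volume] g') : HasWeakPartial j f' g' := by
  refine ⟨h.1.congr hf, h.2.1.congr hg, fun φ h1 h2 => ?_⟩
  rw [← integral_congr_ae (hf.mono fun x hx => congrArg (fderiv ℝ φ x (basisVec j) • ·) hx),
    ← integral_congr_ae (hg.mono fun x hx => congrArg (φ x • ·) hx)]
  exact h.2.2 φ h1 h2

lemma integrable_test {f : ℂ → ℂ} (hf : LocallyIntegrable f) {φ : ℂ → ℝ} (h1 : Continuous φ)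
    (h2 : HasCompactSupport φ) : Integrable (fun x => φ x • f x) :=
  hf.integrable_smul_left_of_hasCompactSupport h1 h2

lemma integrable_test_deriv (j : Fin 2) {f : ℂ → ℂ} (hf : LocallyIntegrable f) {φ : ℂ → ℝ}
    (h1 : ContDiff ℝ ∞ φ) (h2 : HasCompactSupport φ) :
    Integrable (fun x => fderiv ℝ φ x (basisVec j) • f x) :=
  integrable_test hf ((h1.continuous_fderiv (by simp)).clm_apply continuous_const)
    (h2.fderiv_apply ℝ _)

lemma HasWeakPartial.add {j : Fin 2} {f f' g g' : ℂ → ℂ} (h : HasWeakPartial j f g)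
    (h' : HasWeakPartial j f' g') : HasWeakPartial j (f + f') (g + g') := by
  refine ⟨h.1.add h'.1, h.2.1.add h'.2.1, fun φ h1 h2 => ?_⟩
  simp only [Pi.add_apply, smul_add]
  rw [integral_add (integrable_test_deriv j h.1 h1 h2) (integrable_test_deriv j h'.1 h1 h2),
    integral_add (integrable_test h.2.1 h1.continuous h2) (integrable_test h'.2.1 h1.continuous h2),
    h.2.2 φ h1 h2, h'.2.2 φ h1 h2]
  ring

lemma HasWeakPartial.smul {j : Fin 2} {f g : ℂ → ℂ} (z : ℂ) (h : HasWeakPartial j f g) :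
    HasWeakPartial j (z • f) (z • g) := by
  refine ⟨h.1.smul z, h.2.1.smul z, fun φ h1 h2 => ?_⟩
  simp only [Pi.smul_apply, smul_comm _ z]
  rw [integral_smul, integral_smul, h.2.2 φ h1 h2, smul_neg]

lemma HasWeakPartial.eq_zero {j : Fin 2} {f g : ℂ → ℂ} (h : HasWeakPartial j f g)
    (hf : f =ᵐ[volume] 0) : g =ᵐ[volume] 0 := by
  have h' := h.congr hf Filter.EventuallyEq.rfl
  refine ae_eq_zero_of_integral_contDiff_smul_eq_zero h.2.1 fun φ h1 h2 => ?_
  have := h'.2.2 φ h1 h2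
  simpa using this.symm

lemma HasWeakPartial.zero (j : Fin 2) : HasWeakPartial j 0 0 :=
  ⟨locallyIntegrable_zero, locallyIntegrable_zero, fun φ _ _ => by simp⟩

lemma MemL2Loc.zero : MemL2Loc 0 := fun _ _ => MemLp.zero

lemma MemL2Loc.add {f g : ℂ → ℂ} (hf : MemL2Loc f) (hg : MemL2Loc g) : MemL2Loc (f + g) :=
  fun K hK => (hf K hK).add (hg K hK)

lemma MemL2Loc.smul {f : ℂ → ℂ} (z : ℂ) (hf : MemL2Loc f) : MemL2Loc (z • f) :=
  fun K hK => (hf K hK).const_smul z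

lemma MemL2Loc.congr {f g : ℂ → ℂ} (hf : MemL2Loc f) (h : f =ᵐ[volume] g) : MemL2Loc g :=
  fun K hK => (memLp_congr_ae (ae_restrict_of_ae h)).1 (hf K hK)

lemma MemH2Loc.zero : MemH2Loc 0 :=
  ⟨.zero, 0, 0, fun j => ⟨.zero, .zero j⟩, fun _ k => ⟨.zero, .zero k⟩⟩

lemma MemH2Loc.add {f f' : ℂ → ℂ} (h : MemH2Loc f) (h' : MemH2Loc f') : MemH2Loc (f + f') := by
  obtain ⟨h0, a, b, ha, hb⟩ := h
  obtain ⟨h0', a', b', ha', hb'⟩ := h'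
  exact ⟨h0.add h0', a + a', b + b', fun j => ⟨(ha j).1.add (ha' j).1, (ha j).2.add (ha' j).2⟩,
    fun j k => ⟨(hb j k).1.add (hb' j k).1, (hb j k).2.add (hb' j k).2⟩⟩

lemma MemH2Loc.smul {f : ℂ → ℂ} (z : ℂ) (h : MemH2Loc f) : MemH2Loc (z • f) := by
  obtain ⟨h0, a, b, ha, hb⟩ := h
  exact ⟨h0.smul z, z • a, z • b, fun j => ⟨(ha j).1.smul z, (ha j).2.smul z⟩,
    fun j k => ⟨(hb j k).1.smul z, (hb j k).2.smul z⟩⟩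

lemma MemH2Loc.congr {f f' : ℂ → ℂ} (h : MemH2Loc f) (hf : f =ᵐ[volume] f') : MemH2Loc f' := by
  obtain ⟨h0, a, b, ha, hb⟩ := h
  exact ⟨h0.congr hf, a, b, fun j => ⟨(ha j).1, (ha j).2.congr hf .rfl⟩, hb⟩

/-! ### The magnetic Laplacian -/

/-- The components of the magnetic potential `aⁿ(x) = (n/2) J x`. -/
def potential (n : ℕ) (j : Fin 2) (x : ℂ) : ℝ := (n : ℝ) / 2 * dot (perp x) (basisVec j)

/-- `g = (∂_j - i aⁿ_j) f` in the weak sense. -/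
def HasWeakCovDeriv (n : ℕ) (j : Fin 2) (f g : ℂ → ℂ) : Prop :=
  HasWeakPartial j f fun x => g x + Complex.I * (potential n j x : ℂ) * f x

/-- `g = -Δ_{aⁿ} f`, where `Δ_{aⁿ} = ∑_j (∂_j - i aⁿ_j)²`, in the weak sense. -/
def IsNegMagneticLaplacian (n : ℕ) (f g : ℂ → ℂ) : Prop :=
  ∃ d e : Fin 2 → ℂ → ℂ, (∀ j, HasWeakCovDeriv n j f (d j)) ∧
    (∀ j, HasWeakCovDeriv n j (d j) (e j)) ∧ g =ᵐ[volume] -∑ j, e j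

lemma HasWeakCovDeriv.congr {j : Fin 2} {f f' g g' : ℂ → ℂ} (h : HasWeakCovDeriv n j f g)
    (hf : f =ᵐ[volume] f') (hg : g =ᵐ[volume] g') : HasWeakCovDeriv n j f' g' := by
  refine HasWeakPartial.congr h hf ?_
  filter_upwards [hf, hg] with x h1 h2
  rw [h1, h2]

lemma HasWeakCovDeriv.add {j : Fin 2} {f f' g g' : ℂ → ℂ} (h : HasWeakCovDeriv n j f g)
    (h' : HasWeakCovDeriv n j f' g') : HasWeakCovDeriv n j (f + f') (g + g') := by
  refine (HasWeakPartial.add h h').congr .rfl (.of_forall fun x => ?_)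
  simp only [Pi.add_apply]; ring

lemma HasWeakCovDeriv.smul {j : Fin 2} {f g : ℂ → ℂ} (z : ℂ) (h : HasWeakCovDeriv n j f g) :
    HasWeakCovDeriv n j (z • f) (z • g) := by
  refine (HasWeakPartial.smul z h).congr .rfl (.of_forall fun x => ?_)
  simp only [Pi.smul_apply, smul_eq_mul]; ring

lemma HasWeakCovDeriv.eq_zero {j : Fin 2} {f g : ℂ → ℂ} (h : HasWeakCovDeriv n j f g)
    (hf : f =ᵐ[volume] 0) : g =ᵐ[volume] 0 := by
  filter_upwards [HasWeakPartial.eq_zero h hf, hf] with x h1 h2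
  simpa [h2] using h1

lemma IsNegMagneticLaplacian.congr {f f' g g' : ℂ → ℂ} (h : IsNegMagneticLaplacian n f g)
    (hf : f =ᵐ[volume] f') (hg : g =ᵐ[volume] g') : IsNegMagneticLaplacian n f' g' := by
  obtain ⟨d, e, hd, he, hge⟩ := h
  exact ⟨d, e, fun j => (hd j).congr hf .rfl, he, hg.symm.trans hge⟩

lemma IsNegMagneticLaplacian.eq_zero {f g : ℂ → ℂ} (h : IsNegMagneticLaplacian n f g)
    (hf : f =ᵐ[volume] 0) : g =ᵐ[volume] 0 := by
  obtain ⟨d, e, hd, he, hge⟩ := h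
  have h1 := ae_all_iff.2 fun j => (he j).eq_zero ((hd j).eq_zero hf)
  filter_upwards [hge, h1] with x hx hx'
  simp [hx, hx']

/-- The graph of `-Δ_{aⁿ}` on gauge-periodic functions of class `H²_loc`. -/
def magneticGraph (γ : GaugePhase τ n) : Submodule ℂ (GaugeL2 γ × GaugeL2 γ) where
  carrier := {p | MemH2Loc p.1.1 ∧ IsNegMagneticLaplacian n p.1.1 p.2.1}
  zero_mem' := by
    have h0 : ((0 : ℂ →ₘ[(volume : Measure ℂ)] ℂ) : ℂ → ℂ) =ᵐ[volume] 0 := AEEqFun.coeFn_zero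
    refine ⟨MemH2Loc.zero.congr h0.symm, 0, 0, fun j => ?_, fun j => ?_, ?_⟩
    · refine HasWeakCovDeriv.congr (f := 0) ?_ h0.symm .rfl
      exact (HasWeakPartial.zero j).congr .rfl (.of_forall fun x => by simp)
    · exact (HasWeakPartial.zero j).congr .rfl (.of_forall fun x => by simp)
    · refine h0.trans (.of_forall fun x => by simp)
  add_mem' := by
    rintro p p' ⟨h, d, e, hd, he, hv⟩ ⟨h', d', e', hd', he', hv'⟩
    have h0 := AEEqFun.coeFn_add p.1.1 p'.1.1
    refine ⟨(h.add h').congr h0.symm, d + d', e + e',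
      fun j => ((hd j).add (hd' j)).congr h0.symm .rfl, fun j => (he j).add (he' j), ?_⟩
    refine (AEEqFun.coeFn_add p.2.1 p'.2.1).trans ?_
    filter_upwards [hv, hv'] with x hx hx'
    simp [hx, hx']; ring
  smul_mem' := by
    rintro z p ⟨h, d, e, hd, he, hv⟩
    have h0 := AEEqFun.coeFn_smul z p.1.1
    refine ⟨(h.smul z).congr h0.symm, z • d, z • e,
      fun j => ((hd j).smul z).congr h0.symm .rfl, fun j => (he j).smul z, ?_⟩
    refine (AEEqFun.coeFn_smul z p.2.1).trans ?_
    filter_upwards [hv] with x hx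
    simp [hx]; ring

/-- The operator `-Δ_{aⁿ}` on the Hilbert space of gauge-periodic functions. -/
def magneticLaplacian (γ : GaugePhase τ n) : GaugeL2 γ →ₗ.[ℂ] GaugeL2 γ :=
  (magneticGraph γ).toLinearPMap

/-- The graph above is single-valued, hence it is the graph of the operator. -/
lemma magneticLaplacian_graph (γ : GaugePhase τ n) :
    (magneticLaplacian γ).graph = magneticGraph γ := by
  refine Submodule.toLinearPMap_graph_eq _ ?_
  rintro ⟨u, v⟩ ⟨_, h⟩ hu
  have hu' : u = 0 := hu
  subst hu'
  have := h.eq_zero (AEEqFun.coeFn_zero (μ := (volume : Measure ℂ)))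
  exact Subtype.ext (AEEqFun.ext (this.trans AEEqFun.coeFn_zero.symm))

/-! ### Spectrum and eigenspaces of unbounded operators -/

/-- The spectrum of an unbounded operator `A`: the complement of the set of all `z` for which
`A - z` is a bijection from the domain of `A` onto the space with bounded inverse. -/
def unboundedSpectrum {H : Type*} [NormedAddCommGroup H] [NormedSpace ℂ H] (A : H →ₗ.[ℂ] H) :
    Set ℂ :=
  {z | ¬ ∃ R : H →L[ℂ] H, (∀ u : A.domain, R (A u - z • (u : H)) = u) ∧
    ∀ f : H, ∃ u : A.domain, (u : H) = R f ∧ A u - z • (u : H) = f}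

/-- The null space of `A - z`. -/
def eigenspace {H : Type*} [AddCommGroup H] [Module ℂ H] (A : H →ₗ.[ℂ] H) (z : ℂ) :
    Submodule ℂ H :=
  (LinearMap.ker (A.toFun - z • A.domain.subtype)).map A.domain.subtype

/-! ### Theta functions -/

/-- `θ` has the everywhere convergent expansion `θ(z) = ∑_{m ∈ ℤ} c_m e^{2πimz}`, with
`c_{m+n} = e^{iπnτ} e^{2πimτ} c_m`. -/
def IsThetaExpansion (τ : ℍ) (n : ℕ) (c : ℤ → ℂ) (θ : ℂ → ℂ) : Prop :=
  (∀ m : ℤ, c (m + n) = Complex.exp (Complex.I * Real.pi * n * τ) *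
    Complex.exp (2 * Complex.I * m * Real.pi * τ) * c m) ∧
  ∀ z : ℂ, HasSum (fun m : ℤ => c m * Complex.exp (2 * Real.pi * Complex.I * m * z)) (θ z)

/-- The space `V_n` of `n`-theta functions. -/
def thetaSpace (τ : ℍ) (n : ℕ) : Submodule ℂ (ℂ → ℂ) where
  carrier := {θ | ∃ c, IsThetaExpansion τ n c θ}
  zero_mem' := ⟨0, fun m => by simp, fun z => by simp⟩
  add_mem' := by
    rintro θ θ' ⟨c, h1, h2⟩ ⟨c', h1', h2'⟩
    refine ⟨c + c', fun m => ?_, fun z => ?_⟩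
    · simp only [Pi.add_apply, h1, h1']; ring
    · simpa [add_mul] using (h2 z).add (h2' z)
  smul_mem' := by
    rintro w θ ⟨c, h1, h2⟩
    refine ⟨w • c, fun m => ?_, fun z => ?_⟩
    · simp only [Pi.smul_apply, smul_eq_mul, h1]; ring
    · simpa [mul_assoc] using (h2 z).mul_left w

/-- The factor `e^{(in/2) x₂ (x₁ + i x₂)}`. -/
def thetaFactor (n : ℕ) (x : ℂ) : ℂ :=
  Complex.exp (Complex.I * n / 2 * x.im * (x.re + Complex.I * x.im))

end Landau

end

/-! The covariant derivatives `D₁`, `D₂` are skew-symmetric on smooth gauge-periodic functions and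
their commutator is the constant `-in`, so `A = D₁ + i D₂` and its formal adjoint `A*` are ladder
operators with `-Δ = A* A + n`. Superpositions of plane waves times Gaussians, with weights that
make them gauge-periodic, form an `n`-dimensional space killed by `A`, and `A*` raises them to all
superpositions with a polynomial factor. The latter are complete: unfolding the cell to a strip,
orthogonality to all of them makes every Fourier coefficient of the function have vanishing moments
against a Gaussian. Hence the powers of `A*` applied to the ground states give a Hilbert basis of
smooth eigenvectors, each eigenvalue `(2m + 1)n` appearing `n` times.

Integrating by parts against this basis shows that `-Δ` on `H²_loc` multiplies coordinates by the
eigenvalues. It is the maximal such operator: the commutation relation gives an a priori estimate of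
all second derivatives by `u` and `Δu`, so eigenfunction expansions whose images under `-Δ` converge
have their sums in `H²_loc`. For trivial phases on the basis vectors, completing the square in the
Gaussian turns the ground states into theta functions. -/

noncomputable section

namespace Landau

/-! ### Operators that are diagonal in a Hilbert basis -/

section Diagonal

variable {𝕜 : Type*} [RCLike 𝕜] {H : Type*} [NormedAddCommGroup H] [InnerProductSpace 𝕜 H]
  {ι : Type*}

lemma hilbertBasis_ext (b : HilbertBasis ι 𝕜 H) {u v : H}
    (h : ∀ i, inner 𝕜 (b i) u = inner 𝕜 (b i) v) : u = v :=
  b.repr.injective <| lp.ext <| funext fun i => by simpa only [b.repr_apply_apply] using h i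

lemma exists_diagonal_clm (b : HilbertBasis ι 𝕜 H) (μ : ι → 𝕜) {C : ℝ} (hC : 0 ≤ C)
    (hμ : ∀ i, ‖μ i‖ ≤ C) :
    ∃ R : H →L[𝕜] H, ∀ f i, inner 𝕜 (b i) (R f) = μ i * inner 𝕜 (b i) f := by
  have pointwise_le (f : lp (fun _ : ι => 𝕜) 2) (i : ι) : ‖μ i * f i‖ ≤ ‖(C : 𝕜) * f i‖ := by
    rw [norm_mul, norm_mul, RCLike.norm_ofReal, abs_of_nonneg hC]
    gcongr
    exact hμ i
  let M : lp (fun _ : ι => 𝕜) 2 →ₗ[𝕜] lp (fun _ : ι => 𝕜) 2 :=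
    { toFun f := ⟨fun i => μ i * f i, (lp.memℓp ((C : 𝕜) • f)).mono' (pointwise_le f)⟩
      map_add' f g := by ext i; exact mul_add _ _ _
      map_smul' c f := by ext i; exact mul_left_comm _ _ _ }
  have norm_M_le (f : lp (fun _ : ι => 𝕜) 2) : ‖M f‖ ≤ C * ‖f‖ := calc
    ‖M f‖ ≤ ‖(C : 𝕜) • f‖ := lp.norm_mono two_ne_zero (pointwise_le f)
    _ = C * ‖f‖ := by rw [norm_smul, RCLike.norm_ofReal, abs_of_nonneg hC]
  refine ⟨(b.repr.symm.toContinuousLinearEquiv : _ →L[𝕜] H) ∘L M.mkContinuous C norm_M_le ∘L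
    (b.repr.toContinuousLinearEquiv : H →L[𝕜] _), fun f i => ?_⟩
  rw [← b.repr_apply_apply, ← b.repr_apply_apply]
  simp [M]

/-- `T` is the maximal operator that multiplies the `i`-th coordinate in the Hilbert basis `b` by
`l i`: its domain consists of all `u` for which the products are the coordinates of a vector. -/
def IsDiagonal (T : H →ₗ.[𝕜] H) (b : HilbertBasis ι 𝕜 H) (l : ι → 𝕜) : Prop :=
  ∀ u f, (u, f) ∈ T.graph ↔ ∀ i, inner 𝕜 (b i) f = l i * inner 𝕜 (b i) u

namespace IsDiagonal

variable {b : HilbertBasis ι 𝕜 H} {l : ι → 𝕜} {T : H →ₗ.[𝕜] H}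

lemma inner_apply (hT : IsDiagonal T b l) (u : T.domain) (i : ι) :
    inner 𝕜 (b i) (T u) = l i * inner 𝕜 (b i) (u : H) :=
  (hT _ _).1 (T.mem_graph u) i

lemma basis_mem_graph (hT : IsDiagonal T b l) (i : ι) : (b i, l i • b i) ∈ T.graph := by
  classical
  refine (hT _ _).2 fun j => ?_
  rw [inner_smul_right, orthonormal_iff_ite.1 b.orthonormal j i]
  split_ifs with h
  · rw [h]
  · rw [mul_zero, mul_zero]

lemma dense_domain (hT : IsDiagonal T b l) : Dense (T.domain : Set H) := by
  rw [Submodule.dense_iff_topologicalClosure_eq_top, ← top_le_iff, ← b.dense_span]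
  refine Submodule.topologicalClosure_mono (Submodule.span_le.2 ?_)
  rintro _ ⟨i, rfl⟩
  exact T.mem_domain_of_mem_graph (hT.basis_mem_graph i)

lemma isSelfAdjoint [CompleteSpace H] (hT : IsDiagonal T b l) (hl : ∀ i, conj (l i) = l i) :
    IsSelfAdjoint T := by
  rw [LinearPMap.isSelfAdjoint_def]
  apply LinearPMap.eq_of_eq_graph
  rw [LinearPMap.adjoint_graph_eq_graph_adjoint hT.dense_domain]
  ext ⟨v, w⟩
  rw [Submodule.mem_adjoint_iff, hT]
  constructor
  · intro h i
    have := h _ _ (hT.basis_mem_graph i)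
    rw [inner_smul_left, hl, sub_eq_zero] at this
    exact this.symm
  · intro h a f haf
    have hf := (hT a f).1 haf
    refine sub_eq_zero.2 ((b.hasSum_inner_mul_inner f v).unique
      ((b.hasSum_inner_mul_inner a w).congr_fun fun i => ?_))
    rw [h i, ← inner_conj_symm f, hf i, ← inner_conj_symm a, map_mul, hl]
    ring

end IsDiagonal

end Diagonal

section Spectrum

variable {H : Type*} [NormedAddCommGroup H] [InnerProductSpace ℂ H] {ι : Type*}

lemma mem_eigenspace_iff {T : H →ₗ.[ℂ] H} {z : ℂ} {u : H} :
    u ∈ eigenspace T z ↔ (u, z • u) ∈ T.graph := by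
  rw [LinearPMap.mem_graph_iff, eigenspace, Submodule.mem_map]
  constructor
  · rintro ⟨y, hy, rfl⟩
    exact ⟨y, rfl, sub_eq_zero.1 hy⟩
  · rintro ⟨y, rfl, hy⟩
    exact ⟨y, sub_eq_zero.2 hy, rfl⟩

namespace IsDiagonal

variable {b : HilbertBasis ι ℂ H} {l : ι → ℂ} {T : H →ₗ.[ℂ] H}

lemma mem_eigenspace_iff (hT : IsDiagonal T b l) {z : ℂ} {u : H} :
    u ∈ eigenspace T z ↔ ∀ i, l i ≠ z → inner ℂ (b i) u = 0 := by
  rw [Landau.mem_eigenspace_iff, hT]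
  refine forall_congr' fun i => ?_
  rw [inner_smul_right, mul_eq_mul_right_iff, eq_comm (a := z)]
  tauto

lemma eigenspace_eq_span (hT : IsDiagonal T b l) {z : ℂ} (hz : {i | l i = z}.Finite) :
    eigenspace T z = Submodule.span ℂ (b '' {i | l i = z}) := by
  classical
  refine le_antisymm (fun u hu => ?_) (Submodule.span_le.2 ?_)
  · have expansion : u = ∑ i ∈ hz.toFinset, inner ℂ (b i) u • b i := by
      refine hilbertBasis_ext b fun j => ?_
      simp only [inner_sum, inner_smul_right, orthonormal_iff_ite.1 b.orthonormal, mul_ite, mul_one,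
        mul_zero, Finset.sum_ite_eq, Set.Finite.mem_toFinset, Set.mem_ofPred_eq]
      split_ifs with hj
      · rfl
      · exact hT.mem_eigenspace_iff.1 hu j hj
    rw [expansion]
    exact Submodule.sum_mem _ fun i hi => Submodule.smul_mem _ _
      (Submodule.subset_span (Set.mem_image_of_mem b (hz.mem_toFinset.1 hi)))
  · rintro _ ⟨i, hi, rfl⟩
    refine hT.mem_eigenspace_iff.2 fun j hj => b.orthonormal.inner_eq_zero ?_
    rintro rfl
    exact hj hi

lemma finrank_eigenspace (hT : IsDiagonal T b l) {z : ℂ} (hz : {i | l i = z}.Finite) :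
    Module.finrank ℂ (eigenspace T z) = {i | l i = z}.ncard := by
  have := hz.fintype
  rw [hT.eigenspace_eq_span hz, Set.image_eq_range]
  exact (finrank_span_eq_card (b.orthonormal.linearIndependent.comp _ Subtype.val_injective)).trans
    Fintype.card_eq_nat_card

lemma mem_closure_of_mem_unboundedSpectrum (hT : IsDiagonal T b l) {z : ℂ}
    (hz : z ∈ unboundedSpectrum T) : z ∈ closure (Set.range l) := by
  contrapose! hz
  obtain ⟨δ, hδ, h⟩ : ∃ δ > 0, ∀ i, δ ≤ ‖l i - z‖ := by
    simpa [Metric.mem_closure_range_iff, dist_eq_norm_sub'] using hz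
  have sub_ne_zero (i : ι) : l i - z ≠ 0 := norm_pos_iff.1 (hδ.trans_le (h i))
  obtain ⟨R, hR⟩ := exists_diagonal_clm b (fun i => (l i - z)⁻¹) (C := δ⁻¹) (by positivity)
    fun i => by rw [norm_inv]; exact inv_anti₀ hδ (h i)
  refine not_not.2 ⟨R, fun u => hilbertBasis_ext b fun i => ?_, fun f => ?_⟩
  · rw [hR, inner_sub_right, inner_smul_right, hT.inner_apply, ← sub_mul,
      inv_mul_cancel_left₀ (sub_ne_zero i)]
  · have graph_mem : (R f, f + z • R f) ∈ T.graph := (hT _ _).2 fun i => by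
      rw [inner_add_right, inner_smul_right, hR]
      field_simp [sub_ne_zero i]
      ring
    obtain ⟨u, (hu : (u : H) = R f), (hTu : T u = f + z • R f)⟩ :=
      (LinearPMap.mem_graph_iff _).1 graph_mem
    exact ⟨u, hu, by rw [hTu, hu, add_sub_cancel_right]⟩

lemma unboundedSpectrum_eq_closure (hT : IsDiagonal T b l) :
    unboundedSpectrum T = closure (Set.range l) := by
  refine Set.Subset.antisymm (fun z hz => hT.mem_closure_of_mem_unboundedSpectrum hz) ?_
  rintro z hz ⟨R, hR, -⟩
  have one_le (i : ι) : 1 ≤ ‖R‖ * dist z (l i) := by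
    obtain ⟨u, (hu : (u : H) = b i), (hTu : T u = l i • b i)⟩ :=
      (LinearPMap.mem_graph_iff _).1 (hT.basis_mem_graph i)
    have hRi : R ((l i - z) • b i) = b i := by
      rw [sub_smul, ← hTu, ← hu, hR]
    calc 1 = ‖R ((l i - z) • b i)‖ := by rw [hRi, b.orthonormal.norm_eq_one]
      _ ≤ ‖R‖ * ‖(l i - z) • b i‖ := R.le_opNorm _
      _ = ‖R‖ * dist z (l i) := by
        rw [norm_smul, b.orthonormal.norm_eq_one, mul_one, dist_eq_norm_sub']
  obtain ⟨i, hi⟩ := Metric.mem_closure_range_iff.1 hz (‖R‖ + 1)⁻¹ (by positivity)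
  have : ‖R‖ * dist z (l i) ≤ ‖R‖ * (‖R‖ + 1)⁻¹ := by gcongr
  have : ‖R‖ * (‖R‖ + 1)⁻¹ < 1 := by
    rw [← div_eq_mul_inv, div_lt_one (by positivity)]
    exact lt_add_one _
  linarith [one_le i]

end IsDiagonal

lemma isClosed_range_odd_mul {ν : ℝ} (hν : 0 < ν) :
    IsClosed (Set.range fun m : ℕ => (2 * (m : ℂ) + 1) * ν) := by
  refine (Metric.isClosedEmbedding_of_pairwise_le_dist (ε := 2 * ν) (by positivity)
    fun m k hmk => ?_).isClosed_range
  have one_le_abs_sub : (1 : ℝ) ≤ |(m : ℝ) - k| := by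
    exact_mod_cast Int.one_le_abs (sub_ne_zero.2 (Nat.cast_injective.ne hmk))
  have sub_eq : (2 * (m : ℂ) + 1) * ν - (2 * k + 1) * ν = ((2 * ν * (m - k) : ℝ) : ℂ) := by
    push_cast; ring
  change 2 * ν ≤ dist ((2 * (m : ℂ) + 1) * ν) ((2 * k + 1) * ν)
  rw [dist_eq_norm, sub_eq, Complex.norm_real, Real.norm_eq_abs, abs_mul,
    abs_of_pos (by positivity)]
  exact le_mul_of_one_le_right (by positivity) one_le_abs_sub

end Spectrum

/-! ### Ladder operators -/

section Ladder

variable {H : Type*} [NormedAddCommGroup H] [InnerProductSpace ℂ H]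
  {E : Type*} [AddCommGroup E] [Module ℂ E]

/-- A pair of covariant derivatives in a constant magnetic field `ν`, acting on a space `E` that is
mapped to a Hilbert space by `j`: they are skew-symmetric, with commutator
`[D₁, D₂] = -iν`. The indices `1, 2` of the paper are `0, 1` here. -/
structure CovariantPair (j : E →ₗ[ℂ] H) (D : Fin 2 → E →ₗ[ℂ] E) (ν : ℝ) : Prop where
  skew : ∀ k x y, inner ℂ (j x) (j (D k y)) = -inner ℂ (j (D k x)) (j y)
  comm : ∀ x, D 1 (D 0 x) = D 0 (D 1 x) + (Complex.I * ν) • x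

/-- The annihilation operator `D₁ + i D₂`. -/
def lowering (D : Fin 2 → E →ₗ[ℂ] E) : E →ₗ[ℂ] E := D 0 + Complex.I • D 1

/-- The creation operator `-(D₁ - i D₂)`. -/
def raising (D : Fin 2 → E →ₗ[ℂ] E) : E →ₗ[ℂ] E := -(D 0 - Complex.I • D 1)

/-- The operator `-(D₁² + D₂²)`. -/
def negLaplacian (D : Fin 2 → E →ₗ[ℂ] E) : E →ₗ[ℂ] E := -∑ k, D k ∘ₗ D k

lemma lowering_apply (D : Fin 2 → E →ₗ[ℂ] E) (x : E) :
    lowering D x = D 0 x + Complex.I • D 1 x := rfl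

lemma raising_apply (D : Fin 2 → E →ₗ[ℂ] E) (x : E) :
    raising D x = -(D 0 x - Complex.I • D 1 x) := rfl

lemma negLaplacian_apply (D : Fin 2 → E →ₗ[ℂ] E) (x : E) :
    negLaplacian D x = -(D 0 (D 0 x) + D 1 (D 1 x)) := by
  simp [negLaplacian]

lemma zero_apply_eq_lowering_sub_raising (D : Fin 2 → E →ₗ[ℂ] E) (x : E) :
    D 0 x = (1 / 2 : ℂ) • (lowering D x - raising D x) := by
  rw [lowering_apply, raising_apply]; module

/-- The `k`-th vector, divided by `√((2ν)^k k!)`, of the ladder that starts at `v l`. When the `v l`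
are annihilated by the lowering operator and have orthonormal images, so have these vectors. -/
def ladderVector {ι : Type*} (D : Fin 2 → E →ₗ[ℂ] E) (ν : ℝ) (v : ι → E) (i : ℕ × ι) : E :=
  ((√((2 * ν) ^ i.1 * i.1.factorial) : ℝ) : ℂ)⁻¹ • (raising D ^ i.1) (v i.2)

/-- The span of all vectors that are obtained from `V` with the raising operator. -/
def ladderSpan (D : Fin 2 → E →ₗ[ℂ] E) (V : Submodule ℂ E) : Submodule ℂ E :=
  ⨆ k : ℕ, V.map (raising D ^ k)

lemma raising_pow_mem_ladderSpan {D : Fin 2 → E →ₗ[ℂ] E} {V : Submodule ℂ E} {v : E} (hv : v ∈ V)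
    (k : ℕ) : (raising D ^ k) v ∈ ladderSpan D V :=
  Submodule.mem_iSup_of_mem k (Submodule.mem_map_of_mem hv)

lemma ladderSpan_le_iff {D : Fin 2 → E →ₗ[ℂ] E} {V W : Submodule ℂ E} :
    ladderSpan D V ≤ W ↔ ∀ k, ∀ v ∈ V, (raising D ^ k) v ∈ W := by
  rw [ladderSpan, iSup_le_iff]
  exact forall_congr' fun k => Submodule.map_le_iff_le_comap

lemma raising_mem_ladderSpan {D : Fin 2 → E →ₗ[ℂ] E} {V : Submodule ℂ E} {x : E}
    (hx : x ∈ ladderSpan D V) : raising D x ∈ ladderSpan D V := by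
  suffices ladderSpan D V ≤ (ladderSpan D V).comap (raising D) from this hx
  refine ladderSpan_le_iff.2 fun k v hv => ?_
  rw [Submodule.mem_comap, ← Module.End.mul_apply, ← pow_succ']
  exact raising_pow_mem_ladderSpan hv (k + 1)

namespace CovariantPair

variable {j : E →ₗ[ℂ] H} {D : Fin 2 → E →ₗ[ℂ] E} {ν : ℝ}

lemma inner_raising (hD : CovariantPair j D ν) (x y : E) :
    inner ℂ (j (raising D x)) (j y) = inner ℂ (j x) (j (lowering D y)) := by
  rw [raising_apply, lowering_apply]
  simp only [map_neg, map_sub, map_smul, map_add, inner_neg_left, inner_sub_left, inner_smul_left,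
    inner_add_right, inner_smul_right, hD.skew, Complex.conj_I]
  ring

lemma lowering_raising (hD : CovariantPair j D ν) (x : E) :
    lowering D (raising D x) = raising D (lowering D x) + (2 * ν : ℂ) • x := by
  simp only [raising_apply, lowering_apply, map_neg, map_sub, map_smul, map_add, hD.comm]
  match_scalars <;> ring_nf
  rw [Complex.I_sq]
  ring

lemma negLaplacian_eq_raising_lowering (hD : CovariantPair j D ν) (x : E) :
    negLaplacian D x = raising D (lowering D x) + (ν : ℂ) • x := by
  simp only [raising_apply, lowering_apply, negLaplacian_apply, map_smul, map_add, hD.comm]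
  match_scalars <;> ring_nf <;> simp

lemma lowering_raising_pow (hD : CovariantPair j D ν) {v : E} (hv : lowering D v = 0) (k : ℕ) :
    lowering D ((raising D ^ (k + 1)) v) = (2 * ν * (k + 1) : ℂ) • (raising D ^ k) v := by
  induction k with
  | zero => simp [hD.lowering_raising, hv]
  | succ k ih =>
    rw [pow_succ', Module.End.mul_apply, hD.lowering_raising, ih, map_smul,
      ← Module.End.mul_apply, ← pow_succ', ← add_smul]
    push_cast
    ring_nf

lemma negLaplacian_raising_pow (hD : CovariantPair j D ν) {v : E} (hv : lowering D v = 0)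
    (k : ℕ) :
    negLaplacian D ((raising D ^ k) v) = ((2 * k + 1) * ν : ℂ) • (raising D ^ k) v := by
  rw [hD.negLaplacian_eq_raising_lowering]
  cases k with
  | zero => simp [hv]
  | succ k =>
    rw [hD.lowering_raising_pow hv, map_smul, ← Module.End.mul_apply, ← pow_succ', ← add_smul]
    push_cast
    ring_nf

lemma inner_raising_pow (hD : CovariantPair j D ν) {v w : E} (hv : lowering D v = 0)
    (hw : lowering D w = 0) (k l : ℕ) :
    inner ℂ (j ((raising D ^ k) v)) (j ((raising D ^ l) w)) =
      if k = l then ((2 * ν) ^ k * k.factorial : ℂ) * inner ℂ (j v) (j w) else 0 := by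
  induction k generalizing l with
  | zero =>
    cases l with
    | zero => simp
    | succ l =>
      rw [pow_succ' _ l, Module.End.mul_apply, ← inner_conj_symm, hD.inner_raising]
      simp [hv]
  | succ k ih =>
    rw [pow_succ' _ k, Module.End.mul_apply, hD.inner_raising]
    cases l with
    | zero => simp [hw]
    | succ l =>
      rw [hD.lowering_raising_pow hw, map_smul, inner_smul_right, ih, mul_ite, mul_zero]
      refine ite_congr (by rw [Nat.succ_inj]) (fun hkl => ?_) fun _ => rfl
      obtain rfl : k = l := Nat.succ_injective hkl
      rw [Nat.factorial_succ]
      push_cast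
      ring

lemma lowering_mem_ladderSpan (hD : CovariantPair j D ν) {V : Submodule ℂ E}
    (hV : ∀ v ∈ V, lowering D v = 0) {x : E} (hx : x ∈ ladderSpan D V) :
    lowering D x ∈ ladderSpan D V := by
  suffices ladderSpan D V ≤ (ladderSpan D V).comap (lowering D) from this hx
  refine ladderSpan_le_iff.2 fun k v hv => ?_
  rw [Submodule.mem_comap]
  cases k with
  | zero =>
    rw [pow_zero, Module.End.one_apply, hV v hv]
    exact Submodule.zero_mem _
  | succ k =>
    rw [hD.lowering_raising_pow (hV v hv)]
    exact Submodule.smul_mem _ _ (raising_pow_mem_ladderSpan hv k)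

lemma zero_apply_mem_ladderSpan (hD : CovariantPair j D ν) {V : Submodule ℂ E}
    (hV : ∀ v ∈ V, lowering D v = 0) {x : E} (hx : x ∈ ladderSpan D V) :
    D 0 x ∈ ladderSpan D V := by
  rw [zero_apply_eq_lowering_sub_raising]
  exact Submodule.smul_mem _ _
    (Submodule.sub_mem _ (hD.lowering_mem_ladderSpan hV hx) (raising_mem_ladderSpan hx))

lemma inner_negLaplacian_right (hD : CovariantPair j D ν) (x y : E) :
    inner ℂ (j x) (j (negLaplacian D y)) = ∑ k, inner ℂ (j (D k x)) (j (D k y)) := by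
  rw [negLaplacian_apply, map_neg, map_add, inner_neg_right, inner_add_right, hD.skew 0, hD.skew 1,
    Fin.sum_univ_two, ← neg_add, neg_neg]

lemma inner_negLaplacian_left (hD : CovariantPair j D ν) (x y : E) :
    inner ℂ (j (negLaplacian D x)) (j y) = ∑ k, inner ℂ (j (D k x)) (j (D k y)) := by
  simp only [← inner_conj_symm (j (negLaplacian D x)), hD.inner_negLaplacian_right, map_sum,
    inner_conj_symm]

lemma inner_negLaplacian_self (hD : CovariantPair j D ν) (x : E) :
    inner ℂ (j x) (j (negLaplacian D x)) = ((∑ k, ‖j (D k x)‖ ^ 2 : ℝ) : ℂ) := by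
  rw [hD.inner_negLaplacian_right]
  push_cast
  exact Finset.sum_congr rfl fun k _ => inner_self_eq_norm_sq_to_K _

lemma sum_norm_sq_cov_le (hD : CovariantPair j D ν) (x : E) :
    ∑ k, ‖j (D k x)‖ ^ 2 ≤ ‖j x‖ * ‖j (negLaplacian D x)‖ := calc
  ∑ k, ‖j (D k x)‖ ^ 2 ≤ ‖inner ℂ (j x) (j (negLaplacian D x))‖ := by
    rw [hD.inner_negLaplacian_self, Complex.norm_real]
    exact Real.le_norm_self _
  _ ≤ ‖j x‖ * ‖j (negLaplacian D x)‖ := norm_inner_le_norm _ _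

lemma norm_cov_le (hD : CovariantPair j D ν) (k : Fin 2) (x : E) :
    ‖j (D k x)‖ ≤ ‖j x‖ + ‖j (negLaplacian D x)‖ := by
  refine (sq_le_sq₀ (norm_nonneg _) (by positivity)).1 ?_
  have sq_le : ‖j (D k x)‖ ^ 2 ≤ ‖j x‖ * ‖j (negLaplacian D x)‖ :=
    (Finset.single_le_sum (fun l _ => sq_nonneg ‖j (D l x)‖) (Finset.mem_univ k)).trans
      (hD.sum_norm_sq_cov_le x)
  nlinarith [norm_nonneg (j x), norm_nonneg (j (negLaplacian D x))]

lemma zero_negLaplacian (hD : CovariantPair j D ν) (x : E) :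
    D 0 (negLaplacian D x) = negLaplacian D (D 0 x) + (2 * ν * Complex.I) • D 1 x := by
  simp only [negLaplacian_apply, map_neg, map_add, hD.comm, map_smul]
  module

lemma one_negLaplacian (hD : CovariantPair j D ν) (x : E) :
    D 1 (negLaplacian D x) = negLaplacian D (D 1 x) - (2 * ν * Complex.I) • D 0 x := by
  simp only [negLaplacian_apply, map_neg, map_add, hD.comm, map_smul]
  module

lemma sum_norm_sq_cov_cov (hD : CovariantPair j D ν) (x : E) :
    ((∑ k, ∑ l, ‖j (D l (D k x))‖ ^ 2 : ℝ) : ℂ) =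
      (‖j (negLaplacian D x)‖ : ℂ) ^ 2 + 2 * ν * Complex.I *
        (inner ℂ (j (D 1 x)) (j (D 0 x)) - inner ℂ (j (D 0 x)) (j (D 1 x))) := by
  have norm_sq_eq : (‖j (negLaplacian D x)‖ : ℂ) ^ 2 =
      ∑ k, inner ℂ (j (D k x)) (j (D k (negLaplacian D x))) :=
    (inner_self_eq_norm_sq_to_K _).symm.trans (hD.inner_negLaplacian_left x _)
  rw [norm_sq_eq]
  rw [Fin.sum_univ_two, Fin.sum_univ_two (fun k => inner ℂ _ _), hD.zero_negLaplacian,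
    hD.one_negLaplacian]
  simp only [map_add, map_sub, map_smul, inner_add_right, inner_sub_right, inner_smul_right,
    hD.inner_negLaplacian_self, Complex.ofReal_add]
  ring

lemma sum_norm_sq_cov_cov_le (hD : CovariantPair j D ν) (hν : 0 ≤ ν) (x : E) :
    ∑ k, ∑ l, ‖j (D l (D k x))‖ ^ 2 ≤
      ‖j (negLaplacian D x)‖ ^ 2 + 2 * ν * (‖j x‖ * ‖j (negLaplacian D x)‖) := by
  have norm_commutator_term_le :
      ‖inner ℂ (j (D 1 x)) (j (D 0 x)) - inner ℂ (j (D 0 x)) (j (D 1 x))‖ ≤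
        ‖j x‖ * ‖j (negLaplacian D x)‖ := calc
    _ ≤ ‖j (D 1 x)‖ * ‖j (D 0 x)‖ + ‖j (D 0 x)‖ * ‖j (D 1 x)‖ :=
      (norm_sub_le _ _).trans (add_le_add (norm_inner_le_norm _ _) (norm_inner_le_norm _ _))
    _ ≤ ∑ k, ‖j (D k x)‖ ^ 2 := by
      rw [Fin.sum_univ_two]
      nlinarith [sq_nonneg (‖j (D 0 x)‖ - ‖j (D 1 x)‖)]
    _ ≤ _ := hD.sum_norm_sq_cov_le x
  calc ∑ k, ∑ l, ‖j (D l (D k x))‖ ^ 2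
      ≤ ‖((∑ k, ∑ l, ‖j (D l (D k x))‖ ^ 2 : ℝ) : ℂ)‖ := by
        rw [Complex.norm_real]
        exact Real.le_norm_self _
    _ ≤ ‖j (negLaplacian D x)‖ ^ 2 + 2 * ν *
        ‖inner ℂ (j (D 1 x)) (j (D 0 x)) - inner ℂ (j (D 0 x)) (j (D 1 x))‖ := by
      rw [hD.sum_norm_sq_cov_cov]
      refine (norm_add_le _ _).trans_eq ?_
      simp [abs_of_nonneg hν]
    _ ≤ _ := by gcongr

lemma norm_cov_cov_le (hD : CovariantPair j D ν) (hν : 0 ≤ ν) (k l : Fin 2) (x : E) :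
    ‖j (D l (D k x))‖ ≤ (1 + ν) * (‖j x‖ + ‖j (negLaplacian D x)‖) := by
  refine (sq_le_sq₀ (norm_nonneg _) (by positivity)).1 ?_
  calc ‖j (D l (D k x))‖ ^ 2
      ≤ ∑ l, ‖j (D l (D k x))‖ ^ 2 :=
        Finset.single_le_sum (fun l _ => sq_nonneg ‖j (D l (D k x))‖) (Finset.mem_univ l)
    _ ≤ ∑ k, ∑ l, ‖j (D l (D k x))‖ ^ 2 :=
        Finset.single_le_sum (f := fun k => ∑ l, ‖j (D l (D k x))‖ ^ 2)
          (fun k _ => by positivity) (Finset.mem_univ k)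
    _ ≤ ‖j (negLaplacian D x)‖ ^ 2 + 2 * ν * (‖j x‖ * ‖j (negLaplacian D x)‖) :=
        hD.sum_norm_sq_cov_cov_le hν x
    _ ≤ (‖j x‖ + ‖j (negLaplacian D x)‖) ^ 2 + 2 * ν * (‖j x‖ + ‖j (negLaplacian D x)‖) ^ 2 +
        ν ^ 2 * (‖j x‖ + ‖j (negLaplacian D x)‖) ^ 2 := by
        refine (add_le_add ?_ (mul_le_mul_of_nonneg_left ?_ (by positivity))).trans
          (le_add_of_nonneg_right (by positivity)) <;>
        nlinarith [norm_nonneg (j x), norm_nonneg (j (negLaplacian D x))]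
    _ = ((1 + ν) * (‖j x‖ + ‖j (negLaplacian D x)‖)) ^ 2 := by ring

end CovariantPair

lemma cauchySeq_of_norm_sub_le {X Y Z : Type*} [SeminormedAddCommGroup X]
    [SeminormedAddCommGroup Y] [SeminormedAddCommGroup Z] {x : ℕ → X} {y : ℕ → Y} {z : ℕ → Z}
    {K : ℝ} (hx : CauchySeq x) (hy : CauchySeq y)
    (h : ∀ p q, ‖z p - z q‖ ≤ K * (‖x p - x q‖ + ‖y p - y q‖)) : CauchySeq z := by
  rw [cauchySeq_iff_tendsto_dist_atTop_0] at hx hy ⊢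
  refine squeeze_zero (fun _ => dist_nonneg) (fun p => ?_) (by simpa using (hx.add hy).const_mul K)
  simpa only [dist_eq_norm] using h _ _

lemma exists_orthonormal_span_eq (j : E →ₗ[ℂ] H) (V : Submodule ℂ E) [FiniteDimensional ℂ V]
    (hj : ∀ v ∈ V, j v = 0 → v = 0) :
    ∃ v : Fin (Module.finrank ℂ V) → E, (Orthonormal ℂ fun l => j (v l)) ∧
      Submodule.span ℂ (Set.range v) = V := by
  have injective : Function.Injective (j.domRestrict V) :=
    (injective_iff_map_eq_zero _).2 fun v hv => Subtype.ext (hj v v.2 hv)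
  let φ := LinearEquiv.ofInjective _ injective
  let o := (stdOrthonormalBasis ℂ (j.domRestrict V).range).reindex (finCongr φ.finrank_eq.symm)
  let v := o.toBasis.map φ.symm
  have j_v (l) : j (v l) = o l := by
    change ((φ (φ.symm (o.toBasis l)) : (j.domRestrict V).range) : H) = o l
    rw [φ.apply_symm_apply, o.coe_toBasis]
  refine ⟨fun l => v l, ?_, ?_⟩
  · simp only [j_v]
    exact o.orthonormal.comp_linearIsometry (j.domRestrict V).range.subtypeₗᵢ
  · rw [Set.range_comp' (Subtype.val : V → E) v, ← Submodule.coe_subtype, Submodule.span_image,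
      v.span_eq, Submodule.map_top, Submodule.range_subtype]

namespace CovariantPair

variable {j : E →ₗ[ℂ] H} {D : Fin 2 → E →ₗ[ℂ] E} {ν : ℝ}

lemma exists_tendsto_of_mem_closure [CompleteSpace H] (hD : CovariantPair j D ν) (hν : 0 ≤ ν)
    {u f : H} (h : (u, f) ∈ closure (Set.range fun x => (j x, j (negLaplacian D x)))) :
    ∃ (x : ℕ → E) (d : Fin 2 → H) (e : Fin 2 → Fin 2 → H),
      Filter.Tendsto (fun N => j (x N)) Filter.atTop (nhds u) ∧
      (∀ k, Filter.Tendsto (fun N => j (D k (x N))) Filter.atTop (nhds (d k))) ∧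
      (∀ k l, Filter.Tendsto (fun N => j (D l (D k (x N)))) Filter.atTop (nhds (e k l))) ∧
      f = -∑ k, e k k := by
  obtain ⟨y, hy, tendsto_y⟩ := mem_closure_iff_seq_limit.1 h
  choose x hx using hy
  obtain rfl : (fun N => (j (x N), j (negLaplacian D (x N)))) = y := funext hx
  obtain ⟨tendsto_u, tendsto_f⟩ := (Prod.tendsto_iff _ _).1 tendsto_y
  have cauchySeq_cov (k) : CauchySeq fun N => j (D k (x N)) :=
    cauchySeq_of_norm_sub_le (K := 1) tendsto_u.cauchySeq tendsto_f.cauchySeq fun p q => by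
      simpa only [← map_sub, one_mul] using hD.norm_cov_le k _
  have cauchySeq_cov_cov (k l) : CauchySeq fun N => j (D l (D k (x N))) :=
    cauchySeq_of_norm_sub_le tendsto_u.cauchySeq tendsto_f.cauchySeq fun p q => by
      simpa only [← map_sub] using hD.norm_cov_cov_le hν k l _
  choose d hd using fun k => cauchySeq_tendsto_of_complete (cauchySeq_cov k)
  choose e he using fun k l => cauchySeq_tendsto_of_complete (cauchySeq_cov_cov k l)
  refine ⟨x, d, e, tendsto_u, hd, he, tendsto_nhds_unique tendsto_f ?_⟩
  refine (tendsto_finsetSum Finset.univ fun k _ => he k k).neg.congr fun N => ?_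
  simp [negLaplacian]

lemma orthonormal_ladderVector (hD : CovariantPair j D ν) (hν : 0 < ν) {ι : Type*} {v : ι → E}
    (hv : ∀ l, lowering D (v l) = 0) (ho : Orthonormal ℂ fun l => j (v l)) :
    Orthonormal ℂ fun i => j (ladderVector D ν v i) := by
  classical
  rw [orthonormal_iff_ite] at ho ⊢
  rintro ⟨k, l⟩ ⟨k', l'⟩
  simp only [ladderVector, map_smul, inner_smul_left, inner_smul_right,
    hD.inner_raising_pow (hv _) (hv _), ho, Prod.mk.injEq, ite_and]
  split_ifs with hk hl
  · subst hk
    have sq_eq : (√((2 * ν) ^ k * k.factorial) : ℂ) ^ 2 = (2 * ν) ^ k * k.factorial := by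
      exact_mod_cast congrArg Complex.ofReal (Real.sq_sqrt (by positivity))
    have : (√((2 * ν) ^ k * k.factorial) : ℂ) ≠ 0 :=
      Complex.ofReal_ne_zero.2 (Real.sqrt_ne_zero'.2 (by positivity))
    rw [map_inv₀, Complex.conj_ofReal, ← sq_eq]
    field_simp
  all_goals simp only [mul_zero]

lemma inner_eq_zero_of_mem_ladderSpan (hν : 0 < ν) {ι : Type*} {v : ι → E} {u : H}
    (hu : ∀ i, inner ℂ (j (ladderVector D ν v i)) u = 0) {x : E}
    (hx : x ∈ ladderSpan D (Submodule.span ℂ (Set.range v))) : inner ℂ (j x) u = 0 := by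
  suffices ladderSpan D (Submodule.span ℂ (Set.range v)) ≤
    ((innerSL ℂ u).toLinearMap ∘ₗ j).ker from inner_eq_zero_symm.1 (this hx)
  refine iSup_le fun k => ?_
  rw [Submodule.map_span_le]
  rintro _ ⟨l, rfl⟩
  have normalization_ne_zero : (√((2 * ν) ^ k * k.factorial) : ℂ)⁻¹ ≠ 0 :=
    inv_ne_zero (Complex.ofReal_ne_zero.2 (Real.sqrt_ne_zero'.2 (by positivity)))
  have := inner_eq_zero_symm.1 (hu (k, l))
  rw [ladderVector, map_smul, inner_smul_right] at this
  exact (mul_eq_zero.1 this).resolve_left normalization_ne_zero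

lemma exists_ladder_basis [CompleteSpace H] (hD : CovariantPair j D ν) (hν : 0 < ν)
    {V : Submodule ℂ E} [FiniteDimensional ℂ V] (hV : ∀ v ∈ V, lowering D v = 0)
    (hj : ∀ v ∈ V, j v = 0 → v = 0)
    (total : ∀ u : H, (∀ x ∈ ladderSpan D V, inner ℂ (j x) u = 0) → u = 0) :
    ∃ (b : HilbertBasis (ℕ × Fin (Module.finrank ℂ V)) ℂ H)
      (e : ℕ × Fin (Module.finrank ℂ V) → E), (∀ i, b i = j (e i)) ∧
      (∀ i, negLaplacian D (e i) = ((2 * i.1 + 1) * ν : ℂ) • e i) ∧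
      Submodule.span ℂ (Set.range fun l => e (0, l)) = V := by
  obtain ⟨v, orthonormal_v, span_v⟩ := exists_orthonormal_span_eq j V hj
  have lowering_v (l) : lowering D (v l) = 0 :=
    hV _ (span_v.le (Submodule.subset_span (Set.mem_range_self l)))
  refine ⟨HilbertBasis.mkOfOrthogonalEqBot
      (hD.orthonormal_ladderVector hν lowering_v orthonormal_v) ?_,
    ladderVector D ν v,
    congrFun (HilbertBasis.coe_mkOfOrthogonalEqBot _ _), fun i => ?_,
    by simpa [ladderVector] using span_v⟩
  · refine (Submodule.eq_bot_iff _).2 fun u hu => total u fun x hx =>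
      inner_eq_zero_of_mem_ladderSpan hν (fun i => ?_) (span_v.symm ▸ hx)
    exact (Submodule.mem_orthogonal _ _).1 hu _ (Submodule.subset_span (Set.mem_range_self i))
  · rw [ladderVector, map_smul, hD.negLaplacian_raising_pow (lowering_v _), smul_comm]

end CovariantPair

end Ladder

/-! ### Weak derivatives -/

section WeakDerivative

lemma contDiff_fderiv_apply_const {E F : Type*} [NormedAddCommGroup E] [NormedSpace ℝ E]
    [NormedAddCommGroup F] [NormedSpace ℝ F] {f : E → F} (hf : ContDiff ℝ ∞ f) (v : E) :
    ContDiff ℝ ∞ fun x => fderiv ℝ f x v :=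
  (hf.fderiv_right (by simp)).clm_apply contDiff_const

lemma fderiv_re_apply {E : Type*} [NormedAddCommGroup E] [NormedSpace ℝ E] {f : E → ℂ} {x : E}
    (hf : DifferentiableAt ℝ f x) (v : E) :
    fderiv ℝ (fun x => (f x).re) x v = (fderiv ℝ f x v).re :=
  congrArg (· v) (Complex.reCLM.hasFDerivAt.comp x hf.hasFDerivAt).fderiv

lemma fderiv_im_apply {E : Type*} [NormedAddCommGroup E] [NormedSpace ℝ E] {f : E → ℂ} {x : E}
    (hf : DifferentiableAt ℝ f x) (v : E) :
    fderiv ℝ (fun x => (f x).im) x v = (fderiv ℝ f x v).im :=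
  congrArg (· v) (Complex.imCLM.hasFDerivAt.comp x hf.hasFDerivAt).fderiv

lemma mul_eq_re_smul_add_I_mul (w z : ℂ) : w * z = w.re • z + Complex.I * (w.im • z) := by
  conv_lhs => rw [← Complex.re_add_im w]
  simp only [Complex.real_smul]
  ring

lemma locallyIntegrable_mul {f a : ℂ → ℂ} (hf : LocallyIntegrable f) (ha : Continuous a) :
    LocallyIntegrable fun x => a x * f x :=
  locallyIntegrable_iff.2 fun _ hK =>
    (hf.integrableOn_isCompact hK).continuousOn_mul ha.continuousOn hK

lemma integrable_mul_of_hasCompactSupport {f φ : ℂ → ℂ} (hf : LocallyIntegrable f)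
    (hφ : Continuous φ) (support_φ : HasCompactSupport φ) : Integrable fun x => φ x * f x := by
  simpa only [smul_eq_mul] using hf.integrable_smul_left_of_hasCompactSupport hφ support_φ

lemma locallyIntegrable_comp_add {f : ℂ → ℂ} (hf : LocallyIntegrable f) (t : ℂ) :
    LocallyIntegrable fun x => f (x + t) := by
  rw [locallyIntegrable_iff] at hf ⊢
  intro K hK
  exact ((measurePreserving_add_right volume t).integrableOn_image
    (Homeomorph.addRight t).measurableEmbedding).1 (hf _ (hK.image (continuous_add_const t)))

lemma HasWeakPartial.integral_mul {j : Fin 2} {f g : ℂ → ℂ} (h : HasWeakPartial j f g)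
    {φ : ℂ → ℂ} (hφ : ContDiff ℝ ∞ φ) (support_φ : HasCompactSupport φ) :
    ∫ x, fderiv ℝ φ x (basisVec j) * f x = -∫ x, φ x * g x := by
  have diff_φ (x) : DifferentiableAt ℝ φ x := hφ.differentiable (by simp) x
  have re_φ : ContDiff ℝ ∞ fun x => (φ x).re := Complex.reCLM.contDiff.comp hφ
  have im_φ : ContDiff ℝ ∞ fun x => (φ x).im := Complex.imCLM.contDiff.comp hφ
  have support_re : HasCompactSupport fun x => (φ x).re :=
    support_φ.comp_left (g := Complex.re) rfl
  have support_im : HasCompactSupport fun x => (φ x).im :=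
    support_φ.comp_left (g := Complex.im) rfl
  simp_rw [fun x => mul_eq_re_smul_add_I_mul (fderiv ℝ φ x (basisVec j)),
    fun x => mul_eq_re_smul_add_I_mul (φ x), ← fderiv_re_apply (diff_φ _),
    ← fderiv_im_apply (diff_φ _)]
  rw [integral_add (integrable_test_deriv j h.1 re_φ support_re)
      ((integrable_test_deriv j h.1 im_φ support_im).const_mul _),
    integral_add (integrable_test h.2.1 re_φ.continuous support_re)
      ((integrable_test h.2.1 im_φ.continuous support_im).const_mul _),
    integral_const_mul, integral_const_mul, h.2.2 _ re_φ support_re, h.2.2 _ im_φ support_im]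
  ring

lemma HasWeakPartial.of_contDiff (j : Fin 2) {f : ℂ → ℂ} (hf : ContDiff ℝ ∞ f) :
    HasWeakPartial j f fun x => fderiv ℝ f x (basisVec j) := by
  have locInt_f := hf.continuous.locallyIntegrable (μ := volume)
  have locInt_deriv := (contDiff_fderiv_apply_const hf (basisVec j)).continuous.locallyIntegrable
    (μ := volume)
  refine ⟨locInt_f, locInt_deriv, fun φ hφ support_φ => ?_⟩
  have by_parts := integral_bilinear_fderiv_right_eq_neg_left_of_integrable
    (B := ContinuousLinearMap.lsmul ℝ ℝ) (integrable_test_deriv j locInt_f hφ support_φ)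
    (integrable_test locInt_deriv hφ.continuous support_φ)
    (integrable_test locInt_f hφ.continuous support_φ)
    (fun x _ => hφ.differentiable (by simp) x) (fun x _ => hf.differentiable (by simp) x)
  simp only [ContinuousLinearMap.lsmul_apply] at by_parts
  rw [by_parts, neg_neg]

lemma HasWeakPartial.mul {j : Fin 2} {f g a : ℂ → ℂ} (h : HasWeakPartial j f g)
    (ha : ContDiff ℝ ∞ a) :
    HasWeakPartial j (fun x => a x * f x)
      fun x => fderiv ℝ a x (basisVec j) * f x + a x * g x := by
  have cont_deriv := (contDiff_fderiv_apply_const ha (basisVec j)).continuous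
  have locInt_deriv_mul := locallyIntegrable_mul h.1 cont_deriv
  have locInt_mul := locallyIntegrable_mul h.1 ha.continuous
  have locInt_mul' := locallyIntegrable_mul h.2.1 ha.continuous
  refine ⟨locInt_mul, locInt_deriv_mul.add locInt_mul', fun φ hφ support_φ => ?_⟩
  have fderiv_smul_apply_mul (x) : fderiv ℝ (fun x => φ x • a x) x (basisVec j) * f x =
      φ x • (fderiv ℝ a x (basisVec j) * f x) + fderiv ℝ φ x (basisVec j) • (a x * f x) := by
    rw [fderiv_fun_smul (hφ.differentiable (by simp) x) (ha.differentiable (by simp) x)]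
    simp only [add_apply, smul_apply,
      ContinuousLinearMap.smulRight_apply, Complex.real_smul]
    ring
  have by_parts := h.integral_mul (φ := fun x => φ x • a x) (hφ.smul ha) support_φ.smul_right
  have integrable_deriv_mul := integrable_test locInt_deriv_mul hφ.continuous support_φ
  simp only [fderiv_smul_apply_mul, smul_mul_assoc] at by_parts
  rw [integral_add integrable_deriv_mul (integrable_test_deriv j locInt_mul hφ support_φ)]
    at by_parts
  simp only [smul_add]
  rw [integral_add integrable_deriv_mul (integrable_test locInt_mul' hφ.continuous support_φ)]
  linear_combination by_parts

lemma HasWeakPartial.comp_add {j : Fin 2} {f g : ℂ → ℂ} (h : HasWeakPartial j f g) (t : ℂ) :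
    HasWeakPartial j (fun x => f (x + t)) fun x => g (x + t) := by
  refine ⟨locallyIntegrable_comp_add h.1 t, locallyIntegrable_comp_add h.2.1 t,
    fun φ hφ support_φ => ?_⟩
  have support_sub : HasCompactSupport fun x => φ (x - t) := by
    simpa only [sub_eq_add_neg] using! support_φ.comp_homeomorph (Homeomorph.addRight (-t))
  have by_parts := h.2.2 (fun x => φ (x - t)) (hφ.comp (contDiff_id.sub contDiff_const)) support_sub
  rw [← integral_add_right_eq_self _ t,
    ← integral_add_right_eq_self (fun x => φ (x - t) • g x) t] at by_parts
  simpa [fderiv_comp_sub] using! by_parts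

lemma HasWeakPartial.unique {j : Fin 2} {f g g' : ℂ → ℂ} (h : HasWeakPartial j f g)
    (h' : HasWeakPartial j f g') : g =ᵐ[volume] g' := by
  filter_upwards [(h.add (h'.smul (-1))).eq_zero (.of_forall fun x => by simp)] with x hx
  simpa [← sub_eq_add_neg, sub_eq_zero] using hx

lemma MemL2Loc.locallyIntegrable {f : ℂ → ℂ} (hf : MemL2Loc f) : LocallyIntegrable f := by
  rw [locallyIntegrable_iff]
  intro K hK
  have : IsFiniteMeasure ((volume : Measure ℂ).restrict K) := ⟨by simpa using hK.measure_lt_top⟩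
  exact (hf K hK).integrable (by norm_num)

lemma MemL2Loc.mul {f a : ℂ → ℂ} (hf : MemL2Loc f) (ha : Continuous a) :
    MemL2Loc fun x => a x * f x := by
  intro K hK
  obtain ⟨C, a_le⟩ := hK.exists_bound_of_continuousOn ha.continuousOn
  refine (hf K hK).of_le_mul (c := C) (ha.aestronglyMeasurable.mul (hf K hK).1) ?_
  filter_upwards [ae_restrict_mem hK.measurableSet] with x hx
  rw [norm_mul]
  exact mul_le_mul_of_nonneg_right (a_le x hx) (norm_nonneg _)

end WeakDerivative

/-! ### Integration over the cell -/

section Cell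

open scoped ENNReal

lemma isAddFundamentalDomain_cell (τ : ℍ) :
    IsAddFundamentalDomain (lattice τ) (cell τ) (volume : Measure ℂ) := by
  have vadd_eq (t : lattice τ) (x : ℂ) : t +ᵥ x = x + t := add_comm _ _
  refine .mk' (measurableSet_cell τ).nullMeasurableSet fun x => ⟨-latticeFloor τ x, ?_,
    fun t ht => ?_⟩
  · simpa [vadd_eq, sub_eq_add_neg] using sub_latticeFloor_mem τ x
  · have add_mem : t +ᵥ x ∈ cell τ := ht
    rw [vadd_eq] at add_mem
    have floor_eq := latticeFloor_of_mem add_mem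
    rw [latticeFloor_add] at floor_eq
    exact (neg_eq_of_add_eq_zero_right floor_eq).symm

lemma continuous_coordQ (τ : ℍ) : Continuous (coordQ τ) := by
  unfold coordQ; fun_prop

lemma continuous_coordP (τ : ℍ) : Continuous (coordP τ) := by
  have := continuous_coordQ τ
  unfold coordP; fun_prop

lemma mem_Icc_of_abs_add_intCast_le {a M : ℝ} (ha : a ∈ Set.Ico (0 : ℝ) 1) {p : ℤ}
    (hp : |a + p| ≤ M) : p ∈ Finset.Icc (-⌈M⌉ - 1) ⌈M⌉ := by
  obtain ⟨le_add, add_le⟩ := abs_le.1 hp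
  have le_ceil := Int.le_ceil M
  have le_p : (-⌈M⌉ - 1 : ℝ) ≤ p := by linarith [ha.2]
  have p_le : (p : ℝ) ≤ ⌈M⌉ := by linarith [ha.1]
  exact Finset.mem_Icc.2 ⟨mod_cast le_p, mod_cast p_le⟩

lemma exists_finset_lattice_of_isCompact (τ : ℍ) {K : Set ℂ} (hK : IsCompact K) :
    ∃ F : Finset (lattice τ), ∀ x ∈ cell τ, ∀ t : lattice τ, x + (t : ℂ) ∈ K → t ∈ F := by
  classical
  obtain ⟨M, coordP_le⟩ := hK.exists_bound_of_continuousOn (continuous_coordP τ).continuousOn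
  obtain ⟨M', coordQ_le⟩ := hK.exists_bound_of_continuousOn (continuous_coordQ τ).continuousOn
  refine ⟨(Finset.Icc (-⌈M⌉ - 1) ⌈M⌉ ×ˢ Finset.Icc (-⌈M'⌉ - 1) ⌈M'⌉).image
    fun pq => latticePt τ pq.1 pq.2, ?_⟩
  rintro x hx ⟨_, p, q, rfl⟩ hxK
  obtain ⟨coordP_add, coordQ_add⟩ := coord_add_lattice τ x p q
  obtain ⟨coordP_mem, coordQ_mem⟩ := (mem_cell_iff τ x).1 hx
  exact Finset.mem_image.2 ⟨(p, q), Finset.mem_product.2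
    ⟨mem_Icc_of_abs_add_intCast_le coordP_mem (coordP_add ▸ coordP_le _ hxK),
      mem_Icc_of_abs_add_intCast_le coordQ_mem (coordQ_add ▸ coordQ_le _ hxK)⟩, rfl⟩

lemma exists_setLIntegral_le_cell (τ : ℍ) {K : Set ℂ} (hK : IsCompact K) :
    ∃ N : ℕ, ∀ w : ℂ → ℝ≥0∞, (∀ t : lattice τ, ∀ᵐ x, w (x + (t : ℂ)) = w x) →
      ∫⁻ x in K, w x ≤ N * ∫⁻ x in cell τ, w x := by
  obtain ⟨F, mem_F⟩ := exists_finset_lattice_of_isCompact τ hK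
  refine ⟨F.card, fun w hw => ?_⟩
  have translate_le (t : lattice τ) :
      ∫⁻ x in cell τ, K.indicator w (t +ᵥ x) ≤ ∫⁻ x in cell τ, w x := by
    refine lintegral_mono_ae (ae_restrict_of_ae ?_)
    filter_upwards [hw t] with x hx
    exact (Set.indicator_le_self _ _ _).trans_eq ((congrArg w (add_comm _ _)).trans hx)
  have translate_eq_zero (t : lattice τ) (ht : t ∉ F) :
      ∫⁻ x in cell τ, K.indicator w (t +ᵥ x) = 0 := by
    refine (setLIntegral_congr_fun (measurableSet_cell τ) fun x hx => ?_).trans lintegral_zero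
    refine Set.indicator_of_notMem (fun hxK => ht (mem_F x hx t ?_)) _
    rwa [add_comm]
  calc ∫⁻ x in K, w x = ∑' t : lattice τ, ∫⁻ x in cell τ, K.indicator w (t +ᵥ x) := by
        rw [← lintegral_indicator hK.measurableSet,
          (isAddFundamentalDomain_cell τ).lintegral_eq_tsum'']
    _ = ∑ t ∈ F, ∫⁻ x in cell τ, K.indicator w (t +ᵥ x) := tsum_eq_sum fun t => translate_eq_zero t
    _ ≤ ∑ _t ∈ F, ∫⁻ x in cell τ, w x := Finset.sum_le_sum fun t _ => translate_le t
    _ = F.card * ∫⁻ x in cell τ, w x := by rw [Finset.sum_const, nsmul_eq_mul]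

lemma exists_isCompact_cell_subset (τ : ℍ) : ∃ K : Set ℂ, IsCompact K ∧ cell τ ⊆ K := by
  refine ⟨(fun z : ℝ × ℝ => pt τ z.1 z.2) '' (Set.Icc 0 1 ×ˢ Set.Icc 0 1), ?_, ?_⟩
  · exact (isCompact_Icc.prod isCompact_Icc).image (by unfold pt; fun_prop)
  · rintro _ ⟨p, hp, q, hq, rfl⟩
    exact ⟨(p, q), ⟨Set.Ico_subset_Icc_self hp, Set.Ico_subset_Icc_self hq⟩, rfl⟩

instance isFiniteMeasure_cell (τ : ℍ) :
    IsFiniteMeasure ((volume : Measure ℂ).restrict (cell τ)) := by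
  obtain ⟨K, hK, cell_subset⟩ := exists_isCompact_cell_subset τ
  exact ⟨by simpa using (measure_mono cell_subset).trans_lt hK.measure_lt_top⟩

end Cell

/-! ### Gauge-periodic functions in `L²_loc` -/

section GaugePeriodic

open scoped ENNReal NNReal Topology

open Filter

variable {τ : ℍ} {n : ℕ} {γ : GaugePhase τ n}

lemma norm_gaugeFactor (γ : GaugePhase τ n) (t : lattice τ) (x : ℂ) : ‖gaugeFactor γ t x‖ = 1 := by
  rw [gaugeFactor, mul_comm, Complex.norm_exp_ofReal_mul_I]

lemma IsGaugePeriodic.enorm {f : ℂ → ℂ} (h : IsGaugePeriodic γ f) (t : lattice τ) :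
    ∀ᵐ x, ‖f (x + (t : ℂ))‖ₑ = ‖f x‖ₑ := by
  filter_upwards [h t] with x hx
  rw [hx, enorm_mul, ← ofReal_norm (gaugeFactor γ t x), norm_gaugeFactor, ENNReal.ofReal_one,
    one_mul]

lemma IsGaugePeriodic.congr {f g : ℂ → ℂ} (h : IsGaugePeriodic γ f) (hfg : f =ᵐ[volume] g) :
    IsGaugePeriodic γ g := by
  intro t
  have translate_eq :=
    (measurePreserving_add_right (volume : Measure ℂ) (t : ℂ)).quasiMeasurePreserving.ae hfg
  filter_upwards [h t, hfg, translate_eq] with x periodic eq_x eq_translate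
  rw [← eq_x, ← eq_translate, periodic]

lemma memL2Loc_coe (u : GaugeL2 γ) : MemL2Loc u.1 := by
  intro K hK
  obtain ⟨N, le_cell⟩ := exists_setLIntegral_le_cell τ hK
  have le_cell_sq := le_cell (fun x => ‖u.1 x‖ₑ ^ (2 : ℝ)) fun t => by
    filter_upwards [u.2.1.enorm t] with x hx
    rw [hx]
  have cell_lt_top :=
    (eLpNorm_lt_top_iff_lintegral_rpow_enorm_lt_top (by norm_num) (by norm_num)).1 u.2.2.2
  refine ⟨u.1.aestronglyMeasurable.restrict,
    (eLpNorm_lt_top_iff_lintegral_rpow_enorm_lt_top (by norm_num) (by norm_num)).2 ?_⟩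
  exact le_cell_sq.trans_lt (ENNReal.mul_lt_top (by simp) cell_lt_top)

lemma locallyIntegrable_coe (u : GaugeL2 γ) : LocallyIntegrable u.1 :=
  (memL2Loc_coe u).locallyIntegrable

lemma exists_gaugeL2 {f : ℂ → ℂ} (periodic : IsGaugePeriodic γ f) (hf : MemL2Loc f) :
    ∃ u : GaugeL2 γ, u.1 =ᵐ[volume] f := by
  have measurable_f : AEStronglyMeasurable f volume := hf.locallyIntegrable.aestronglyMeasurable
  have coe_eq := AEEqFun.coeFn_mk f measurable_f
  obtain ⟨K, hK, cell_subset⟩ := exists_isCompact_cell_subset τ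
  exact ⟨⟨AEEqFun.mk f measurable_f, periodic.congr coe_eq.symm,
    (memLp_congr_ae (ae_restrict_of_ae coe_eq)).2
      ((hf K hK).mono_measure (Measure.restrict_mono_set _ cell_subset))⟩, coe_eq⟩

lemma enorm_gaugeL2 (u : GaugeL2 γ) : ‖u‖ₑ = eLpNorm u.1 2 (volume.restrict (cell τ)) :=
  Lp.enorm_toLp u.2.2

lemma exists_setLIntegral_enorm_le (γ : GaugePhase τ n) {K : Set ℂ} (hK : IsCompact K) :
    ∃ C : ℝ≥0, ∀ u : GaugeL2 γ, ∫⁻ x in K, ‖u.1 x‖ₑ ≤ C * ‖u‖ₑ := by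
  obtain ⟨N, le_cell⟩ := exists_setLIntegral_le_cell τ hK
  set V : ℝ≥0∞ :=
    volume.restrict (cell τ) Set.univ ^ (1 / (1 : ℝ≥0∞).toReal - 1 / (2 : ℝ≥0∞).toReal)
  have V_ne_top : V ≠ ⊤ := (ENNReal.rpow_lt_top_of_nonneg (by norm_num) (measure_ne_top _ _)).ne
  refine ⟨N * V.toNNReal, fun u => ?_⟩
  calc ∫⁻ x in K, ‖u.1 x‖ₑ ≤ N * ∫⁻ x in cell τ, ‖u.1 x‖ₑ := le_cell _ fun t => u.2.1.enorm t
    _ = N * eLpNorm u.1 1 (volume.restrict (cell τ)) := by rw [eLpNorm_one_eq_lintegral_enorm]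
    _ ≤ N * (eLpNorm u.1 2 (volume.restrict (cell τ)) * V) := by
        gcongr
        exact eLpNorm_le_eLpNorm_mul_rpow_measure_univ (by norm_num) u.2.2.1
    _ = (N * V.toNNReal : ℝ≥0) * ‖u‖ₑ := by
        rw [enorm_gaugeL2, ENNReal.coe_mul, ENNReal.coe_toNNReal V_ne_top, ENNReal.coe_natCast]
        ring

lemma lintegral_enorm_mul_le_setLIntegral {X : Type*} [TopologicalSpace X] [MeasurableSpace X]
    {μ : Measure X} {φ : X → ℂ} {B : ℝ≥0} (hB : ∀ x, ‖φ x‖ₑ ≤ B) (f : X → ℂ) :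
    ∫⁻ x, ‖φ x * f x‖ₑ ∂μ ≤ B * ∫⁻ x in tsupport φ, ‖f x‖ₑ ∂μ := by
  have support_subset : (Function.support fun x => ‖φ x * f x‖ₑ) ⊆ tsupport φ := fun x hx =>
    subset_tsupport φ fun φ_eq => hx (by simp [φ_eq])
  rw [← setLIntegral_eq_of_support_subset support_subset,
    ← lintegral_const_mul' _ _ ENNReal.coe_ne_top]
  exact lintegral_mono fun x => by rw [enorm_mul]; gcongr; exact hB x

lemma exists_norm_integral_mul_le (γ : GaugePhase τ n) {φ : ℂ → ℂ} (hφ : Continuous φ)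
    (support_φ : HasCompactSupport φ) :
    ∃ C : ℝ, ∀ u : GaugeL2 γ, ‖∫ x, φ x * u.1 x‖ ≤ C * ‖u‖ := by
  obtain ⟨C, le_enorm⟩ := exists_setLIntegral_enorm_le γ support_φ.isCompact
  obtain ⟨B, φ_le⟩ := hφ.bounded_above_of_compact_support support_φ
  have enorm_φ_le (x) : ‖φ x‖ₑ ≤ B.toNNReal := by
    rw [← ofReal_norm]
    exact ENNReal.ofReal_le_ofReal (φ_le x)
  refine ⟨(B.toNNReal * C : ℝ≥0), fun u => ?_⟩
  have enorm_le : ‖∫ x, φ x * u.1 x‖ₑ ≤ (B.toNNReal * C : ℝ≥0) * ‖u‖ₑ := by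
    rw [ENNReal.coe_mul, mul_assoc]
    exact (enorm_integral_le_lintegral_enorm _).trans
      ((lintegral_enorm_mul_le_setLIntegral enorm_φ_le _).trans (by gcongr; exact le_enorm u))
  simp only [enorm_eq_nnnorm] at enorm_le
  exact mod_cast enorm_le

lemma tendsto_integral_mul {φ : ℂ → ℂ} (hφ : Continuous φ) (support_φ : HasCompactSupport φ)
    {u : ℕ → GaugeL2 γ} {v : GaugeL2 γ} (hu : Tendsto u atTop (𝓝 v)) :
    Tendsto (fun N => ∫ x, φ x * (u N).1 x) atTop (𝓝 (∫ x, φ x * v.1 x)) := by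
  obtain ⟨C, le_norm⟩ := exists_norm_integral_mul_le γ hφ support_φ
  rw [tendsto_iff_norm_sub_tendsto_zero] at hu ⊢
  refine squeeze_zero (fun _ => norm_nonneg _) (fun N => ?_) (by simpa using hu.const_mul C)
  refine le_of_eq_of_le (congrArg norm ?_) (le_norm (u N - v))
  rw [← integral_sub
    (integrable_mul_of_hasCompactSupport (locallyIntegrable_coe _) hφ support_φ)
    (integrable_mul_of_hasCompactSupport (locallyIntegrable_coe _) hφ support_φ)]
  refine integral_congr_ae ?_
  filter_upwards [AEEqFun.coeFn_sub (u N).1 v.1] with x hx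
  rw [← mul_sub]
  exact congrArg (φ x * ·) hx.symm

lemma contDiff_potential (n : ℕ) (j : Fin 2) : ContDiff ℝ ∞ (potential n j) := by
  have contDiff_re : ContDiff ℝ ∞ Complex.re := Complex.reCLM.contDiff
  have contDiff_im : ContDiff ℝ ∞ Complex.im := Complex.imCLM.contDiff
  unfold potential dot perp
  fun_prop

lemma contDiff_I_mul_potential (n : ℕ) (j : Fin 2) :
    ContDiff ℝ ∞ fun x => Complex.I * (potential n j x : ℂ) :=
  contDiff_const.mul (Complex.ofRealCLM.contDiff.comp (contDiff_potential n j))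

lemma integral_smul_cov_eq {j : Fin 2} {φ : ℂ → ℝ} (hφ : Continuous φ)
    (support_φ : HasCompactSupport φ) (v w : GaugeL2 γ) :
    ∫ x, φ x • (w.1 x + Complex.I * (potential n j x : ℂ) * v.1 x) = (∫ x, (φ x : ℂ) * w.1 x) +
      ∫ x, ((φ x : ℂ) * (Complex.I * (potential n j x : ℂ))) * v.1 x := by
  have cont_φ : Continuous fun x => (φ x : ℂ) := Complex.continuous_ofReal.comp hφ
  have support_φ' : HasCompactSupport fun x => (φ x : ℂ) :=
    support_φ.comp_left (g := ((↑) : ℝ → ℂ)) rfl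
  rw [← integral_add
    (integrable_mul_of_hasCompactSupport (locallyIntegrable_coe w) cont_φ support_φ')
    (integrable_mul_of_hasCompactSupport
      (φ := fun x => (φ x : ℂ) * (Complex.I * (potential n j x : ℂ))) (locallyIntegrable_coe v)
      (cont_φ.mul (contDiff_I_mul_potential n j).continuous) support_φ'.mul_right)]
  refine integral_congr_ae (.of_forall fun x => ?_)
  simp only [Complex.real_smul]
  ring

lemma hasWeakCovDeriv_of_tendsto {j : Fin 2} {u d : ℕ → GaugeL2 γ} {v e : GaugeL2 γ}
    (hu : Tendsto u atTop (𝓝 v)) (hd : Tendsto d atTop (𝓝 e))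
    (h : ∀ N, HasWeakCovDeriv n j (u N).1 (d N).1) : HasWeakCovDeriv n j v.1 e.1 := by
  have cont_potential := (contDiff_I_mul_potential n j).continuous
  refine ⟨locallyIntegrable_coe v, (locallyIntegrable_coe e).add
    (locallyIntegrable_mul (locallyIntegrable_coe v) cont_potential), fun φ hφ support_φ => ?_⟩
  have cont_φ : Continuous fun x => (φ x : ℂ) := Complex.continuous_ofReal.comp hφ.continuous
  have support_φ' : HasCompactSupport fun x => (φ x : ℂ) :=
    support_φ.comp_left (g := ((↑) : ℝ → ℂ)) rfl
  have tendsto_left := tendsto_integral_mul (φ := fun x => (fderiv ℝ φ x (basisVec j) : ℂ))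
    (Complex.continuous_ofReal.comp (contDiff_fderiv_apply_const hφ _).continuous)
    ((support_φ.fderiv_apply ℝ _).comp_left (g := ((↑) : ℝ → ℂ)) rfl) hu
  have tendsto_right := ((tendsto_integral_mul cont_φ support_φ' hd).add
    (tendsto_integral_mul (φ := fun x => (φ x : ℂ) * (Complex.I * (potential n j x : ℂ)))
      (cont_φ.mul cont_potential) support_φ'.mul_right hu)).neg
  have limits_eq := tendsto_nhds_unique tendsto_left (tendsto_right.congr fun N => ?_)
  · rw [integral_smul_cov_eq hφ.continuous support_φ]
    simpa only [Complex.real_smul] using limits_eq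
  · rw [← integral_smul_cov_eq hφ.continuous support_φ, ← (h N).2.2 φ hφ support_φ]
    simp only [Complex.real_smul]

end GaugePeriodic

/-! ### A partition of unity by lattice translates -/

section PartitionOfUnity

open scoped Topology

variable {τ : ℍ}

/-- A smooth bump on the line whose integer translates sum up to one. -/
def lineBump (s : ℝ) : ℝ := Real.smoothTransition (s + 1) - Real.smoothTransition s

/-- A smooth compactly supported function on the plane whose lattice translates sum up to one. It
turns integrals over the plane against test functions into integrals over the cell. -/
def latticeBump (τ : ℍ) (x : ℂ) : ℝ := lineBump (coordP τ x) * lineBump (coordQ τ x)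

lemma lineBump_eq_zero {s : ℝ} (hs : 1 < |s|) : lineBump s = 0 := by
  rcases lt_abs.1 hs with one_lt | one_lt_neg
  · rw [lineBump, Real.smoothTransition.one_of_one_le (by linarith),
      Real.smoothTransition.one_of_one_le one_lt.le, sub_self]
  · rw [lineBump, Real.smoothTransition.zero_of_nonpos (by linarith),
      Real.smoothTransition.zero_of_nonpos (by linarith), sub_self]

lemma sum_lineBump {s : ℝ} (hs : s ∈ Set.Icc (-1 : ℝ) 2) :
    ∑ p ∈ Finset.Icc (-2 : ℤ) 1, lineBump (s + p) = 1 := by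
  have Icc_eq : Finset.Icc (-2 : ℤ) 1 = (Finset.range 4).image fun k : ℕ => (k : ℤ) - 2 := by
    decide
  calc ∑ p ∈ Finset.Icc (-2 : ℤ) 1, lineBump (s + p)
      = ∑ k ∈ Finset.range 4, (Real.smoothTransition (s - 2 + (k + 1 : ℕ)) -
          Real.smoothTransition (s - 2 + (k : ℕ))) := by
        rw [Icc_eq, Finset.sum_image (by intro k _ l _ h; simpa using h)]
        refine Finset.sum_congr rfl fun k _ => ?_
        rw [lineBump]
        push_cast
        ring_nf
    _ = Real.smoothTransition (s - 2 + (4 : ℕ)) - Real.smoothTransition (s - 2 + (0 : ℕ)) :=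
        Finset.sum_range_sub (fun k : ℕ => Real.smoothTransition (s - 2 + k)) 4
    _ = 1 := by
        rw [Real.smoothTransition.one_of_one_le (by push_cast; linarith [hs.1]),
          Real.smoothTransition.zero_of_nonpos (by push_cast; linarith [hs.2]), sub_zero]

lemma contDiff_lineBump : ContDiff ℝ ∞ lineBump :=
  (Real.smoothTransition.contDiff.comp (contDiff_id.add contDiff_const)).sub
    Real.smoothTransition.contDiff

lemma contDiff_coordQ (τ : ℍ) : ContDiff ℝ ∞ (coordQ τ) := by
  have contDiff_im : ContDiff ℝ ∞ Complex.im := Complex.imCLM.contDiff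
  unfold coordQ; fun_prop

lemma contDiff_coordP (τ : ℍ) : ContDiff ℝ ∞ (coordP τ) := by
  have contDiff_re : ContDiff ℝ ∞ Complex.re := Complex.reCLM.contDiff
  have := contDiff_coordQ τ
  unfold coordP; fun_prop

lemma contDiff_latticeBump (τ : ℍ) : ContDiff ℝ ∞ (latticeBump τ) :=
  (contDiff_lineBump.comp (contDiff_coordP τ)).mul (contDiff_lineBump.comp (contDiff_coordQ τ))

lemma tsupport_latticeBump_subset (τ : ℍ) :
    tsupport (latticeBump τ) ⊆ {x | |coordP τ x| ≤ 1 ∧ |coordQ τ x| ≤ 1} := by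
  refine closure_minimal (fun x hx => ⟨?_, ?_⟩) ?_
  · by_contra! one_lt
    exact hx (by rw [latticeBump, lineBump_eq_zero one_lt, zero_mul])
  · by_contra! one_lt
    exact hx (by rw [latticeBump, lineBump_eq_zero (s := coordQ τ x) one_lt, mul_zero])
  · exact (isClosed_le (continuous_coordP τ).abs continuous_const).inter
      (isClosed_le (continuous_coordQ τ).abs continuous_const)

lemma hasCompactSupport_latticeBump (τ : ℍ) : HasCompactSupport (latticeBump τ) := by
  have compact_image :
      IsCompact ((fun z : ℝ × ℝ => pt τ z.1 z.2) '' (Set.Icc (-1) 1 ×ˢ Set.Icc (-1) 1)) :=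
    (isCompact_Icc.prod isCompact_Icc).image (by unfold pt; fun_prop)
  refine compact_image.of_isClosed_subset (isClosed_tsupport _) fun x hx => ?_
  obtain ⟨coordP_le, coordQ_le⟩ := tsupport_latticeBump_subset τ hx
  exact ⟨(coordP τ x, coordQ τ x), ⟨abs_le.1 coordP_le, abs_le.1 coordQ_le⟩, pt_coord τ x⟩

lemma latticePt_injective (τ : ℍ) :
    Function.Injective fun pq : ℤ × ℤ => latticePt τ pq.1 pq.2 := by
  rintro ⟨p, q⟩ ⟨p', q'⟩ h
  have pt_eq : pt τ p q = pt τ p' q' := congrArg Subtype.val h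
  have p_eq : (p : ℝ) = p' := by simpa only [coordP_pt] using congrArg (coordP τ) pt_eq
  have q_eq : (q : ℝ) = q' := by simpa only [coordQ_pt] using congrArg (coordQ τ) pt_eq
  exact Prod.ext (mod_cast p_eq) (mod_cast q_eq)

open Classical in
/-- The lattice translations which can move a point of the cell into the support of
`latticeBump`. -/
def nearLattice (τ : ℍ) : Finset (lattice τ) :=
  (Finset.Icc (-2) 1 ×ˢ Finset.Icc (-2) 1).image fun pq => latticePt τ pq.1 pq.2

lemma mem_nearLattice {x : ℂ} (hx : x ∈ cell τ) {t : lattice τ}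
    (ht : x + (t : ℂ) ∈ tsupport (latticeBump τ)) : t ∈ nearLattice τ := by
  obtain ⟨_, p, q, rfl⟩ := t
  obtain ⟨coordP_le, coordQ_le⟩ := tsupport_latticeBump_subset τ ht
  obtain ⟨coordP_add, coordQ_add⟩ := coord_add_lattice τ x p q
  obtain ⟨coordP_mem, coordQ_mem⟩ := (mem_cell_iff τ x).1 hx
  have hp := mem_Icc_of_abs_add_intCast_le coordP_mem (coordP_add ▸ coordP_le)
  have hq := mem_Icc_of_abs_add_intCast_le coordQ_mem (coordQ_add ▸ coordQ_le)
  rw [Int.ceil_one] at hp hq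
  exact Finset.mem_image.2 ⟨(p, q), Finset.mem_product.2 ⟨hp, hq⟩, rfl⟩

lemma sum_latticeBump {x : ℂ} (hP : coordP τ x ∈ Set.Icc (-1 : ℝ) 2)
    (hQ : coordQ τ x ∈ Set.Icc (-1 : ℝ) 2) :
    ∑ t ∈ nearLattice τ, latticeBump τ (x + (t : ℂ)) = 1 := by
  have bump_eq (p q : ℤ) : latticeBump τ (x + (latticePt τ p q : ℂ)) =
      lineBump (coordP τ x + p) * lineBump (coordQ τ x + q) := by
    rw [latticeBump, (coord_add_lattice τ x p q).1, (coord_add_lattice τ x p q).2]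
  rw [nearLattice, Finset.sum_image (latticePt_injective τ).injOn, Finset.sum_product]
  simp only [bump_eq, ← Finset.mul_sum, sum_lineBump hQ, mul_one, sum_lineBump hP]

lemma sum_latticeBump_eventuallyEq_one {x : ℂ} (hx : x ∈ cell τ) :
    (fun y => ∑ t ∈ nearLattice τ, latticeBump τ (y + (t : ℂ))) =ᶠ[𝓝 x] 1 := by
  obtain ⟨hP, hQ⟩ := (mem_cell_iff τ x).1 hx
  have coordP_nhds : coordP τ ⁻¹' Set.Icc (-1) 2 ∈ 𝓝 x :=
    (continuous_coordP τ).continuousAt.preimage_mem_nhds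
      (Icc_mem_nhds (by linarith [hP.1]) (by linarith [hP.2]))
  have coordQ_nhds : coordQ τ ⁻¹' Set.Icc (-1) 2 ∈ 𝓝 x :=
    (continuous_coordQ τ).continuousAt.preimage_mem_nhds
      (Icc_mem_nhds (by linarith [hQ.1]) (by linarith [hQ.2]))
  filter_upwards [coordP_nhds, coordQ_nhds] with y hy hy' using sum_latticeBump hy hy'

lemma sum_fderiv_latticeBump {x : ℂ} (hx : x ∈ cell τ) (v : ℂ) :
    ∑ t ∈ nearLattice τ, fderiv ℝ (latticeBump τ) (x + (t : ℂ)) v = 0 := by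
  have hasFDerivAt_sum : HasFDerivAt (fun y => ∑ t ∈ nearLattice τ, latticeBump τ (y + (t : ℂ)))
      (∑ t ∈ nearLattice τ, fderiv ℝ (latticeBump τ) (x + (t : ℂ))) x :=
    HasFDerivAt.fun_sum fun t _ => (hasFDerivAt_comp_add_right (t : ℂ)).2
      ((contDiff_latticeBump τ).differentiable (by simp) (x + t)).hasFDerivAt
  have fderiv_sum_eq_zero := hasFDerivAt_sum.unique
    ((hasFDerivAt_const (1 : ℝ) x).congr_of_eventuallyEq (sum_latticeBump_eventuallyEq_one hx))
  simpa using congrArg (fun L : ℂ →L[ℝ] ℝ => L v) fderiv_sum_eq_zero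

lemma integral_mul_eq_setIntegral_cell {η : ℂ → ℝ} (hη : Continuous η)
    (support_η : tsupport η ⊆ tsupport (latticeBump τ)) {w : ℂ → ℂ} (hw : LocallyIntegrable w)
    (periodic : ∀ t : lattice τ, ∀ᵐ x, w (x + (t : ℂ)) = w x) :
    ∫ x, (η x : ℂ) * w x =
      ∫ x in cell τ, ((∑ t ∈ nearLattice τ, η (x + (t : ℂ)) : ℝ) : ℂ) * w x := by
  have compact_support : HasCompactSupport η :=
    (hasCompactSupport_latticeBump τ).of_isClosed_subset (isClosed_tsupport _) support_η
  have integrable_mul := integrable_mul_of_hasCompactSupport (φ := fun x => (η x : ℂ)) hw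
    (Complex.continuous_ofReal.comp hη) (compact_support.comp_left (g := ((↑) : ℝ → ℂ)) rfl)
  have vadd_eq (t : lattice τ) (x : ℂ) : t +ᵥ x = x + t := add_comm _ _
  have far_eq_zero (t : lattice τ) (ht : t ∉ nearLattice τ) :
      ∫ x in cell τ, (η (t +ᵥ x) : ℂ) * w (t +ᵥ x) = 0 := by
    refine (setIntegral_congr_fun (measurableSet_cell τ) fun x hx => ?_).trans (integral_zero _ _)
    have η_eq_zero : η (t +ᵥ x) = 0 := image_eq_zero_of_notMem_tsupport fun mem =>
      ht (mem_nearLattice hx (support_η (vadd_eq t x ▸ mem)))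
    simp [η_eq_zero]
  rw [(isAddFundamentalDomain_cell τ).integral_eq_tsum'' _ integrable_mul,
    tsum_eq_sum fun t => far_eq_zero t, ← integral_finsetSum]
  · refine integral_congr_ae (ae_restrict_of_ae ?_)
    filter_upwards [ae_all_iff.2 periodic] with x hx
    simp only [vadd_eq, hx, Complex.ofReal_sum, Finset.sum_mul]
  · exact fun t _ => ((measurePreserving_add_left volume (t : ℂ)).integrable_comp_of_integrable
      integrable_mul).integrableOn

lemma integral_latticeBump_mul {w : ℂ → ℂ} (hw : LocallyIntegrable w)
    (periodic : ∀ t : lattice τ, ∀ᵐ x, w (x + (t : ℂ)) = w x) :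
    ∫ x, (latticeBump τ x : ℂ) * w x = ∫ x in cell τ, w x := by
  rw [integral_mul_eq_setIntegral_cell (contDiff_latticeBump τ).continuous le_rfl hw periodic]
  refine setIntegral_congr_fun (measurableSet_cell τ) fun x hx => ?_
  have sum_eq_one := (sum_latticeBump_eventuallyEq_one hx).eq_of_nhds
  simp only [sum_eq_one, Pi.one_apply, Complex.ofReal_one, one_mul]

lemma integral_fderiv_latticeBump_mul {w : ℂ → ℂ} (hw : LocallyIntegrable w)
    (periodic : ∀ t : lattice τ, ∀ᵐ x, w (x + (t : ℂ)) = w x) (v : ℂ) :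
    ∫ x, (fderiv ℝ (latticeBump τ) x v : ℂ) * w x = 0 := by
  rw [integral_mul_eq_setIntegral_cell
    (contDiff_fderiv_apply_const (contDiff_latticeBump τ) v).continuous
    (tsupport_fderiv_apply_subset ℝ v) hw periodic]
  refine (setIntegral_congr_fun (measurableSet_cell τ) fun x hx => ?_).trans (integral_zero _ _)
  simp [sum_fderiv_latticeBump hx]

end PartitionOfUnity

/-! ### Covariant derivatives of gauge-periodic functions -/

section CovariantDerivative

variable {τ : ℍ} {n : ℕ} {γ : GaugePhase τ n}

lemma contDiff_gaugeFactor (γ : GaugePhase τ n) (t : lattice τ) :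
    ContDiff ℝ ∞ (gaugeFactor γ t) := by
  have contDiff_re : ContDiff ℝ ∞ Complex.re := Complex.reCLM.contDiff
  have contDiff_im : ContDiff ℝ ∞ Complex.im := Complex.imCLM.contDiff
  have contDiff_ofReal : ContDiff ℝ ∞ ((↑) : ℝ → ℂ) := Complex.ofRealCLM.contDiff
  refine Complex.contDiff_exp.comp (contDiff_const.mul (contDiff_ofReal.comp ?_))
  unfold dot
  fun_prop

/-- The dot product with a fixed vector, as a real linear form on the plane. -/
def dotCLM (v : ℂ) : ℂ →L[ℝ] ℝ := v.re • Complex.reCLM + v.im • Complex.imCLM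

lemma dotCLM_apply (v x : ℂ) : dotCLM v x = dot x v := by
  simp [dotCLM, dot, mul_comm]

lemma fderiv_gaugeFactor (γ : GaugePhase τ n) (t : lattice τ) (x v : ℂ) :
    fderiv ℝ (gaugeFactor γ t) x v =
      Complex.I * ((n : ℝ) / 2 * dot v (perp t) : ℝ) * gaugeFactor γ t x := by
  have hasFDerivAt_phase : HasFDerivAt (fun x => (n : ℝ) / 2 * dot x (perp t) + γ.c t)
      (((n : ℝ) / 2) • dotCLM (perp t)) x := by
    simpa only [dotCLM_apply] using
      ((dotCLM (perp t)).hasFDerivAt.const_mul ((n : ℝ) / 2)).add_const (γ.c t)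
  have hasFDerivAt_factor : HasFDerivAt (gaugeFactor γ t) _ x :=
    ((Complex.ofRealCLM.hasFDerivAt.comp x hasFDerivAt_phase).const_mul Complex.I).cexp
  rw [hasFDerivAt_factor.fderiv]
  simp only [smul_apply, ContinuousLinearMap.comp_apply, dotCLM_apply, smul_eq_mul,
    Complex.ofRealCLM_apply, Function.comp_apply]
  rw [gaugeFactor]
  ring

lemma potential_add (n : ℕ) (j : Fin 2) (x t : ℂ) :
    potential n j (x + t) = potential n j x + (n : ℝ) / 2 * dot (basisVec j) (perp t) := by
  simp only [potential, dot, perp, Complex.add_re, Complex.add_im]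
  ring

lemma IsGaugePeriodic.hasWeakCovDeriv {j : Fin 2} {f d : ℂ → ℂ} (hf : IsGaugePeriodic γ f)
    (h : HasWeakCovDeriv n j f d) : IsGaugePeriodic γ d := by
  intro t
  have deriv_eq := ((HasWeakPartial.comp_add h (t : ℂ)).congr (hf t) .rfl).unique
    (HasWeakPartial.mul h (contDiff_gaugeFactor γ t))
  filter_upwards [deriv_eq, hf t] with x hx periodic
  rw [periodic, fderiv_gaugeFactor, potential_add] at hx
  push_cast at hx
  linear_combination hx

lemma exists_cov_of_weakPartial {j : Fin 2} {u : GaugeL2 γ} {g : ℂ → ℂ} (hg : MemL2Loc g)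
    (h : HasWeakPartial j u.1 g) : ∃ d : GaugeL2 γ, HasWeakCovDeriv n j u.1 d.1 := by
  have hasWeakCovDeriv : HasWeakCovDeriv n j u.1 fun x =>
      g x - Complex.I * (potential n j x : ℂ) * u.1 x :=
    HasWeakPartial.congr h .rfl (.of_forall fun x => by simp)
  have memL2Loc : MemL2Loc fun x => g x - Complex.I * (potential n j x : ℂ) * u.1 x := by
    refine (hg.add (((memL2Loc_coe u).mul (contDiff_I_mul_potential n j).continuous).smul
      (-1))).congr (.of_forall fun x => ?_)
    simp [sub_eq_add_neg]
  obtain ⟨d, hd⟩ := exists_gaugeL2 (u.2.1.hasWeakCovDeriv hasWeakCovDeriv) memL2Loc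
  exact ⟨d, hasWeakCovDeriv.congr .rfl hd.symm⟩

lemma exists_cov_cov_of_memH2Loc {u : GaugeL2 γ} (h : MemH2Loc u.1) :
    ∃ d e : Fin 2 → GaugeL2 γ, (∀ j, HasWeakCovDeriv n j u.1 (d j).1) ∧
      ∀ j, HasWeakCovDeriv n j (d j).1 (e j).1 := by
  obtain ⟨-, g, k, hg, hk⟩ := h
  choose d hd using fun j => exists_cov_of_weakPartial (γ := γ) (hg j).1 (hg j).2
  have exists_second (j : Fin 2) : ∃ e : GaugeL2 γ, HasWeakCovDeriv n j (d j).1 e.1 := by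
    have contDiff_potential := contDiff_I_mul_potential n j
    have weakPartial := (hk j j).2.add ((HasWeakPartial.mul (hg j).2 contDiff_potential).smul (-1))
    have memL2Loc := (hk j j).1.add ((((memL2Loc_coe u).mul (contDiff_fderiv_apply_const
      contDiff_potential (basisVec j)).continuous).add
        ((hg j).1.mul contDiff_potential.continuous)).smul (-1))
    refine exists_cov_of_weakPartial memL2Loc (weakPartial.congr ?_ .rfl)
    filter_upwards [(hg j).2.unique (hd j)] with x hx
    simp [hx]
  choose e he using exists_second
  exact ⟨d, e, hd, he⟩

lemma memH2Loc_of_cov {u : GaugeL2 γ} {d : Fin 2 → GaugeL2 γ} {e : Fin 2 → Fin 2 → GaugeL2 γ}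
    (hd : ∀ j, HasWeakCovDeriv n j u.1 (d j).1)
    (he : ∀ j k, HasWeakCovDeriv n k (d j).1 (e j k).1) : MemH2Loc u.1 := by
  have contDiff_potential (j) := contDiff_I_mul_potential n j
  have memL2Loc_partial (w y : GaugeL2 γ) (j) :
      MemL2Loc fun x => w.1 x + Complex.I * (potential n j x : ℂ) * y.1 x :=
    (memL2Loc_coe w).add ((memL2Loc_coe y).mul (contDiff_potential j).continuous)
  refine ⟨memL2Loc_coe u, _, _, fun j => ⟨memL2Loc_partial _ _ j, hd j⟩, fun j k =>
    ⟨?_, HasWeakPartial.add (he j k) (HasWeakPartial.mul (hd k) (contDiff_potential j))⟩⟩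
  exact (memL2Loc_partial _ _ k).add (((memL2Loc_coe u).mul
    (contDiff_fderiv_apply_const (contDiff_potential j) _).continuous).add
      ((memL2Loc_partial _ _ k).mul (contDiff_potential j).continuous))

end CovariantDerivative

/-! ### Smooth gauge-periodic functions -/

section Smooth

variable {τ : ℍ} {n : ℕ} {γ : GaugePhase τ n}

/-- The smooth functions satisfying the gauge-periodicity condition at every point. -/
def smoothGauge (γ : GaugePhase τ n) : Submodule ℂ (ℂ → ℂ) where
  carrier := {f | ContDiff ℝ ∞ f ∧ ∀ (t : lattice τ) x, f (x + (t : ℂ)) = gaugeFactor γ t x * f x}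
  zero_mem' := ⟨contDiff_const, fun t x => by simp⟩
  add_mem' hf hg := ⟨hf.1.add hg.1, fun t x => by simp [hf.2, hg.2, mul_add]⟩
  smul_mem' c _ hf := ⟨contDiff_const.smul hf.1, fun t x => by simp [hf.2, mul_left_comm]⟩

lemma memL2Loc_of_continuous {f : ℂ → ℂ} (hf : Continuous f) : MemL2Loc f := by
  intro K hK
  have : IsFiniteMeasure ((volume : Measure ℂ).restrict K) := ⟨by simpa using hK.measure_lt_top⟩
  obtain ⟨C, hC⟩ := hK.exists_bound_of_continuousOn hf.continuousOn
  exact .of_bound hf.aestronglyMeasurable C ((ae_restrict_mem hK.measurableSet).mono hC)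

lemma memLp_smoothGauge (f : smoothGauge γ) :
    MemLp (AEEqFun.mk f.1 f.2.1.continuous.aestronglyMeasurable : ℂ →ₘ[(volume : Measure ℂ)] ℂ) 2
      (volume.restrict (cell τ)) := by
  obtain ⟨K, hK, cell_subset⟩ := exists_isCompact_cell_subset τ
  exact (memLp_congr_ae (ae_restrict_of_ae (AEEqFun.coeFn_mk _ _))).2
    ((memL2Loc_of_continuous f.2.1.continuous K hK).mono_measure
      (Measure.restrict_mono_set _ cell_subset))

/-- The inclusion of the smooth gauge-periodic functions into the Hilbert space. -/
def smoothToL2 (γ : GaugePhase τ n) : smoothGauge γ →ₗ[ℂ] GaugeL2 γ where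
  toFun f := ⟨AEEqFun.mk f.1 f.2.1.continuous.aestronglyMeasurable,
    IsGaugePeriodic.congr (fun t => .of_forall fun x => f.2.2 t x) (AEEqFun.coeFn_mk _ _).symm,
    memLp_smoothGauge f⟩
  map_add' _ _ := rfl
  map_smul' _ _ := rfl

lemma coeFn_smoothToL2 (f : smoothGauge γ) : (smoothToL2 γ f).1 =ᵐ[volume] f.1 :=
  AEEqFun.coeFn_mk _ _

/-- The covariant derivative `(∂_j - i aⁿ_j) f` of a differentiable function. -/
def covDeriv (n : ℕ) (j : Fin 2) (f : ℂ → ℂ) (x : ℂ) : ℂ :=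
  fderiv ℝ f x (basisVec j) - Complex.I * (potential n j x : ℂ) * f x

lemma contDiff_covDeriv (n : ℕ) (j : Fin 2) {f : ℂ → ℂ} (hf : ContDiff ℝ ∞ f) :
    ContDiff ℝ ∞ (covDeriv n j f) :=
  (contDiff_fderiv_apply_const hf _).sub ((contDiff_I_mul_potential n j).mul hf)

lemma hasWeakCovDeriv_covDeriv (n : ℕ) (j : Fin 2) {f : ℂ → ℂ} (hf : ContDiff ℝ ∞ f) :
    HasWeakCovDeriv n j f (covDeriv n j f) :=
  (HasWeakPartial.of_contDiff j hf).congr .rfl (.of_forall fun x => by simp [covDeriv])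

lemma covDeriv_add_lattice (j : Fin 2) {f : ℂ → ℂ} (hf : Differentiable ℝ f)
    (periodic : ∀ (t : lattice τ) x, f (x + (t : ℂ)) = gaugeFactor γ t x * f x)
    (t : lattice τ) (x : ℂ) :
    covDeriv n j f (x + (t : ℂ)) = gaugeFactor γ t x * covDeriv n j f x := by
  have fderiv_translate :
      fderiv ℝ f (x + (t : ℂ)) = fderiv ℝ (fun x => gaugeFactor γ t x * f x) x := by
    rw [← fderiv_comp_add_right, funext (periodic t)]
  rw [covDeriv, fderiv_translate,
    fderiv_fun_mul ((contDiff_gaugeFactor γ t).differentiable (by simp) x) (hf x), periodic,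
    potential_add, covDeriv]
  simp only [add_apply, smul_apply, smul_eq_mul, fderiv_gaugeFactor]
  push_cast
  ring

/-- The covariant derivatives as operators on the smooth gauge-periodic functions. -/
def smoothCov (γ : GaugePhase τ n) (j : Fin 2) : smoothGauge γ →ₗ[ℂ] smoothGauge γ where
  toFun f := ⟨covDeriv n j f.1, contDiff_covDeriv n j f.2.1,
    covDeriv_add_lattice j (f.2.1.differentiable (by simp)) f.2.2⟩
  map_add' f g := by
    refine Subtype.ext (funext fun x => ?_)
    change covDeriv n j (f.1 + g.1) x = covDeriv n j f.1 x + covDeriv n j g.1 x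
    rw [covDeriv, fderiv_add (f.2.1.differentiable (by simp) x) (g.2.1.differentiable (by simp) x)]
    simp only [covDeriv, add_apply, Pi.add_apply]
    ring
  map_smul' c f := by
    refine Subtype.ext (funext fun x => ?_)
    change covDeriv n j (c • f.1) x = c * covDeriv n j f.1 x
    rw [covDeriv, fderiv_const_smul (f.2.1.differentiable (by simp) x)]
    simp only [covDeriv, smul_apply, Pi.smul_apply, smul_eq_mul]
    ring

lemma coe_smoothCov (j : Fin 2) (f : smoothGauge γ) : (smoothCov γ j f).1 = covDeriv n j f.1 := rfl

lemma hasWeakCovDeriv_smooth (j : Fin 2) (f : smoothGauge γ) :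
    HasWeakCovDeriv n j (smoothToL2 γ f).1 (smoothToL2 γ (smoothCov γ j f)).1 :=
  (hasWeakCovDeriv_covDeriv n j f.2.1).congr (coeFn_smoothToL2 f).symm
    (coeFn_smoothToL2 (smoothCov γ j f)).symm

lemma HasWeakPartial.setIntegral_cell_eq_zero {j : Fin 2} {f g : ℂ → ℂ} (h : HasWeakPartial j f g)
    (periodic : ∀ t : lattice τ, ∀ᵐ x, f (x + (t : ℂ)) = f x) : ∫ x in cell τ, g x = 0 := by
  have periodic_deriv (t : lattice τ) : ∀ᵐ x, g (x + (t : ℂ)) = g x :=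
    ((h.comp_add t).congr (periodic t) .rfl).unique h
  have by_parts := h.2.2 (latticeBump τ) (contDiff_latticeBump τ) (hasCompactSupport_latticeBump τ)
  simp only [Complex.real_smul] at by_parts
  rwa [integral_fderiv_latticeBump_mul h.1 periodic, integral_latticeBump_mul h.2.1 periodic_deriv,
    zero_eq_neg] at by_parts

lemma inner_smoothToL2 (f : smoothGauge γ) (u : GaugeL2 γ) :
    inner ℂ (smoothToL2 γ f) u = ∫ x in cell τ, conj (f.1 x) * u.1 x := by
  rw [inner_eq_integral]
  refine integral_congr_ae (ae_restrict_of_ae ?_)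
  filter_upwards [coeFn_smoothToL2 f] with x hx
  rw [hx]

lemma integrableOn_cell_conj_mul (f : smoothGauge γ) (u : GaugeL2 γ) :
    IntegrableOn (fun x => conj (f.1 x) * u.1 x) (cell τ) := by
  obtain ⟨K, hK, cell_subset⟩ := exists_isCompact_cell_subset τ
  exact ((locallyIntegrable_mul (locallyIntegrable_coe u)
    (Complex.continuous_conj.comp f.2.1.continuous)).integrableOn_isCompact hK).mono_set cell_subset

lemma conj_mul_add_lattice (f : smoothGauge γ) (u : GaugeL2 γ) (t : lattice τ) :
    ∀ᵐ x, conj (f.1 (x + (t : ℂ))) * u.1 (x + (t : ℂ)) = conj (f.1 x) * u.1 x := by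
  filter_upwards [u.2.1 t] with x hx
  have conj_mul_self : conj (gaugeFactor γ t x) * gaugeFactor γ t x = 1 := by
    simp [Complex.conj_mul', norm_gaugeFactor]
  rw [hx, f.2.2, map_mul]
  linear_combination (conj (f.1 x) * u.1 x) * conj_mul_self

lemma inner_smoothToL2_of_hasWeakCovDeriv {j : Fin 2} (f : smoothGauge γ) {u g : GaugeL2 γ}
    (h : HasWeakCovDeriv n j u.1 g.1) :
    inner ℂ (smoothToL2 γ f) g = -inner ℂ (smoothToL2 γ (smoothCov γ j f)) u := by
  have fderiv_conj (x : ℂ) : fderiv ℝ (fun y => conj (f.1 y)) x (basisVec j) =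
      conj (fderiv ℝ f.1 x (basisVec j)) := by
    have hasFDerivAt_conj : HasFDerivAt (fun y => conj (f.1 y)) _ x :=
      Complex.conjCLE.hasFDerivAt.comp x (f.2.1.differentiable (by simp) x).hasFDerivAt
    simp [hasFDerivAt_conj.fderiv]
  -- The potential terms cancel because the potential is real and `f` enters through its conjugate.
  have leibniz : HasWeakPartial j (fun x => conj (f.1 x) * u.1 x)
      fun x => conj ((smoothCov γ j f).1 x) * u.1 x + conj (f.1 x) * g.1 x := by
    refine (HasWeakPartial.mul h (Complex.conjCLE.contDiff.comp f.2.1)).congr .rfl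
      (.of_forall fun x => ?_)
    change fderiv ℝ (fun y => conj (f.1 y)) x (basisVec j) * u.1 x + conj (f.1 x) * _ = _
    simp only [fderiv_conj, coe_smoothCov, covDeriv, map_sub, map_mul, Complex.conj_I,
      Complex.conj_ofReal]
    ring
  have integral_eq_zero := leibniz.setIntegral_cell_eq_zero (conj_mul_add_lattice f u)
  rw [integral_add (integrableOn_cell_conj_mul _ u) (integrableOn_cell_conj_mul f g),
    ← inner_smoothToL2, ← inner_smoothToL2] at integral_eq_zero
  exact eq_neg_of_add_eq_zero_right integral_eq_zero

lemma fderiv_I_mul_potential (j k : Fin 2) (x : ℂ) :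
    fderiv ℝ (fun x => Complex.I * (potential n j x : ℂ)) x (basisVec k) =
      Complex.I * ((n : ℝ) / 2 * dot (perp (basisVec k)) (basisVec j) : ℝ) := by
  have hasFDerivAt_potential :
      HasFDerivAt (potential n j) (((n : ℝ) / 2) • -dotCLM (perp (basisVec j))) x := by
    refine ((-dotCLM (perp (basisVec j))).hasFDerivAt.const_mul
      ((n : ℝ) / 2)).congr_of_eventuallyEq (.of_forall fun y => ?_)
    simp only [neg_apply, dotCLM_apply, potential, dot, perp]
    ring
  have hasFDerivAt_I_mul : HasFDerivAt (fun x => Complex.I * (potential n j x : ℂ)) _ x :=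
    (Complex.ofRealCLM.hasFDerivAt.comp x hasFDerivAt_potential).const_mul Complex.I
  rw [hasFDerivAt_I_mul.fderiv]
  simp [dotCLM_apply, dot, perp]
  ring

lemma fderiv_covDeriv {f : ℂ → ℂ} (hf : ContDiff ℝ ∞ f) (j k : Fin 2) (x : ℂ) :
    fderiv ℝ (covDeriv n j f) x (basisVec k) =
      fderiv ℝ (fderiv ℝ f) x (basisVec k) (basisVec j) -
        (Complex.I * ((n : ℝ) / 2 * dot (perp (basisVec k)) (basisVec j) : ℝ) * f x +
          Complex.I * (potential n j x : ℂ) * fderiv ℝ f x (basisVec k)) := by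
  have diff_fderiv : DifferentiableAt ℝ (fderiv ℝ f) x :=
    (hf.fderiv_right (m := ∞) (by simp)).differentiable (by simp) x
  have hasFDerivAt_covDeriv : HasFDerivAt (covDeriv n j f) _ x :=
    (diff_fderiv.hasFDerivAt.clm_apply (hasFDerivAt_const (basisVec j) x)).sub
      (((contDiff_I_mul_potential n j).differentiable (by simp) x).hasFDerivAt.mul
        (hf.differentiable (by simp) x).hasFDerivAt)
  rw [hasFDerivAt_covDeriv.fderiv]
  simp [fderiv_I_mul_potential]
  ring

lemma covDeriv_covDeriv_comm {f : ℂ → ℂ} (hf : ContDiff ℝ ∞ f) (x : ℂ) :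
    covDeriv n 1 (covDeriv n 0 f) x =
      covDeriv n 0 (covDeriv n 1 f) x + Complex.I * (n : ℝ) * f x := by
  have symmetric : fderiv ℝ (fderiv ℝ f) x (basisVec 1) (basisVec 0) =
      fderiv ℝ (fderiv ℝ f) x (basisVec 0) (basisVec 1) :=
    hf.contDiffAt.isSymmSndFDerivAt
      (by simpa using WithTop.coe_le_coe.2 (le_top : (2 : ℕ∞) ≤ ⊤)) _ _
  rw [covDeriv, fderiv_covDeriv hf, symmetric, covDeriv, covDeriv, fderiv_covDeriv hf, covDeriv]
  simp [basisVec, dot, perp]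
  ring

lemma covariantPair_smooth (γ : GaugePhase τ n) :
    CovariantPair (smoothToL2 γ) (smoothCov γ) (n : ℝ) where
  skew k f g := inner_smoothToL2_of_hasWeakCovDeriv f (hasWeakCovDeriv_smooth k g)
  comm f := Subtype.ext (funext fun x => covDeriv_covDeriv_comm f.2.1 x)

end Smooth

/-! ### The graph of the magnetic Laplacian -/

section Graph

variable {τ : ℍ} {n : ℕ} {γ : GaugePhase τ n}

lemma coeFn_neg_sum (e : Fin 2 → GaugeL2 γ) :
    (-∑ j, e j : GaugeL2 γ).1 =ᵐ[volume] -∑ j, ((e j).1 : ℂ → ℂ) := by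
  rw [Fin.sum_univ_two, Fin.sum_univ_two]
  exact (AEEqFun.coeFn_neg ((e 0).1 + (e 1).1)).trans (AEEqFun.coeFn_add (e 0).1 (e 1).1).fun_neg

lemma mem_magneticGraph_of_cov {u : GaugeL2 γ} (h : MemH2Loc u.1) {d e : Fin 2 → GaugeL2 γ}
    (hd : ∀ j, HasWeakCovDeriv n j u.1 (d j).1) (he : ∀ j, HasWeakCovDeriv n j (d j).1 (e j).1) :
    (u, -∑ j, e j) ∈ magneticGraph γ :=
  ⟨h, fun j => (d j).1, fun j => (e j).1, hd, he, coeFn_neg_sum e⟩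

lemma mem_domain_iff_memH2Loc (u : GaugeL2 γ) :
    u ∈ (magneticLaplacian γ).domain ↔ MemH2Loc u.1 := by
  rw [LinearPMap.mem_domain_iff, magneticLaplacian_graph]
  refine ⟨fun ⟨f, hf⟩ => hf.1, fun h => ?_⟩
  obtain ⟨d, e, hd, he⟩ := exists_cov_cov_of_memH2Loc h
  exact ⟨_, mem_magneticGraph_of_cov h hd he⟩

lemma inner_smoothToL2_of_mem_magneticGraph (Φ : smoothGauge γ) {u f : GaugeL2 γ}
    (h : (u, f) ∈ magneticGraph γ) : inner ℂ (smoothToL2 γ Φ) f =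
      inner ℂ (smoothToL2 γ (negLaplacian (smoothCov γ) Φ)) u := by
  obtain ⟨d, e, hd, he⟩ := exists_cov_cov_of_memH2Loc h.1
  have mem_graph := mem_magneticGraph_of_cov h.1 hd he
  rw [← magneticLaplacian_graph] at h mem_graph
  obtain rfl : f = -∑ j, e j := LinearPMap.mem_graph_snd_inj _ h mem_graph rfl
  simp only [negLaplacian_apply, Fin.sum_univ_two, inner_neg_right, inner_add_right, map_neg,
    map_add, inner_neg_left, inner_add_left, inner_smoothToL2_of_hasWeakCovDeriv _ (he _),
    inner_smoothToL2_of_hasWeakCovDeriv _ (hd _), neg_neg]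

lemma mem_magneticGraph_of_mem_closure {u f : GaugeL2 γ}
    (h : (u, f) ∈ closure (Set.range fun x : smoothGauge γ =>
      (smoothToL2 γ x, smoothToL2 γ (negLaplacian (smoothCov γ) x)))) :
    (u, f) ∈ magneticGraph γ := by
  obtain ⟨x, d, e, tendsto_u, tendsto_d, tendsto_e, rfl⟩ :=
    (covariantPair_smooth γ).exists_tendsto_of_mem_closure n.cast_nonneg h
  have hd (j) : HasWeakCovDeriv n j u.1 (d j).1 :=
    hasWeakCovDeriv_of_tendsto tendsto_u (tendsto_d j) fun _ => hasWeakCovDeriv_smooth j _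
  have he (j k) : HasWeakCovDeriv n k (d j).1 (e j k).1 :=
    hasWeakCovDeriv_of_tendsto (tendsto_d j) (tendsto_e j k) fun _ => hasWeakCovDeriv_smooth k _
  exact mem_magneticGraph_of_cov (memH2Loc_of_cov hd he) hd fun j => he j j

lemma isDiagonal_magneticLaplacian {ι : Type*} (b : HilbertBasis ι ℂ (GaugeL2 γ))
    (e : ι → smoothGauge γ) (hb : ∀ i, b i = smoothToL2 γ (e i)) (l : ι → ℝ)
    (eigen : ∀ i, negLaplacian (smoothCov γ) (e i) = (l i : ℂ) • e i) :
    IsDiagonal (magneticLaplacian γ) b fun i => (l i : ℂ) := by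
  intro u f
  rw [magneticLaplacian_graph]
  refine ⟨fun h i => ?_, fun h => mem_magneticGraph_of_mem_closure ?_⟩
  · rw [hb, inner_smoothToL2_of_mem_magneticGraph _ h, eigen, map_smul, inner_smul_left,
      Complex.conj_ofReal]
  · refine mem_closure_of_tendsto ((b.hasSum_repr u).prodMk (b.hasSum_repr f))
      (.of_forall fun F => ⟨∑ i ∈ F, b.repr u i • e i, ?_⟩)
    simp only [map_sum, map_smul, eigen, ← hb, b.repr_apply_apply, h, smul_smul, mul_comm]
    exact Prod.ext (by simp [Prod.fst_sum]) (by simp [Prod.snd_sum])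

end Graph

/-! ### Gauge-periodic sums of Gaussian modes -/

section LatticeGenerators

variable {τ : ℍ} {n : ℕ}

lemma coe_latticePt_one_zero (τ : ℍ) : (latticePt τ 1 0 : ℂ) = scale τ := by
  simp [latticePt, pt]

lemma coe_latticePt_zero_one (τ : ℍ) : (latticePt τ 0 1 : ℂ) = scale τ * τ := by
  simp [latticePt, pt]

lemma eq_zsmul_add_zsmul (t : lattice τ) :
    ∃ p q : ℤ, t = p • latticePt τ 1 0 + q • latticePt τ 0 1 := by
  obtain ⟨_, p, q, rfl⟩ := t
  refine ⟨p, q, Subtype.ext ?_⟩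
  push_cast
  simp only [coe_latticePt_one_zero, coe_latticePt_zero_one, pt, zsmul_eq_mul]
  push_cast
  ring

/-- The pairs `(t, l)` such that the translation by `t` acts on the family `f` as multiplication by
the gauge factor of `t` and a shift of the index by `l`. -/
def gaugeShifts (γ : GaugePhase τ n) (f : ℤ → ℂ → ℂ) : AddSubgroup (lattice τ × ℤ) where
  carrier := {a | ∀ m x, f m (x + (a.1 : ℂ)) = gaugeFactor γ a.1 x * f (m + a.2) x}
  zero_mem' := fun m x => by simp [gaugeFactor_zero]
  add_mem' := fun {a b} ha hb m x => by
    rw [Prod.fst_add, Prod.snd_add, AddSubgroup.coe_add, ← add_assoc, hb, ha, gaugeFactor_add,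
      ← add_assoc, add_right_comm m]
    ring
  neg_mem' := fun {a} ha m x => by
    have shift := ha (m - a.2) (x + ((-a.1 : lattice τ) : ℂ))
    have cocycle := gaugeFactor_add γ (-a.1) a.1 x
    rw [neg_add_cancel, gaugeFactor_zero] at cocycle
    rw [sub_add_cancel] at shift
    rw [AddSubgroup.coe_neg, neg_add_cancel_right] at shift
    rw [Prod.fst_neg, Prod.snd_neg, ← sub_eq_add_neg, shift, AddSubgroup.coe_neg]
    rw [AddSubgroup.coe_neg] at cocycle
    linear_combination f m (x + -(a.1 : ℂ)) * cocycle

lemma gauge_periodic_of_basis {γ : GaugePhase τ n} {f : ℂ → ℂ}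
    (periodic_one : ∀ x,
      f (x + (latticePt τ 1 0 : ℂ)) = gaugeFactor γ (latticePt τ 1 0) x * f x)
    (periodic_tau : ∀ x,
      f (x + (latticePt τ 0 1 : ℂ)) = gaugeFactor γ (latticePt τ 0 1) x * f x)
    (t : lattice τ) (x : ℂ) : f (x + (t : ℂ)) = gaugeFactor γ t x * f x := by
  have one_mem : (latticePt τ 1 0, 0) ∈ gaugeShifts γ fun _ => f := fun _ => periodic_one
  have tau_mem : (latticePt τ 0 1, 0) ∈ gaugeShifts γ fun _ => f := fun _ => periodic_tau
  obtain ⟨p, q, rfl⟩ := eq_zsmul_add_zsmul t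
  exact add_mem (zsmul_mem one_mem p) (zsmul_mem tau_mem q) 0 x

end LatticeGenerators

section Bounds

lemma exists_gaussian_mul_polynomial_le {a : ℝ} (ha : 0 < a) (P : Polynomial ℂ) (b : ℝ) :
    ∃ C : ℝ, 0 ≤ C ∧ ∀ y : ℝ,
      Real.exp (-(a * y ^ 2)) * ‖P.eval (y : ℂ)‖ ≤ C * Real.exp (-(b * |y|)) := by
  induction P using Polynomial.induction_on' with
  | add P Q hP hQ =>
    obtain ⟨C, hC, le_P⟩ := hP
    obtain ⟨C', hC', le_Q⟩ := hQ
    refine ⟨C + C', by positivity, fun y => ?_⟩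
    rw [Polynomial.eval_add, add_mul]
    refine le_trans ?_ (add_le_add (le_P y) (le_Q y))
    rw [← mul_add]
    gcongr
    exact norm_add_le _ _
  | monomial k c =>
    refine ⟨‖c‖ * k.factorial * Real.exp ((1 + b) ^ 2 / (4 * a)), by positivity, fun y => ?_⟩
    have pow_le : |y| ^ k ≤ k.factorial * Real.exp |y| := by
      have := Real.pow_div_factorial_le_exp |y| (abs_nonneg y) k
      rwa [div_le_iff₀ (by positivity), mul_comm] at this
    have exponent_le : -(a * y ^ 2) + |y| ≤ (1 + b) ^ 2 / (4 * a) + -(b * |y|) := by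
      have square : (1 + b) ^ 2 / (4 * a) + -(b * |y|) - (-(a * y ^ 2) + |y|) =
          a * (|y| - (1 + b) / (2 * a)) ^ 2 := by
        rw [← sq_abs y]
        field_simp
        ring
      linarith [mul_nonneg ha.le (sq_nonneg (|y| - (1 + b) / (2 * a)))]
    rw [Polynomial.eval_monomial, norm_mul, norm_pow, Complex.norm_real, Real.norm_eq_abs]
    calc Real.exp (-(a * y ^ 2)) * (‖c‖ * |y| ^ k)
        ≤ Real.exp (-(a * y ^ 2)) * (‖c‖ * (k.factorial * Real.exp |y|)) := by gcongr
      _ = ‖c‖ * k.factorial * Real.exp (-(a * y ^ 2) + |y|) := by rw [Real.exp_add]; ring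
      _ ≤ ‖c‖ * k.factorial * Real.exp ((1 + b) ^ 2 / (4 * a) + -(b * |y|)) := by gcongr
      _ = ‖c‖ * k.factorial * Real.exp ((1 + b) ^ 2 / (4 * a)) * Real.exp (-(b * |y|)) := by
        rw [Real.exp_add]
        ring

lemma summable_exp_neg_mul_abs {β : ℝ} (hβ : 0 < β) :
    Summable fun m : ℤ => Real.exp (-(β * |(m : ℝ)|)) := by
  have summable_nat : Summable fun k : ℕ => Real.exp (-(β * k)) :=
    (Real.summable_exp_nat_mul_iff.2 (neg_lt_zero.2 hβ)).congr fun k => by ring_nf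
  exact .of_nat_of_neg (by simpa using summable_nat) (by simpa using summable_nat)

end Bounds

section Partials

/-- The real-linear map on the plane with partial derivatives `p 0` and `p 1`. -/
def ofPartials (p : Fin 2 → ℂ) : ℂ →L[ℝ] ℂ :=
  Complex.reCLM.smulRight (p 0) + Complex.imCLM.smulRight (p 1)

lemma ofPartials_apply (p : Fin 2 → ℂ) (v : ℂ) : ofPartials p v = v.re * p 0 + v.im * p 1 := by
  simp [ofPartials]

lemma ofPartials_basisVec (p : Fin 2 → ℂ) (j : Fin 2) : ofPartials p (basisVec j) = p j := by
  fin_cases j <;> simp [ofPartials_apply, basisVec]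

lemma smul_ofPartials (c : ℂ) (p : Fin 2 → ℂ) :
    c • ofPartials p = ofPartials fun j => c * p j := by
  ext v
  simp only [smul_apply, ofPartials_apply, smul_eq_mul]
  ring

lemma norm_ofPartials_le (p : Fin 2 → ℂ) : ‖ofPartials p‖ ≤ ‖p 0‖ + ‖p 1‖ := by
  refine (norm_add_le _ _).trans ?_
  simp

lemma hasSum_ofPartials {ι : Type*} {p : ι → Fin 2 → ℂ} {q : Fin 2 → ℂ}
    (h : ∀ j, HasSum (fun i => p i j) (q j)) :
    HasSum (fun i => ofPartials (p i)) (ofPartials q) :=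
  ((h 0).mapL (ContinuousLinearMap.smulRightL ℝ ℂ ℂ Complex.reCLM)).add
    ((h 1).mapL (ContinuousLinearMap.smulRightL ℝ ℂ ℂ Complex.imCLM))

end Partials

section Modes

variable {τ : ℍ} {n : ℕ}

/-- The momentum `κ_m = (2πm + c_r) / r` of the `m`-th mode, forced by gauge periodicity
along `r`. -/
def momentum (γ : GaugePhase τ n) (m : ℤ) : ℝ :=
  (2 * Real.pi * m + γ.c (latticePt τ 1 0)) / scale τ

/-- The constant phase of the `m`-th mode, chosen so that the translation by `rτ` maps the mode
`m` to the mode `m + n`. -/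
def modePhase (γ : GaugePhase τ n) (m : ℤ) : ℝ :=
  Real.pi * τ.re * m ^ 2 / n +
    (γ.c (latticePt τ 1 0) * τ.re - γ.c (latticePt τ 0 1)) * m / n

/-- The second coordinate, measured from the center `-κ_m / n` of the `m`-th mode. -/
def centeredIm (γ : GaugePhase τ n) (m : ℤ) (x : ℂ) : ℝ := x.im + momentum γ m / n

/-- The `m`-th mode: a plane wave in the first variable times a polynomial times a Gaussian in the
centered second variable. -/
def mode (γ : GaugePhase τ n) (P : Polynomial ℂ) (m : ℤ) (x : ℂ) : ℂ :=
  Complex.exp (Complex.I * ((n : ℝ) / 2 * x.re * x.im + momentum γ m * x.re + modePhase γ m : ℝ) -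
    ((n : ℝ) / 2 * centeredIm γ m x ^ 2 : ℝ)) * P.eval (centeredIm γ m x : ℂ)

/-- The superposition of the modes with polynomial factor `P` and weights `s`; it is gauge-periodic
because the weights are `n`-periodic. -/
def modeSum (γ : GaugePhase τ n) (s : ZMod n → ℂ) (P : Polynomial ℂ) (x : ℂ) : ℂ :=
  ∑' m : ℤ, s m * mode γ P m x

/-- The polynomial factor of the `j`-th covariant derivative of a mode. -/
def polyCov (n : ℕ) : Fin 2 → Polynomial ℂ → Polynomial ℂ :=
  ![fun P => Polynomial.C (Complex.I * n) * (Polynomial.X * P),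
    fun P => Polynomial.derivative P - Polynomial.C (n : ℂ) * (Polynomial.X * P)]

lemma norm_mode (γ : GaugePhase τ n) (P : Polynomial ℂ) (m : ℤ) (x : ℂ) :
    ‖mode γ P m x‖ =
      Real.exp (-((n : ℝ) / 2 * centeredIm γ m x ^ 2)) * ‖P.eval (centeredIm γ m x : ℂ)‖ := by
  rw [mode, norm_mul, Complex.norm_exp, Complex.sub_re, Complex.I_mul_re, Complex.ofReal_im,
    Complex.ofReal_re, neg_zero, zero_sub]

lemma mode_add (γ : GaugePhase τ n) (P Q : Polynomial ℂ) (m : ℤ) (x : ℂ) :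
    mode γ (P + Q) m x = mode γ P m x + mode γ Q m x := by
  simp [mode, mul_add]

lemma mode_C_mul (γ : GaugePhase τ n) (a : ℂ) (P : Polynomial ℂ) (m : ℤ) (x : ℂ) :
    mode γ (Polynomial.C a * P) m x = a * mode γ P m x := by
  simp [mode, mul_left_comm]

variable [NeZero n]

lemma mul_abs_sub_le_abs_centeredIm (γ : GaugePhase τ n) (m : ℤ) (x : ℂ) :
    2 * Real.pi / (scale τ * n) * |(m : ℝ)| -
      (‖x‖ + |γ.c (latticePt τ 1 0) / (scale τ * n)|) ≤ |centeredIm γ m x| := by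
  have n_ne_zero : (n : ℝ) ≠ 0 := NeZero.ne _
  have scale_pos := scale_pos τ
  have m_eq : 2 * Real.pi / (scale τ * n) * m =
      centeredIm γ m x - (x.im + γ.c (latticePt τ 1 0) / (scale τ * n)) := by
    rw [centeredIm, momentum]
    field_simp
    ring
  calc 2 * Real.pi / (scale τ * n) * |(m : ℝ)| -
        (‖x‖ + |γ.c (latticePt τ 1 0) / (scale τ * n)|)
      = |2 * Real.pi / (scale τ * n) * m| -
        (‖x‖ + |γ.c (latticePt τ 1 0) / (scale τ * n)|) := by
          rw [abs_mul, abs_of_nonneg (by positivity : 0 ≤ 2 * Real.pi / (scale τ * n))]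
    _ ≤ |centeredIm γ m x| + |x.im + γ.c (latticePt τ 1 0) / (scale τ * n)| -
        (‖x‖ + |γ.c (latticePt τ 1 0) / (scale τ * n)|) := by
          rw [m_eq]; gcongr; exact abs_sub _ _
    _ ≤ |centeredIm γ m x| := by
          linarith [abs_add_le x.im (γ.c (latticePt τ 1 0) / (scale τ * n)),
            Complex.abs_im_le_norm x]

lemma exists_summable_norm_mode_le (γ : GaugePhase τ n) (P : Polynomial ℂ) (R : ℝ) :
    ∃ b : ℤ → ℝ, Summable b ∧ ∀ m x, ‖x‖ ≤ R → ‖mode γ P m x‖ ≤ b m := by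
  have n_pos : (0 : ℝ) < n := mod_cast NeZero.pos n
  have scale_pos := scale_pos τ
  obtain ⟨C, hC, le_exp⟩ := exists_gaussian_mul_polynomial_le (half_pos n_pos) P 1
  simp only [one_mul] at le_exp
  refine ⟨fun m => C * Real.exp (R + |γ.c (latticePt τ 1 0) / (scale τ * n)|) *
    Real.exp (-(2 * Real.pi / (scale τ * n) * |(m : ℝ)|)),
    (summable_exp_neg_mul_abs (by positivity)).mul_left _, fun m x hx => ?_⟩
  beta_reduce
  rw [norm_mode, mul_assoc, ← Real.exp_add]
  refine (le_exp _).trans (mul_le_mul_of_nonneg_left (Real.exp_le_exp.2 ?_) hC)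
  linarith [mul_abs_sub_le_abs_centeredIm γ m x]

lemma exists_summable_norm_mul_mode_le (γ : GaugePhase τ n) (s : ZMod n → ℂ) (P : Polynomial ℂ)
    (R : ℝ) : ∃ b : ℤ → ℝ, Summable b ∧ ∀ (m : ℤ) x, ‖x‖ ≤ R → ‖s m * mode γ P m x‖ ≤ b m := by
  obtain ⟨b, hb, mode_le⟩ := exists_summable_norm_mode_le γ P R
  refine ⟨fun m => (∑ z, ‖s z‖) * b m, hb.mul_left _, fun m x hx => ?_⟩
  rw [norm_mul]
  exact mul_le_mul
    (Finset.single_le_sum (f := fun z => ‖s z‖) (fun _ _ => norm_nonneg _) (Finset.mem_univ _))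
    (mode_le m x hx) (norm_nonneg _) (Finset.sum_nonneg fun _ _ => norm_nonneg _)

lemma summable_mul_mode (γ : GaugePhase τ n) (s : ZMod n → ℂ) (P : Polynomial ℂ) (x : ℂ) :
    Summable fun m : ℤ => s m * mode γ P m x := by
  obtain ⟨b, hb, mode_le⟩ := exists_summable_norm_mul_mode_le γ s P ‖x‖
  exact .of_norm_bounded hb fun m => mode_le m x le_rfl

lemma hasFDerivAt_mode (γ : GaugePhase τ n) (P : Polynomial ℂ) (m : ℤ) (x : ℂ) :
    HasFDerivAt (mode γ P m) (ofPartials fun j => mode γ (polyCov n j P) m x +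
      Complex.I * (potential n j x : ℂ) * mode γ P m x) x := by
  have n_ne_zero : (n : ℂ) ≠ 0 := NeZero.ne _
  have deriv_re : HasFDerivAt (fun x : ℂ => x.re) Complex.reCLM x := Complex.reCLM.hasFDerivAt
  have deriv_im : HasFDerivAt (fun x : ℂ => x.im) Complex.imCLM x := Complex.imCLM.hasFDerivAt
  have deriv_centeredIm : HasFDerivAt (centeredIm γ m) Complex.imCLM x := deriv_im.add_const _
  have deriv_phase : HasFDerivAt
      (fun x : ℂ => (n : ℝ) / 2 * x.re * x.im + momentum γ m * x.re + modePhase γ m) _ x :=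
    (((deriv_re.const_mul ((n : ℝ) / 2)).mul deriv_im).add
      (deriv_re.const_mul (momentum γ m))).add_const (modePhase γ m)
  have deriv_gaussian : HasFDerivAt (fun x : ℂ => (n : ℝ) / 2 * centeredIm γ m x ^ 2) _ x :=
    (deriv_centeredIm.pow 2).const_mul ((n : ℝ) / 2)
  have deriv_exponent : HasFDerivAt (fun x : ℂ => Complex.I *
      ((n : ℝ) / 2 * x.re * x.im + momentum γ m * x.re + modePhase γ m : ℝ) -
      ((n : ℝ) / 2 * centeredIm γ m x ^ 2 : ℝ)) _ x :=
    ((Complex.ofRealCLM.hasFDerivAt.comp x deriv_phase).const_mul Complex.I).sub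
      (Complex.ofRealCLM.hasFDerivAt.comp x deriv_gaussian)
  have deriv_polynomial : HasFDerivAt (fun x => P.eval (centeredIm γ m x : ℂ)) _ x :=
    HasFDerivAt.comp (g := fun z : ℂ => P.eval z) x
      (P.hasDerivAt (centeredIm γ m x : ℂ)).complexToReal_fderiv
      (Complex.ofRealCLM.hasFDerivAt.comp x deriv_centeredIm)
  have deriv_mode : HasFDerivAt (mode γ P m) _ x := deriv_exponent.cexp.mul deriv_polynomial
  refine deriv_mode.congr_fderiv (ContinuousLinearMap.ext fun v => ?_)
  have momentum_eq : (momentum γ m : ℂ) = n * (centeredIm γ m x - x.im) := by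
    rw [centeredIm]
    push_cast
    field_simp
    ring
  simp [ofPartials_apply, mode, polyCov, potential, basisVec, dot, perp, momentum_eq]
  ring

lemma exists_summable_norm_partial_le (γ : GaugePhase τ n) (s : ZMod n → ℂ) (P : Polynomial ℂ)
    (R : ℝ) (j : Fin 2) : ∃ b : ℤ → ℝ, Summable b ∧ ∀ (m : ℤ) x, ‖x‖ ≤ R →
      ‖s m * (mode γ (polyCov n j P) m x + Complex.I * (potential n j x : ℂ) * mode γ P m x)‖ ≤
        b m := by
  obtain ⟨b, hb, cov_le⟩ := exists_summable_norm_mul_mode_le γ s (polyCov n j P) R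
  obtain ⟨b', hb', mode_le⟩ := exists_summable_norm_mul_mode_le γ s P R
  obtain ⟨M, potential_le⟩ := (isCompact_closedBall (0 : ℂ) R).exists_bound_of_continuousOn
    (contDiff_I_mul_potential n j).continuous.continuousOn
  refine ⟨fun m => b m + M * b' m, hb.add (hb'.mul_left M), fun m x hx => ?_⟩
  have norm_le_M := potential_le x (mem_closedBall_zero_iff.2 hx)
  rw [mul_add, mul_left_comm]
  refine (norm_add_le _ _).trans (add_le_add (cov_le m x hx) ?_)
  rw [norm_mul]
  exact mul_le_mul norm_le_M (mode_le m x hx) (norm_nonneg _) ((norm_nonneg _).trans norm_le_M)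

lemma hasFDerivAt_modeSum (γ : GaugePhase τ n) (s : ZMod n → ℂ) (P : Polynomial ℂ) (x : ℂ) :
    HasFDerivAt (modeSum γ s P) (ofPartials fun j => modeSum γ s (polyCov n j P) x +
      Complex.I * (potential n j x : ℂ) * modeSum γ s P x) x := by
  choose b hb partial_le using exists_summable_norm_partial_le γ s P (‖x‖ + 1)
  have mem_ball : x ∈ Metric.ball (0 : ℂ) (‖x‖ + 1) := mem_ball_zero_iff.2 (lt_add_one _)
  have termwise := hasFDerivAt_tsum_of_isPreconnected (𝕜 := ℝ) ((hb 0).add (hb 1))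
    Metric.isOpen_ball (convex_ball (0 : ℂ) (‖x‖ + 1)).isPreconnected
    (f := fun m : ℤ => fun y => s m * mode γ P m y)
    (fun m y _ => (hasFDerivAt_mode γ P m y).const_mul (s m))
    (fun m y hy => by
      rw [smul_ofPartials]
      exact (norm_ofPartials_le _).trans (add_le_add
        (partial_le 0 m y (mem_ball_zero_iff.1 hy).le)
        (partial_le 1 m y (mem_ball_zero_iff.1 hy).le)))
    mem_ball (summable_mul_mode γ s P x) mem_ball
  refine termwise.congr_fderiv (HasSum.tsum_eq ?_)
  simp only [smul_ofPartials, mul_add, mul_left_comm (s _)]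
  exact hasSum_ofPartials fun j =>
    (summable_mul_mode γ s _ x).hasSum.add ((summable_mul_mode γ s P x).hasSum.mul_left _)

lemma contDiff_modeSum (γ : GaugePhase τ n) (s : ZMod n → ℂ) (P : Polynomial ℂ) :
    ContDiff ℝ ∞ (modeSum γ s P) := by
  rw [contDiff_infty]
  intro N
  induction N generalizing P with
  | zero =>
    rw [Nat.cast_zero, contDiff_zero]
    exact continuous_iff_continuousAt.2 fun x => (hasFDerivAt_modeSum γ s P x).continuousAt
  | succ N ih =>
    have contDiff_potential (j) :=
      (contDiff_I_mul_potential n j).of_le (m := N) (by exact_mod_cast le_top)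
    rw [Nat.cast_succ, contDiff_succ_iff_hasFDerivAt]
    refine ⟨_, ?_, hasFDerivAt_modeSum γ s P⟩
    exact (contDiff_const.smulRight ((ih _).add ((contDiff_potential 0).mul (ih P)))).add
      (contDiff_const.smulRight ((ih _).add ((contDiff_potential 1).mul (ih P))))

lemma covDeriv_modeSum (γ : GaugePhase τ n) (s : ZMod n → ℂ) (P : Polynomial ℂ) (j : Fin 2) :
    covDeriv n j (modeSum γ s P) = modeSum γ s (polyCov n j P) := by
  funext x
  rw [covDeriv, (hasFDerivAt_modeSum γ s P x).fderiv, ofPartials_basisVec, add_sub_cancel_right]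

end Modes

section ModePeriodicity

variable {τ : ℍ} {n : ℕ}

lemma scale_mul_self_mul_im (τ : ℍ) : scale τ * scale τ * τ.im = 2 * Real.pi := by
  rw [← scale_sq τ]; ring

lemma mode_add_latticePt_one_zero (γ : GaugePhase τ n) (P : Polynomial ℂ) (m : ℤ) (x : ℂ) :
    mode γ P m (x + (latticePt τ 1 0 : ℂ)) = gaugeFactor γ (latticePt τ 1 0) x * mode γ P m x := by
  have scale_ne_zero := (scale_pos τ).ne'
  have centeredIm_add : centeredIm γ m (x + (latticePt τ 1 0 : ℂ)) = centeredIm γ m x := by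
    simp [centeredIm, coe_latticePt_one_zero]
  have phase_add : (n : ℝ) / 2 * (x + (latticePt τ 1 0 : ℂ)).re * (x + (latticePt τ 1 0 : ℂ)).im +
      momentum γ m * (x + (latticePt τ 1 0 : ℂ)).re + modePhase γ m =
      ((n : ℝ) / 2 * dot x (perp (latticePt τ 1 0 : ℂ)) + γ.c (latticePt τ 1 0)) +
      ((n : ℝ) / 2 * x.re * x.im + momentum γ m * x.re + modePhase γ m) + 2 * Real.pi * m := by
    simp only [coe_latticePt_one_zero, dot, perp, momentum, Complex.add_re, Complex.add_im,
      Complex.ofReal_re, Complex.ofReal_im]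
    field_simp
    ring
  rw [mode, mode, gaugeFactor, centeredIm_add, phase_add, ← mul_assoc, ← Complex.exp_add]
  congr 1
  rw [Complex.exp_eq_exp_iff_exists_int]
  refine ⟨m, ?_⟩
  push_cast
  ring

lemma momentum_add (γ : GaugePhase τ n) (m : ℤ) :
    momentum γ (m + n) = momentum γ m + n * (scale τ * τ.im) := by
  have scale_ne_zero := (scale_pos τ).ne'
  rw [momentum, momentum]
  field_simp
  push_cast
  linear_combination (-n : ℝ) * scale_mul_self_mul_im τ

variable [NeZero n]

lemma modePhase_add (γ : GaugePhase τ n) (m : ℤ) :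
    modePhase γ (m + n) = modePhase γ m + Real.pi * τ.re * (2 * m + n) +
      (γ.c (latticePt τ 1 0) * τ.re - γ.c (latticePt τ 0 1)) := by
  have n_ne_zero : (n : ℝ) ≠ 0 := NeZero.ne _
  rw [modePhase, modePhase]
  push_cast
  field_simp
  ring

lemma mode_add_latticePt_zero_one (γ : GaugePhase τ n) (P : Polynomial ℂ) (m : ℤ) (x : ℂ) :
    mode γ P m (x + (latticePt τ 0 1 : ℂ)) =
      gaugeFactor γ (latticePt τ 0 1) x * mode γ P (m + n) x := by
  have n_ne_zero : (n : ℝ) ≠ 0 := NeZero.ne _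
  have centeredIm_add : centeredIm γ m (x + (latticePt τ 0 1 : ℂ)) = centeredIm γ (m + n) x := by
    rw [centeredIm, centeredIm, momentum_add, coe_latticePt_zero_one, Complex.add_im,
      Complex.im_ofReal_mul, UpperHalfPlane.coe_im]
    field_simp
    ring
  have momentum_mul_scale :
      momentum γ m * scale τ = 2 * Real.pi * m + γ.c (latticePt τ 1 0) :=
    div_mul_cancel₀ _ (scale_pos τ).ne'
  have phase_add : (n : ℝ) / 2 * (x + (latticePt τ 0 1 : ℂ)).re * (x + (latticePt τ 0 1 : ℂ)).im +
      momentum γ m * (x + (latticePt τ 0 1 : ℂ)).re + modePhase γ m =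
      ((n : ℝ) / 2 * dot x (perp (latticePt τ 0 1 : ℂ)) + γ.c (latticePt τ 0 1)) +
      ((n : ℝ) / 2 * x.re * x.im + momentum γ (m + n) * x.re + modePhase γ (m + n)) := by
    rw [momentum_add, modePhase_add]
    simp only [coe_latticePt_zero_one, dot, perp, Complex.add_re, Complex.add_im, Complex.mul_re,
      Complex.mul_im, Complex.ofReal_re, Complex.ofReal_im, UpperHalfPlane.coe_re,
      UpperHalfPlane.coe_im]
    linear_combination τ.re * momentum_mul_scale + (n : ℝ) / 2 * τ.re * scale_mul_self_mul_im τ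
  rw [mode, mode, gaugeFactor, centeredIm_add, phase_add, ← mul_assoc, ← Complex.exp_add]
  congr 2
  push_cast
  ring

lemma modeSum_add_lattice (γ : GaugePhase τ n) (s : ZMod n → ℂ) (P : Polynomial ℂ) (t : lattice τ)
    (x : ℂ) : modeSum γ s P (x + (t : ℂ)) = gaugeFactor γ t x * modeSum γ s P x := by
  refine gauge_periodic_of_basis (fun x => ?_) (fun x => ?_) t x
  · simp only [modeSum, mode_add_latticePt_one_zero, ← tsum_mul_left, mul_left_comm (s _)]
  · simp only [modeSum, mode_add_latticePt_zero_one, ← tsum_mul_left, mul_left_comm (s _)]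
    rw [← (Equiv.addRight (n : ℤ)).tsum_eq
      fun m => gaugeFactor γ (latticePt τ 0 1) x * (s m * mode γ P m x)]
    simp

/-- The superposition of modes as a smooth gauge-periodic function. -/
def smoothMode (γ : GaugePhase τ n) (s : ZMod n → ℂ) (P : Polynomial ℂ) : smoothGauge γ :=
  ⟨modeSum γ s P, contDiff_modeSum γ s P, modeSum_add_lattice γ s P⟩

lemma smoothCov_smoothMode (γ : GaugePhase τ n) (s : ZMod n → ℂ) (P : Polynomial ℂ) (j : Fin 2) :
    smoothCov γ j (smoothMode γ s P) = smoothMode γ s (polyCov n j P) :=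
  Subtype.ext (covDeriv_modeSum γ s P j)

lemma smoothMode_add (γ : GaugePhase τ n) (s : ZMod n → ℂ) (P Q : Polynomial ℂ) :
    smoothMode γ s (P + Q) = smoothMode γ s P + smoothMode γ s Q := by
  refine Subtype.ext (funext fun x => ?_)
  change modeSum γ s (P + Q) x = modeSum γ s P x + modeSum γ s Q x
  simp only [modeSum, mode_add, mul_add]
  exact (summable_mul_mode γ s P x).tsum_add (summable_mul_mode γ s Q x)

lemma smoothMode_C_mul (γ : GaugePhase τ n) (s : ZMod n → ℂ) (a : ℂ) (P : Polynomial ℂ) :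
    smoothMode γ s (Polynomial.C a * P) = a • smoothMode γ s P := by
  refine Subtype.ext (funext fun x => ?_)
  change modeSum γ s (Polynomial.C a * P) x = a * modeSum γ s P x
  simp only [modeSum, mode_C_mul, mul_left_comm (s _), tsum_mul_left]

lemma lowering_smoothMode_one (γ : GaugePhase τ n) (s : ZMod n → ℂ) :
    lowering (smoothCov γ) (smoothMode γ s 1) = 0 := by
  have polynomial_eq_zero :
      polyCov n 0 1 + Polynomial.C Complex.I * polyCov n 1 1 = Polynomial.C 0 * 1 := by
    simp [polyCov, ← mul_assoc]
  rw [lowering_apply, smoothCov_smoothMode, smoothCov_smoothMode, ← smoothMode_C_mul,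
    ← smoothMode_add, polynomial_eq_zero, smoothMode_C_mul, zero_smul]

end ModePeriodicity

section Uniqueness

/-! ### Uniqueness of Fourier transforms, moments and Fourier coefficients -/

open scoped FourierTransform in
lemma ae_eq_zero_of_fourier_eq_zero {V E : Type*} [NormedAddCommGroup V] [InnerProductSpace ℝ V]
    [FiniteDimensional ℝ V] [MeasurableSpace V] [BorelSpace V] [NormedAddCommGroup E]
    [NormedSpace ℂ E] [CompleteSpace E] {w : V → E} (hw : Integrable w) (h : ∀ ξ, 𝓕 w ξ = 0) :
    w =ᵐ[volume] 0 := by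
  refine ae_eq_zero_of_integral_contDiff_smul_eq_zero hw.locallyIntegrable
    fun φ contDiff_φ support_φ => ?_
  let ψ : SchwartzMap V ℂ :=
    (support_φ.comp_left (g := ((↑) : ℝ → ℂ)) rfl).toSchwartzMap
      (Complex.ofRealCLM.contDiff.comp contDiff_φ)
  let χ : SchwartzMap V ℂ := 𝓕⁻ ψ
  have fourier_χ : 𝓕 (χ : V → ℂ) = fun x => (φ x : ℂ) := by
    rw [← SchwartzMap.fourier_coe, FourierTransform.fourier_fourierInv_eq]
    rfl
  have parseval := VectorFourier.integral_fourierIntegral_smul_eq_flip (L := innerₗ V)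
    (μ := (volume : Measure V)) (ν := (volume : Measure V)) Real.continuous_fourierChar
    continuous_inner χ.integrable hw
  rw [flip_innerₗ] at parseval
  change ∫ ξ, 𝓕 (χ : V → ℂ) ξ • w ξ = ∫ x, χ x • 𝓕 w x at parseval
  simpa only [fourier_χ, h, smul_zero, integral_zero, Complex.coe_smul] using parseval

lemma hasSum_integral_pow_mul {μ : Measure ℝ} {w : ℝ → ℂ} (a : ℂ) (hw : AEStronglyMeasurable w μ)
    (hexp : Integrable (fun q => (Real.exp (‖a‖ * |q|) : ℂ) * w q) μ) :
    HasSum (fun k : ℕ => a ^ k / k.factorial * ∫ q, (q : ℂ) ^ k * w q ∂μ)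
      (∫ q, Complex.exp (a * q) * w q ∂μ) := by
  have exp_series (q : ℝ) :
      HasSum (fun k : ℕ => a ^ k / k.factorial * ((q : ℂ) ^ k * w q))
        (Complex.exp (a * q) * w q) := by
    have exp_hasSum := (NormedSpace.expSeries_div_hasSum_exp (a * q)).mul_right (w q)
    rw [← Complex.exp_eq_exp_ℂ] at exp_hasSum
    exact exp_hasSum.congr_fun fun k => by rw [mul_pow]; ring
  have norm_exp_series (q : ℝ) : HasSum (fun k : ℕ => (‖a‖ * |q|) ^ k / k.factorial * ‖w q‖)
      (Real.exp (‖a‖ * |q|) * ‖w q‖) := by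
    have exp_hasSum := (NormedSpace.expSeries_div_hasSum_exp (‖a‖ * |q|)).mul_right ‖w q‖
    rwa [← Real.exp_eq_exp_ℝ] at exp_hasSum
  simp only [← integral_const_mul]
  refine hasSum_integral_of_dominated_convergence
    (fun k q => (‖a‖ * |q|) ^ k / k.factorial * ‖w q‖) (fun k => ?_) (fun k => ?_)
    (.of_forall fun q => (norm_exp_series q).summable) (hexp.norm.congr ?_)
    (.of_forall exp_series)
  · exact ((by fun_prop : Continuous fun q : ℝ => (q : ℂ) ^ k).aestronglyMeasurable.mul
      hw).const_mul _
  · refine .of_forall fun q => le_of_eq ?_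
    simp only [norm_mul, norm_div, norm_pow, RCLike.norm_natCast, Complex.norm_real,
      Real.norm_eq_abs]
    ring
  · refine .of_forall fun q => ?_
    simp only [(norm_exp_series q).tsum_eq, norm_mul, Complex.norm_real, Real.norm_eq_abs,
      Real.abs_exp]

lemma ae_eq_zero_of_moments_eq_zero {w : ℝ → ℂ}
    (hw : ∀ c : ℝ, Integrable fun q => (Real.exp (c * |q|) : ℂ) * w q)
    (h : ∀ k : ℕ, ∫ q : ℝ, (q : ℂ) ^ k * w q = 0) : w =ᵐ[volume] 0 := by
  have integrable_w : Integrable w := by simpa using hw 0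
  refine ae_eq_zero_of_fourier_eq_zero integrable_w fun ξ => ?_
  have moment_series :=
    hasSum_integral_pow_mul (-(2 * Real.pi * ξ * Complex.I)) integrable_w.1 (hw _)
  simp only [h, mul_zero] at moment_series
  rw [Real.fourier_eq']
  refine Eq.trans ?_ (hasSum_zero.unique moment_series).symm
  congr! 2
  rw [smul_eq_mul, RCLike.inner_apply, conj_trivial]
  congr 2
  push_cast
  ring

lemma ae_eq_zero_of_fourierCoeff_eq_zero {f : ℝ → ℂ}
    (hf : MemLp f 2 (volume.restrict (Set.Ico (0 : ℝ) 1)))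
    (h : ∀ m : ℤ, ∫ p in Set.Ico (0 : ℝ) 1,
      Complex.exp (-(2 * Real.pi * Complex.I * m * p)) * f p = 0) :
    f =ᵐ[volume.restrict (Set.Ico (0 : ℝ) 1)] 0 := by
  rw [restrict_Ico_eq_restrict_Ioc] at hf h ⊢
  have coeff_eq_zero (m : ℤ) : fourierCoeffOn zero_lt_one f m = 0 := by
    rw [fourierCoeffOn_eq_integral, intervalIntegral.integral_of_le zero_le_one, ← h m]
    simp only [sub_zero, div_one, one_smul, fourier_coe_apply, smul_eq_mul]
    congr! 4
    push_cast
    ring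
  have parseval := hasSum_sq_fourierCoeffOn zero_lt_one hf
  simp only [coeff_eq_zero, norm_zero, ne_eq, OfNat.ofNat_ne_zero, not_false_eq_true, zero_pow,
    sub_zero, inv_one, one_smul] at parseval
  have integral_sq := (hasSum_zero.unique parseval).symm
  rw [intervalIntegral.integral_of_le zero_le_one, integral_eq_zero_iff_of_nonneg
    (fun p => sq_nonneg ‖f p‖) ((memLp_two_iff_integrable_sq_norm hf.1).1 hf)] at integral_sq
  filter_upwards [integral_sq] with p sq_eq_zero
  simpa using sq_eq_zero

end Uniqueness

section Strip

/-! ### Unfolding an integral over a cell to a strip -/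

lemma exists_map_volume_eq_smul {E F : Type*} [NormedAddCommGroup E] [NormedSpace ℝ E]
    [MeasureSpace E] [BorelSpace E] [NormedAddCommGroup F] [NormedSpace ℝ F] [MeasureSpace F]
    [BorelSpace F] [FiniteDimensional ℝ F] [(volume : Measure E).IsAddHaarMeasure]
    [(volume : Measure F).IsAddHaarMeasure] (L : E ≃L[ℝ] F) :
    ∃ c : ENNReal, c ≠ ⊤ ∧ (volume : Measure E).map L = c • (volume : Measure F) :=
  have : ((volume : Measure E).map L).IsAddHaarMeasure := L.isAddHaarMeasure_map _
  ⟨_, ENNReal.coe_ne_top, Measure.isAddLeftInvariant_eq_smul _ _⟩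

lemma quasiMeasurePreserving_continuousLinearEquiv {E F : Type*} [NormedAddCommGroup E]
    [NormedSpace ℝ E] [MeasureSpace E] [BorelSpace E] [NormedAddCommGroup F] [NormedSpace ℝ F]
    [MeasureSpace F] [BorelSpace F] [FiniteDimensional ℝ F]
    [(volume : Measure E).IsAddHaarMeasure] [(volume : Measure F).IsAddHaarMeasure]
    (L : E ≃L[ℝ] F) : Measure.QuasiMeasurePreserving L volume volume := by
  obtain ⟨c, -, map_eq⟩ := exists_map_volume_eq_smul L
  exact ⟨L.continuous.measurable, map_eq ▸ Measure.smul_absolutelyContinuous⟩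

/-- The strip `ℝ × [0, 1)`, for the lattice coordinates taken in the order `(q, p)`. -/
def strip : Set (ℝ × ℝ) := Set.univ ×ˢ Set.Ico 0 1

/-- The unit square `[k, k + 1) × [0, 1)` of the strip. -/
def stripSquare (k : ℤ) : Set (ℝ × ℝ) := Set.Ico (k : ℝ) (k + 1) ×ˢ Set.Ico 0 1

lemma iUnion_stripSquare : ⋃ k, stripSquare k = strip := by
  simp only [stripSquare, strip, ← Set.iUnion_prod_const, iUnion_Ico_intCast]

lemma measurableSet_stripSquare (k : ℤ) : MeasurableSet (stripSquare k) :=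
  measurableSet_Ico.prod measurableSet_Ico

lemma pairwise_disjoint_stripSquare : Pairwise (Function.onFun Disjoint stripSquare) :=
  fun _ _ hkl => Set.disjoint_prod.2 (.inl (Set.pairwise_disjoint_Ico_intCast ℝ hkl))

lemma restrict_strip : (volume : Measure (ℝ × ℝ)).restrict strip =
    (volume : Measure ℝ).prod (volume.restrict (Set.Ico 0 1)) := by
  rw [strip, Measure.volume_eq_prod, ← Measure.prod_restrict, Measure.restrict_univ]

lemma restrict_stripSquare_zero : (volume : Measure (ℝ × ℝ)).restrict (stripSquare 0) =
    (volume.restrict (Set.Ico (0 : ℝ) 1)).prod (volume.restrict (Set.Ico 0 1)) := by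
  rw [stripSquare, Measure.volume_eq_prod, ← Measure.prod_restrict, Int.cast_zero, zero_add]

lemma measurableEmbedding_add_right (a : ℝ × ℝ) : MeasurableEmbedding fun z => z + a :=
  (Homeomorph.addRight a).measurableEmbedding

lemma measurePreserving_add_stripSquare (k : ℤ) :
    MeasurePreserving (fun z : ℝ × ℝ => z + ((k : ℝ), 0)) (volume.restrict (stripSquare 0))
      (volume.restrict (stripSquare k)) := by
  have preimage_add :
      (fun z : ℝ × ℝ => z + ((k : ℝ), 0)) ⁻¹' stripSquare k = stripSquare 0 := by
    ext ⟨q, p⟩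
    simp only [stripSquare, Set.mem_preimage, Prod.mk_add_mk, add_zero, Set.mem_prod, Set.mem_Ico,
      Int.cast_zero, zero_add, le_add_iff_nonneg_right, add_comm q, add_lt_add_iff_left]
  rw [← preimage_add]
  exact (measurePreserving_add_right volume _).restrict_preimage (measurableSet_stripSquare k)

lemma hasSum_integral_stripSquare {E : Type*} [NormedAddCommGroup E] [NormedSpace ℝ E]
    {F : ℝ × ℝ → E} (hF : IntegrableOn F strip) :
    HasSum (fun k : ℤ => ∫ z in stripSquare 0, F (z + ((k : ℝ), 0))) (∫ z in strip, F z) := by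
  simp only [(measurePreserving_add_stripSquare _).integral_comp (measurableEmbedding_add_right _)]
  rw [← iUnion_stripSquare] at hF ⊢
  exact hasSum_integral_iUnion measurableSet_stripSquare pairwise_disjoint_stripSquare hF

lemma integral_strip_eq {E : Type*} [NormedAddCommGroup E] [NormedSpace ℝ E] {F : ℝ × ℝ → E}
    (hF : IntegrableOn F strip) :
    ∫ z in strip, F z = ∫ z in stripSquare 0, ∑' k : ℤ, F (z + ((k : ℝ), 0)) := by
  have integrableOn_add (k : ℤ) :
      IntegrableOn (fun z => F (z + ((k : ℝ), 0))) (stripSquare 0) :=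
    ((measurePreserving_add_stripSquare k).integrable_comp_emb
      (measurableEmbedding_add_right _)).2
      (hF.mono_set (iUnion_stripSquare ▸ Set.subset_iUnion stripSquare k))
  exact (hasSum_integral_stripSquare hF).unique (hasSum_integral_of_summable_integral_norm
    integrableOn_add (hasSum_integral_stripSquare hF.norm).summable)

lemma integrableOn_strip_mul {v G : ℝ × ℝ → ℂ} (hv : IntegrableOn v (stripSquare 0))
    (aesm_v : AEStronglyMeasurable v volume)
    (norm_v_add : ∀ k : ℤ, ∀ᵐ z, ‖v (z + ((k : ℝ), 0))‖ₑ = ‖v z‖ₑ) (hG : Continuous G) {C : ℝ}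
    (hC : 0 ≤ C) (norm_G_le : ∀ z, ‖G z‖ ≤ C * Real.exp (-|z.1|)) :
    IntegrableOn (fun z => G z * v z) strip := by
  refine ⟨(hG.aestronglyMeasurable.mul aesm_v).restrict, ?_⟩
  rw [hasFiniteIntegral_iff_enorm, ← iUnion_stripSquare,
    lintegral_iUnion measurableSet_stripSquare pairwise_disjoint_stripSquare]
  have norm_G_add_le (k : ℤ) {z : ℝ × ℝ} (hz : z ∈ stripSquare 0) :
      ‖G (z + ((k : ℝ), 0))‖ ≤ C * Real.exp 1 * Real.exp (-(1 * |(k : ℝ)|)) := by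
    refine (norm_G_le _).trans ?_
    rw [mul_assoc, ← Real.exp_add]
    gcongr
    obtain ⟨⟨q_nonneg, q_lt⟩, -⟩ := hz
    simp only [Int.cast_zero, zero_add] at q_nonneg q_lt
    have abs_sub_le := abs_sub (z.1 + k) z.1
    rw [add_sub_cancel_left, abs_of_nonneg q_nonneg] at abs_sub_le
    simp only [Prod.fst_add]
    linarith
  have lintegral_stripSquare_le (k : ℤ) : ∫⁻ z in stripSquare k, ‖G z * v z‖ₑ ≤
      ENNReal.ofReal (C * Real.exp 1 * Real.exp (-(1 * |(k : ℝ)|))) *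
        ∫⁻ z in stripSquare 0, ‖v z‖ₑ := by
    rw [← (measurePreserving_add_stripSquare k).lintegral_comp_emb
      (measurableEmbedding_add_right _), ← lintegral_const_mul' _ _ ENNReal.ofReal_ne_top]
    refine lintegral_mono_ae ?_
    filter_upwards [ae_restrict_of_ae (norm_v_add k), ae_restrict_mem (measurableSet_stripSquare 0)]
      with z enorm_v_add hz
    rw [enorm_mul, enorm_v_add, ← ofReal_norm (G _)]
    gcongr
    exact norm_G_add_le k hz
  refine (ENNReal.tsum_le_tsum lintegral_stripSquare_le).trans_lt ?_
  rw [ENNReal.tsum_mul_right]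
  exact ENNReal.mul_lt_top
    ((summable_exp_neg_mul_abs one_pos).mul_left _).tsum_ofReal_lt_top hv.2

end Strip

section LatticeCoordinates

variable {τ : ℍ} {n : ℕ}

/-- The lattice coordinates `(q, p) ↦ √(2π / Im τ) (p + q τ)` as a linear equivalence. The
coordinate `q` comes first because the strip is unbounded in the direction of `τ`. -/
def ptEquiv (τ : ℍ) : (ℝ × ℝ) ≃L[ℝ] ℂ :=
  LinearEquiv.toContinuousLinearEquiv
    { toFun := fun z => pt τ z.2 z.1
      map_add' := fun _ _ => pt_add τ _ _ _ _
      map_smul' := fun c z => by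
        simp only [pt, Prod.smul_fst, Prod.smul_snd, smul_eq_mul, Complex.ofReal_mul,
          RingHom.id_apply, Complex.real_smul]
        ring
      invFun := fun x => (coordQ τ x, coordP τ x)
      left_inv := fun _ => Prod.ext (coordQ_pt τ _ _) (coordP_pt τ _ _)
      right_inv := fun x => pt_coord τ x }

lemma ptEquiv_apply (τ : ℍ) (z : ℝ × ℝ) : ptEquiv τ z = pt τ z.2 z.1 := rfl

lemma measurableEmbedding_ptEquiv (τ : ℍ) : MeasurableEmbedding (ptEquiv τ) :=
  (ptEquiv τ).toHomeomorph.measurableEmbedding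

lemma ptEquiv_add (τ : ℍ) (z : ℝ × ℝ) (k : ℤ) :
    ptEquiv τ (z + ((k : ℝ), 0)) = ptEquiv τ z + (latticePt τ 0 k : ℂ) := by
  rw [map_add]
  simp [ptEquiv_apply, latticePt]

lemma preimage_ptEquiv_cell (τ : ℍ) : ptEquiv τ ⁻¹' cell τ = stripSquare 0 := by
  ext ⟨q, p⟩
  rw [Set.mem_preimage, ptEquiv_apply, mem_cell_iff, coordP_pt, coordQ_pt]
  simp [stripSquare, and_comm]

lemma exists_map_restrict_stripSquare_eq_smul (τ : ℍ) : ∃ c : ENNReal, c ≠ ⊤ ∧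
    (volume.restrict (stripSquare 0)).map (ptEquiv τ) = c • volume.restrict (cell τ) := by
  obtain ⟨c, hc, map_eq⟩ := exists_map_volume_eq_smul (ptEquiv τ)
  refine ⟨c, hc, ?_⟩
  rw [← preimage_ptEquiv_cell τ, ← Measure.restrict_map (ptEquiv τ).continuous.measurable
    (measurableSet_cell τ), map_eq, Measure.restrict_smul]

lemma memLp_comp_ptEquiv {E : Type*} [NormedAddCommGroup E] {f : ℂ → E} {p : ENNReal}
    (hf : MemLp f p (volume.restrict (cell τ))) :
    MemLp (fun z => f (ptEquiv τ z)) p (volume.restrict (stripSquare 0)) := by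
  obtain ⟨c, hc, map_eq⟩ := exists_map_restrict_stripSquare_eq_smul τ
  exact (measurableEmbedding_ptEquiv τ).memLp_map_measure_iff.1 (map_eq ▸ hf.smul_measure hc)

lemma setIntegral_comp_ptEquiv_eq_zero {E : Type*} [NormedAddCommGroup E] [NormedSpace ℝ E]
    {f : ℂ → E} (hf : ∫ x in cell τ, f x = 0) : ∫ z in stripSquare 0, f (ptEquiv τ z) = 0 := by
  obtain ⟨c, -, map_eq⟩ := exists_map_restrict_stripSquare_eq_smul τ
  rw [← (measurableEmbedding_ptEquiv τ).integral_map, map_eq, integral_smul_measure, hf, smul_zero]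

lemma ae_add_comp_ptEquiv {γ : GaugePhase τ n} (u : GaugeL2 γ) (k : ℤ) :
    ∀ᵐ z, u.1 (ptEquiv τ (z + ((k : ℝ), 0))) =
      gaugeFactor γ (latticePt τ 0 k) (ptEquiv τ z) * u.1 (ptEquiv τ z) := by
  filter_upwards [(quasiMeasurePreserving_continuousLinearEquiv (ptEquiv τ)).ae
    (u.2.1 (latticePt τ 0 k))] with z periodic
  rw [ptEquiv_add, periodic]

end LatticeCoordinates

section Completeness

/-! ### Completeness of the modes -/

lemma exists_gaussian_mul_polynomial_affine_le {α : ℝ} (hα : 0 < α) (P : Polynomial ℂ) {a : ℝ}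
    (ha : a ≠ 0) (b : ℝ) {c : ℝ} (hc : 0 ≤ c) : ∃ C : ℝ, 0 ≤ C ∧ ∀ q : ℝ,
      Real.exp (-(α * (a * q + b) ^ 2)) * ‖P.eval ((a * q + b : ℝ) : ℂ)‖ ≤
        C * Real.exp (-(c * |q|)) := by
  obtain ⟨C, hC, le_exp⟩ := exists_gaussian_mul_polynomial_le hα P (c / |a|)
  refine ⟨C * Real.exp (c / |a| * |b|), by positivity, fun q => (le_exp _).trans ?_⟩
  rw [mul_assoc, ← Real.exp_add]
  refine mul_le_mul_of_nonneg_left (Real.exp_le_exp.2 ?_) hC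
  have abs_le : |a| * |q| ≤ |a * q + b| + |b| := by
    simpa [abs_mul] using abs_sub (a * q + b) b
  calc -(c / |a| * |a * q + b|)
      = c / |a| * |b| + -(c / |a| * (|a * q + b| + |b|)) := by ring
    _ ≤ c / |a| * |b| + -(c / |a| * (|a| * |q|)) := by gcongr
    _ = c / |a| * |b| + -(c * |q|) := by field_simp

variable {τ : ℍ} {n : ℕ}

lemma centeredIm_ptEquiv (γ : GaugePhase τ n) (m : ℤ) (z : ℝ × ℝ) :
    centeredIm γ m (ptEquiv τ z) = scale τ * τ.im * z.1 + momentum γ m / n := by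
  rw [centeredIm, ptEquiv_apply, pt_im]
  ring

lemma exists_mode_eq_pow_mul (γ : GaugePhase τ n) (m : ℤ) (k : ℕ) : ∃ P : Polynomial ℂ,
    ∀ z, mode γ P m (ptEquiv τ z) = (z.1 : ℂ) ^ k * mode γ 1 m (ptEquiv τ z) := by
  have slope_ne_zero : ((scale τ * τ.im : ℝ) : ℂ) ≠ 0 :=
    Complex.ofReal_ne_zero.2 (mul_pos (scale_pos τ) τ.im_pos).ne'
  refine ⟨(Polynomial.C ((scale τ * τ.im : ℝ) : ℂ)⁻¹ *
    (Polynomial.X - Polynomial.C ((momentum γ m / n : ℝ) : ℂ))) ^ k, fun z => ?_⟩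
  rw [mode, mode, centeredIm_ptEquiv, Polynomial.eval_pow, Polynomial.eval_mul, Polynomial.eval_C,
    Polynomial.eval_sub, Polynomial.eval_X, Polynomial.eval_C, ← Complex.ofReal_sub,
    add_sub_cancel_right, Complex.ofReal_mul (scale τ * τ.im), inv_mul_cancel_left₀ slope_ne_zero,
    Polynomial.eval_one, mul_one, mul_comm]

/-- The unimodular factor common to all modes on a line parallel to the first basis vector of the
lattice; divided by it, the modes become the characters `exp (2πimp)`. -/
def modeTwist (γ : GaugePhase τ n) (p q : ℝ) : ℂ :=
  Complex.exp (Complex.I * ((n : ℝ) / 2 * (pt τ p q).re * (pt τ p q).im +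
    γ.c (latticePt τ 1 0) * p : ℝ))

lemma norm_modeTwist (γ : GaugePhase τ n) (p q : ℝ) : ‖modeTwist γ p q‖ = 1 := by
  rw [modeTwist, mul_comm, Complex.norm_exp_ofReal_mul_I]

lemma continuous_modeTwist (γ : GaugePhase τ n) (q : ℝ) : Continuous fun p => modeTwist γ p q := by
  simp only [modeTwist, pt_re, pt_im]
  fun_prop

lemma exists_mode_one_eq (γ : GaugePhase τ n) (m : ℤ) (q : ℝ) : ∃ K : ℂ, K ≠ 0 ∧ ∀ p,
    mode γ 1 m (pt τ p q) =
      K * (Complex.exp (2 * Real.pi * Complex.I * m * p) * modeTwist γ p q) := by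
  refine ⟨Complex.exp (Complex.I * (momentum γ m * scale τ * (q * τ.re) + modePhase γ m : ℝ) -
    ((n : ℝ) / 2 * centeredIm γ m (pt τ 0 q) ^ 2 : ℝ)), Complex.exp_ne_zero _, fun p => ?_⟩
  have centeredIm_eq : centeredIm γ m (pt τ p q) = centeredIm γ m (pt τ 0 q) := by
    simp only [centeredIm, pt_im]
  have momentum_mul_scale :
      momentum γ m * scale τ = 2 * Real.pi * m + γ.c (latticePt τ 1 0) :=
    div_mul_cancel₀ _ (scale_pos τ).ne'
  have phase_eq : (n : ℝ) / 2 * (pt τ p q).re * (pt τ p q).im + momentum γ m * (pt τ p q).re +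
      modePhase γ m =
      (momentum γ m * scale τ * (q * τ.re) + modePhase γ m) + 2 * Real.pi * m * p +
      ((n : ℝ) / 2 * (pt τ p q).re * (pt τ p q).im + γ.c (latticePt τ 1 0) * p) := by
    rw [pt_re]
    linear_combination p * momentum_mul_scale
  rw [mode, modeTwist, centeredIm_eq, phase_eq, Polynomial.eval_one, mul_one, ← Complex.exp_add,
    ← Complex.exp_add]
  congr 1
  push_cast
  ring

lemma ae_eq_zero_of_integral_mode_eq_zero {γ : GaugePhase τ n} {q : ℝ} {f : ℝ → ℂ}
    (hf : MemLp f 2 (volume.restrict (Set.Ico (0 : ℝ) 1)))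
    (h : ∀ m, ∫ p in Set.Ico (0 : ℝ) 1, conj (mode γ 1 m (pt τ p q)) * f p = 0) :
    f =ᵐ[volume.restrict (Set.Ico (0 : ℝ) 1)] 0 := by
  have memLp_twist : MemLp (fun p => conj (modeTwist γ p q) * f p) 2
      (volume.restrict (Set.Ico (0 : ℝ) 1)) := by
    refine hf.congr_norm ((Complex.continuous_conj.comp
      (continuous_modeTwist γ q)).aestronglyMeasurable.mul hf.1) (.of_forall fun p => ?_)
    rw [norm_mul, RCLike.norm_conj, norm_modeTwist, one_mul]
  have twist_eq_zero := ae_eq_zero_of_fourierCoeff_eq_zero memLp_twist fun m => by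
    obtain ⟨K, K_ne_zero, mode_eq⟩ := exists_mode_one_eq γ m q
    refine (mul_eq_zero.1 (?_ : conj K * _ = 0)).resolve_left ((map_ne_zero _).2 K_ne_zero)
    rw [← h m, ← integral_const_mul]
    congr! 2
    rw [mode_eq, map_mul, map_mul, ← Complex.exp_conj]
    simp only [map_mul, Complex.conj_ofReal, Complex.conj_I, map_ofNat, map_intCast]
    ring_nf
  filter_upwards [twist_eq_zero] with p hp
  refine (mul_eq_zero.1 hp).resolve_left ?_
  rw [← norm_eq_zero, RCLike.norm_conj, norm_modeTwist]
  exact one_ne_zero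

lemma eq_zero_of_ae_slice_eq_zero {γ : GaugePhase τ n} {u : GaugeL2 γ}
    (hu : ∀ᵐ q ∂(volume.restrict (Set.Ico (0 : ℝ) 1)),
      (fun p => u.1 (pt τ p q)) =ᵐ[volume.restrict (Set.Ico (0 : ℝ) 1)] 0) : u = 0 := by
  have aesm_square := (memLp_comp_ptEquiv u.2.2).1
  have square_eq_zero :
      (fun z => u.1 (ptEquiv τ z)) =ᵐ[volume.restrict (stripSquare 0)] 0 := by
    rw [restrict_stripSquare_zero] at aesm_square ⊢
    have lintegral_eq_zero : ∫⁻ z, ‖u.1 (ptEquiv τ z)‖ₑ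
        ∂(volume.restrict (Set.Ico (0 : ℝ) 1)).prod (volume.restrict (Set.Ico 0 1)) = 0 := by
      rw [lintegral_prod _ aesm_square.enorm]
      refine lintegral_eq_zero_of_ae_eq_zero ?_
      filter_upwards [hu] with q slice_eq_zero
      refine lintegral_eq_zero_of_ae_eq_zero ?_
      filter_upwards [slice_eq_zero] with p eq_zero
      simpa [ptEquiv_apply] using eq_zero
    filter_upwards [(lintegral_eq_zero_iff' aesm_square.enorm).1 lintegral_eq_zero] with z eq_zero
    simpa using eq_zero
  have cell_eq_zero : u.1 =ᵐ[volume.restrict (cell τ)] 0 := by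
    rw [Filter.EventuallyEq, ae_restrict_iff' (measurableSet_stripSquare 0)] at square_eq_zero
    refine (ae_restrict_iff' (measurableSet_cell τ)).2 ?_
    filter_upwards [(quasiMeasurePreserving_continuousLinearEquiv (ptEquiv τ).symm).ae
      square_eq_zero] with x eq_zero hx
    rw [← preimage_ptEquiv_cell τ] at eq_zero
    simpa [hx] using eq_zero
  exact Subtype.ext (AEEqFun.ext ((eq_zero_of_cell u.2.1 cell_eq_zero).trans
    AEEqFun.coeFn_zero.symm))

variable [NeZero n]

lemma mode_add_latticePt_zero (γ : GaugePhase τ n) (P : Polynomial ℂ) (k m : ℤ) (x : ℂ) :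
    mode γ P m (x + (latticePt τ 0 k : ℂ)) =
      gaugeFactor γ (latticePt τ 0 k) x * mode γ P (m + k * n) x := by
  have tau_mem : (latticePt τ 0 1, (n : ℤ)) ∈ gaugeShifts γ (mode γ P) :=
    mode_add_latticePt_zero_one γ P
  have latticePt_eq : latticePt τ 0 k = k • latticePt τ 0 1 :=
    Subtype.ext (by simp [latticePt, pt, mul_left_comm])
  rw [latticePt_eq, ← smul_eq_mul]
  exact zsmul_mem tau_mem k m x

lemma modeSum_single (γ : GaugePhase τ n) (P : Polynomial ℂ) (m : ℤ) (x : ℂ) :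
    modeSum γ (Pi.single (m : ZMod n) 1) P x = ∑' k : ℤ, mode γ P (m + k * n) x := by
  have shift_injective : Function.Injective fun k : ℤ => m + k * n := fun k l h =>
    mul_right_cancel₀ (mod_cast NeZero.ne n) (add_left_cancel h)
  rw [modeSum, ← shift_injective.tsum_eq]
  · exact tsum_congr fun k => by simp
  · intro l mem_support
    have l_eq : (l : ZMod n) = m := by
      by_contra l_ne
      exact mem_support (by simp [Pi.single_eq_of_ne l_ne])
    obtain ⟨k, hk⟩ := (ZMod.intCast_eq_intCast_iff_dvd_sub _ _ _).1 l_eq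
    exact ⟨-k, by linear_combination hk⟩

lemma continuous_mode (γ : GaugePhase τ n) (P : Polynomial ℂ) (m : ℤ) : Continuous (mode γ P m) :=
  continuous_iff_continuousAt.2 fun x => (hasFDerivAt_mode γ P m x).continuousAt

lemma integrableOn_strip_exp_mul_mode {γ : GaugePhase τ n} (u : GaugeL2 γ) (P : Polynomial ℂ)
    (m : ℤ) (c : ℝ) :
    IntegrableOn (fun z => (Real.exp (c * |z.1|) : ℂ) * conj (mode γ P m (ptEquiv τ z)) *
      u.1 (ptEquiv τ z)) strip := by
  have n_pos : (0 : ℝ) < n := mod_cast NeZero.pos n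
  have slope_ne_zero : scale τ * τ.im ≠ 0 := (mul_pos (scale_pos τ) τ.im_pos).ne'
  obtain ⟨C, hC, le_exp⟩ := exists_gaussian_mul_polynomial_affine_le (half_pos n_pos) P
    slope_ne_zero (momentum γ m / n) (show 0 ≤ |c| + 1 by positivity)
  have : IsFiniteMeasure ((volume : Measure (ℝ × ℝ)).restrict (stripSquare 0)) := by
    rw [restrict_stripSquare_zero]
    infer_instance
  refine integrableOn_strip_mul (v := fun z => u.1 (ptEquiv τ z))
    ((memLp_comp_ptEquiv u.2.2).integrable one_le_two) ?_ (fun k => ?_) ?_ hC fun z => ?_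
  · exact u.1.aestronglyMeasurable.comp_quasiMeasurePreserving
      (quasiMeasurePreserving_continuousLinearEquiv (ptEquiv τ))
  · filter_upwards [ae_add_comp_ptEquiv u k] with z periodic
    rw [periodic, enorm_mul, ← ofReal_norm (gaugeFactor _ _ _), norm_gaugeFactor,
      ENNReal.ofReal_one, one_mul]
  · exact (by fun_prop : Continuous fun z : ℝ × ℝ => (Real.exp (c * |z.1|) : ℂ)).mul
      (Complex.continuous_conj.comp ((continuous_mode γ P m).comp (ptEquiv τ).continuous))
  · rw [norm_mul, RCLike.norm_conj, norm_mode, centeredIm_ptEquiv, Complex.norm_real,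
      Real.norm_eq_abs, Real.abs_exp]
    refine (mul_le_mul_of_nonneg_left (le_exp z.1) (Real.exp_nonneg _)).trans ?_
    rw [mul_left_comm, ← Real.exp_add]
    gcongr
    linarith [mul_le_mul_of_nonneg_right (le_abs_self c) (abs_nonneg z.1)]

lemma integrableOn_strip_mode {γ : GaugePhase τ n} (u : GaugeL2 γ) (P : Polynomial ℂ) (m : ℤ) :
    IntegrableOn (fun z => conj (mode γ P m (ptEquiv τ z)) * u.1 (ptEquiv τ z)) strip := by
  simpa using integrableOn_strip_exp_mul_mode u P m 0

lemma integral_strip_mode_eq_zero {γ : GaugePhase τ n} {u : GaugeL2 γ}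
    (hu : ∀ s P, inner ℂ (smoothToL2 γ (smoothMode γ s P)) u = 0) (P : Polynomial ℂ) (m : ℤ) :
    ∫ z in strip, conj (mode γ P m (ptEquiv τ z)) * u.1 (ptEquiv τ z) = 0 := by
  have integral_cell : ∫ x in cell τ,
      conj (modeSum γ (Pi.single (m : ZMod n) 1) P x) * u.1 x = 0 := by
    rw [← hu (Pi.single (m : ZMod n) 1) P, inner_smoothToL2]
    rfl
  rw [integral_strip_eq (integrableOn_strip_mode u P m),
    ← setIntegral_comp_ptEquiv_eq_zero integral_cell]
  refine integral_congr_ae ?_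
  filter_upwards [ae_restrict_of_ae (ae_all_iff.2 fun k => ae_add_comp_ptEquiv u k)]
    with z periodic
  rw [modeSum_single, Complex.conj_tsum, ← tsum_mul_right]
  refine tsum_congr fun k => ?_
  have conj_gaugeFactor_mul : conj (gaugeFactor γ (latticePt τ 0 k) (ptEquiv τ z)) *
      gaugeFactor γ (latticePt τ 0 k) (ptEquiv τ z) = 1 := by
    rw [← Complex.normSq_eq_conj_mul_self, Complex.normSq_eq_norm_sq, norm_gaugeFactor, one_pow,
      Complex.ofReal_one]
  rw [periodic k, ptEquiv_add, mode_add_latticePt_zero, map_mul]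
  linear_combination
    (conj (mode γ P (m + k * n) (ptEquiv τ z)) * u.1 (ptEquiv τ z)) * conj_gaugeFactor_mul

lemma ae_integral_mode_eq_zero {γ : GaugePhase τ n} {u : GaugeL2 γ}
    (hu : ∀ s P, inner ℂ (smoothToL2 γ (smoothMode γ s P)) u = 0) (m : ℤ) :
    ∀ᵐ q : ℝ, ∫ p in Set.Ico (0 : ℝ) 1, conj (mode γ 1 m (pt τ p q)) * u.1 (pt τ p q) = 0 := by
  refine ae_eq_zero_of_moments_eq_zero (fun c => ?_) fun k => ?_
  · have integrable_exp_mul := integrableOn_strip_exp_mul_mode u 1 m c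
    rw [IntegrableOn, restrict_strip] at integrable_exp_mul
    simpa only [mul_assoc, integral_const_mul] using! integrable_exp_mul.integral_prod_left
  · obtain ⟨P, mode_eq⟩ := exists_mode_eq_pow_mul γ m k
    have integrable_mode := integrableOn_strip_mode u P m
    have integral_eq_zero := integral_strip_mode_eq_zero hu P m
    rw [IntegrableOn, restrict_strip] at integrable_mode
    rw [restrict_strip, integral_prod _ integrable_mode] at integral_eq_zero
    simpa only [mode_eq, map_mul, map_pow, Complex.conj_ofReal, mul_assoc, integral_const_mul]
      using! integral_eq_zero

lemma ae_slice_eq_zero {γ : GaugePhase τ n} {u : GaugeL2 γ}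
    (hu : ∀ s P, inner ℂ (smoothToL2 γ (smoothMode γ s P)) u = 0) :
    ∀ᵐ q ∂(volume.restrict (Set.Ico (0 : ℝ) 1)),
      (fun p => u.1 (pt τ p q)) =ᵐ[volume.restrict (Set.Ico (0 : ℝ) 1)] 0 := by
  have memLp_square := memLp_comp_ptEquiv u.2.2
  have aesm_square := memLp_square.1
  have integrable_sq := memLp_square.integrable_norm_pow two_ne_zero
  rw [restrict_stripSquare_zero] at aesm_square integrable_sq
  filter_upwards [aesm_square.prodMk_left, integrable_sq.prod_right_ae,
    ae_restrict_of_ae (ae_all_iff.2 fun m => ae_integral_mode_eq_zero hu m)]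
    with q aesm_slice integrable_slice integral_mode
  exact ae_eq_zero_of_integral_mode_eq_zero
    ((memLp_two_iff_integrable_sq_norm aesm_slice).2 integrable_slice) integral_mode

lemma eq_zero_of_inner_smoothMode {γ : GaugePhase τ n} {u : GaugeL2 γ}
    (hu : ∀ s P, inner ℂ (smoothToL2 γ (smoothMode γ s P)) u = 0) : u = 0 :=
  eq_zero_of_ae_slice_eq_zero (ae_slice_eq_zero hu)

end Completeness

/-! ### Ground states and the eigenbasis -/

section Ground

lemma eq_zero_of_hasSum_mul_exp_eq_zero {c : ℤ → ℂ}
    (h : ∀ p : ℝ, HasSum (fun m : ℤ => c m * Complex.exp (2 * Real.pi * Complex.I * m * p)) 0) :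
    c = 0 := by
  have summable_c : Summable c := by simpa using (h 0).summable
  obtain ⟨g, hg⟩ : Summable fun m : ℤ => c m • (fourier m : C(UnitAddCircle, ℂ)) :=
    .of_norm (summable_c.norm.congr fun m => by rw [norm_smul, fourier_norm, mul_one])
  obtain rfl : g = 0 := by
    ext x
    induction x using QuotientAddGroup.induction_on with
    | H p =>
      refine (ContinuousMap.hasSum_apply hg (p : UnitAddCircle)).unique
        ((h p).congr_fun fun m => ?_)
      change c m * fourier m (p : UnitAddCircle) = _
      rw [fourier_coe_apply, Complex.ofReal_one, div_one]
  funext l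
  have hasSum_inner := (hg.mapL (ContinuousMap.toLp (E := ℂ) 2
    (AddCircle.haarAddCircle (T := 1)) ℂ)).mapL (innerSL ℂ (fourierLp (T := 1) 2 l))
  rw [map_zero, map_zero] at hasSum_inner
  refine ((hasSum_ite_eq l (c l)).congr_fun fun m => ?_).unique hasSum_inner
  rw [map_smul, map_smul, innerSL_apply_apply, orthonormal_iff_ite.1 orthonormal_fourier]
  by_cases hlm : l = m
  · subst hlm; simp
  · simp [hlm, Ne.symm hlm]

variable {τ : ℍ} {n : ℕ}

lemma smoothToL2_injective (γ : GaugePhase τ n) : Function.Injective (smoothToL2 γ) := by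
  intro f g h
  refine Subtype.ext ((Continuous.ae_eq_iff_eq volume f.2.1.continuous g.2.1.continuous).1 ?_)
  exact (coeFn_smoothToL2 f).symm.trans (h ▸ coeFn_smoothToL2 g)

variable [NeZero n]

/-- The linear map that sends the weights `s` to the superposition of the Gaussian modes with
weights `s`. -/
def groundMap (γ : GaugePhase τ n) : (ZMod n → ℂ) →ₗ[ℂ] smoothGauge γ where
  toFun s := smoothMode γ s 1
  map_add' s t := by
    refine Subtype.ext (funext fun x => ?_)
    change modeSum γ (s + t) 1 x = modeSum γ s 1 x + modeSum γ t 1 x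
    simp only [modeSum, Pi.add_apply, add_mul]
    exact (summable_mul_mode γ s 1 x).tsum_add (summable_mul_mode γ t 1 x)
  map_smul' a s := by
    refine Subtype.ext (funext fun x => ?_)
    change modeSum γ (a • s) 1 x = a * modeSum γ s 1 x
    simp only [modeSum, Pi.smul_apply, smul_eq_mul, mul_assoc, tsum_mul_left]

lemma groundMap_injective (γ : GaugePhase τ n) : Function.Injective (groundMap γ) := by
  rw [injective_iff_map_eq_zero]
  intro s hs
  choose K K_ne_zero mode_eq using fun m => exists_mode_one_eq γ m 0
  have weights_eq_zero : (fun m : ℤ => s m * K m) = 0 := by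
    refine eq_zero_of_hasSum_mul_exp_eq_zero fun p => ?_
    have twist_ne_zero : modeTwist γ p 0 ≠ 0 := Complex.exp_ne_zero _
    have modeSum_eq_zero : modeSum γ s 1 (pt τ p 0) = 0 := congrFun (congrArg Subtype.val hs) _
    have hasSum_mode := (summable_mul_mode γ s 1 (pt τ p 0)).hasSum.mul_left (modeTwist γ p 0)⁻¹
    rw [← modeSum, modeSum_eq_zero, mul_zero] at hasSum_mode
    refine hasSum_mode.congr_fun fun m => ?_
    rw [mode_eq]
    field_simp
  funext z
  have := (mul_eq_zero.1 (congrFun weights_eq_zero (z.val : ℤ))).resolve_right (K_ne_zero _)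
  rwa [Int.cast_natCast, ZMod.natCast_zmod_val] at this

/-- The space of all superpositions of Gaussian modes, on which the lowering operator vanishes. -/
def groundSpace (γ : GaugePhase τ n) : Submodule ℂ (smoothGauge γ) := LinearMap.range (groundMap γ)

lemma finrank_groundSpace (γ : GaugePhase τ n) : Module.finrank ℂ (groundSpace γ) = n := by
  rw [groundSpace, LinearMap.finrank_range_of_inj (groundMap_injective γ),
    Module.finrank_fintype_fun_eq_card, ZMod.card]

instance finiteDimensional_groundSpace (γ : GaugePhase τ n) :
    FiniteDimensional ℂ (groundSpace γ) :=
  inferInstanceAs (FiniteDimensional ℂ (LinearMap.range (groundMap γ)))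

lemma lowering_of_mem_groundSpace {γ : GaugePhase τ n} {v : smoothGauge γ}
    (hv : v ∈ groundSpace γ) : lowering (smoothCov γ) v = 0 := by
  obtain ⟨s, rfl⟩ := hv
  exact lowering_smoothMode_one γ s

lemma smoothMode_X_mul_mem_ladderSpan {γ : GaugePhase τ n} {s : ZMod n → ℂ} {P : Polynomial ℂ}
    (h : smoothMode γ s P ∈ ladderSpan (smoothCov γ) (groundSpace γ)) :
    smoothMode γ s (Polynomial.X * P) ∈ ladderSpan (smoothCov γ) (groundSpace γ) := by
  have cov_mem := (covariantPair_smooth γ).zero_apply_mem_ladderSpan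
    (fun v hv => lowering_of_mem_groundSpace hv) h
  rw [smoothCov_smoothMode] at cov_mem
  change smoothMode γ s (Polynomial.C (Complex.I * n) * (Polynomial.X * P)) ∈ _ at cov_mem
  rw [smoothMode_C_mul] at cov_mem
  exact (Submodule.smul_mem_iff _ (mul_ne_zero Complex.I_ne_zero (NeZero.ne _))).1 cov_mem

lemma smoothMode_mem_ladderSpan (γ : GaugePhase τ n) (s : ZMod n → ℂ) (P : Polynomial ℂ) :
    smoothMode γ s P ∈ ladderSpan (smoothCov γ) (groundSpace γ) := by
  induction P using Polynomial.induction_on' with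
  | add P Q hP hQ =>
    rw [smoothMode_add]
    exact Submodule.add_mem _ hP hQ
  | monomial k a =>
    rw [← Polynomial.C_mul_X_pow_eq_monomial, smoothMode_C_mul]
    refine Submodule.smul_mem _ _ ?_
    induction k with
    | zero => exact raising_pow_mem_ladderSpan (LinearMap.mem_range_self (groundMap γ) s) 0
    | succ k ih =>
      rw [pow_succ']
      exact smoothMode_X_mul_mem_ladderSpan ih

lemma exists_eigenbasis (γ : GaugePhase τ n) :
    ∃ (b : HilbertBasis (ℕ × Fin n) ℂ (GaugeL2 γ)) (e : ℕ × Fin n → smoothGauge γ),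
      (∀ i, b i = smoothToL2 γ (e i)) ∧
      (∀ i, negLaplacian (smoothCov γ) (e i) = (((2 * i.1 + 1) * n : ℝ) : ℂ) • e i) ∧
      Submodule.span ℂ (Set.range fun l => e (0, l)) = groundSpace γ := by
  have ladder := (covariantPair_smooth γ).exists_ladder_basis (Nat.cast_pos.2 (NeZero.pos n))
    (fun v (hv : v ∈ groundSpace γ) => lowering_of_mem_groundSpace hv)
    (fun v _ => (map_eq_zero_iff _ (smoothToL2_injective γ)).1)
    (fun u hu => eq_zero_of_inner_smoothMode fun s P => hu _ (smoothMode_mem_ladderSpan γ s P))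
  rw [finrank_groundSpace γ] at ladder
  simpa only [Complex.ofReal_mul, Complex.ofReal_add, Complex.ofReal_natCast, Complex.ofReal_ofNat,
    Complex.ofReal_one] using ladder

end Ground

/-! ### Theta functions -/

section Theta

variable {τ : ℍ} {n : ℕ}

/-- The Gaussian coefficients `e^{iπτm²/n}`, which solve the recursion for the coefficients of
`n`-theta functions. -/
def thetaGauss (τ : ℍ) (n : ℕ) (m : ℤ) : ℂ :=
  Complex.exp (Real.pi * Complex.I * m ^ 2 * (τ / n))

lemma thetaGauss_ne_zero (τ : ℍ) (n : ℕ) (m : ℤ) : thetaGauss τ n m ≠ 0 := Complex.exp_ne_zero _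

lemma IsThetaExpansion.unique {c c' : ℤ → ℂ} {θ : ℂ → ℂ} (h : IsThetaExpansion τ n c θ)
    (h' : IsThetaExpansion τ n c' θ) : c = c' := by
  rw [← sub_eq_zero]
  refine eq_zero_of_hasSum_mul_exp_eq_zero fun p => ?_
  simpa only [Pi.sub_apply, sub_mul, sub_self] using (h.2 p).sub (h'.2 p)

lemma IsThetaExpansion.add {c c' : ℤ → ℂ} {θ θ' : ℂ → ℂ} (h : IsThetaExpansion τ n c θ)
    (h' : IsThetaExpansion τ n c' θ') : IsThetaExpansion τ n (c + c') (θ + θ') :=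
  ⟨fun m => by simp only [Pi.add_apply, h.1, h'.1, mul_add],
    fun z => by simpa only [Pi.add_apply, add_mul] using (h.2 z).add (h'.2 z)⟩

lemma IsThetaExpansion.smul {c : ℤ → ℂ} {θ : ℂ → ℂ} (h : IsThetaExpansion τ n c θ) (a : ℂ) :
    IsThetaExpansion τ n (a • c) (a • θ) :=
  ⟨fun m => by simp only [Pi.smul_apply, smul_eq_mul, h.1, mul_left_comm a],
    fun z => by simpa only [Pi.smul_apply, smul_eq_mul, mul_assoc] using (h.2 z).mul_left a⟩

/-- The coefficients `c_0, …, c_{n-1}` of a theta function. -/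
def thetaCoeff (τ : ℍ) (n : ℕ) : thetaSpace τ n →ₗ[ℂ] (Fin n → ℂ) where
  toFun θ j := Classical.choose θ.2 ((j : ℕ) : ℤ)
  map_add' θ θ' := funext fun j => congrFun ((Classical.choose_spec (θ + θ').2).unique
    ((Classical.choose_spec θ.2).add (Classical.choose_spec θ'.2))) ((j : ℕ) : ℤ)
  map_smul' a θ := funext fun j => congrFun ((Classical.choose_spec (a • θ).2).unique
    ((Classical.choose_spec θ.2).smul a)) ((j : ℕ) : ℤ)

lemma thetaCoeff_apply {θ : thetaSpace τ n} {c : ℤ → ℂ} (h : IsThetaExpansion τ n c θ)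
    (j : Fin n) : thetaCoeff τ n θ j = c ((j : ℕ) : ℤ) :=
  congrFun ((Classical.choose_spec θ.2).unique h) _

variable [NeZero n]

lemma thetaGauss_add (m : ℤ) : thetaGauss τ n (m + n) =
    Complex.exp (Complex.I * Real.pi * n * τ) * Complex.exp (2 * Complex.I * m * Real.pi * τ) *
      thetaGauss τ n m := by
  have n_ne_zero : (n : ℂ) ≠ 0 := NeZero.ne _
  rw [thetaGauss, thetaGauss, ← Complex.exp_add, ← Complex.exp_add]
  congr 1
  push_cast
  field_simp
  ring

lemma exists_eq_mul_thetaGauss {c : ℤ → ℂ} (h : ∀ m : ℤ, c (m + n) =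
    Complex.exp (Complex.I * Real.pi * n * τ) * Complex.exp (2 * Complex.I * m * Real.pi * τ) *
      c m) :
    ∃ s : ZMod n → ℂ, ∀ m : ℤ, c m = s m * thetaGauss τ n m := by
  have periodic : Function.Periodic (fun m => c m / thetaGauss τ n m) (n : ℤ) := fun m => by
    beta_reduce
    rw [h, thetaGauss_add, mul_div_mul_left]
    exact mul_ne_zero (Complex.exp_ne_zero _) (Complex.exp_ne_zero _)
  refine ⟨fun z => c (z.val : ℤ) / thetaGauss τ n (z.val : ℤ), fun m => ?_⟩
  have val_eq : ((m : ZMod n).val : ℤ) = m - (m / n) * n := by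
    rw [ZMod.val_intCast, Int.emod_def, mul_comm]
  beta_reduce
  rw [← div_eq_iff (thetaGauss_ne_zero τ n m), val_eq]
  simpa only [Int.cast_id] using (periodic.sub_int_mul_eq (m / n)).symm

/-- The theta function with coefficients `s_m e^{iπτm²/n}`. -/
def thetaSum (τ : ℍ) (s : ZMod n → ℂ) (z : ℂ) : ℂ :=
  ∑' m : ℤ, s m * thetaGauss τ n m * Complex.exp (2 * Real.pi * Complex.I * m * z)

lemma hasSum_thetaSum (s : ZMod n → ℂ) (z : ℂ) :
    HasSum (fun m : ℤ => s m * thetaGauss τ n m * Complex.exp (2 * Real.pi * Complex.I * m * z))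
      (thetaSum τ s z) := by
  have im_pos : 0 < ((τ : ℂ) / n).im := by
    rw [Complex.div_natCast_im]
    exact div_pos τ.im_pos (Nat.cast_pos.2 (NeZero.pos n))
  have term_eq (m : ℤ) : thetaGauss τ n m * Complex.exp (2 * Real.pi * Complex.I * m * z) =
      jacobiTheta₂_term m z (τ / n) := by
    rw [jacobiTheta₂_term, thetaGauss, ← Complex.exp_add, add_comm]
  have summable_term := ((summable_jacobiTheta₂_term_iff z ((τ : ℂ) / n)).2 im_pos).norm
  refine (Summable.of_norm_bounded (summable_term.mul_left (∑ y, ‖s y‖)) fun m => ?_).hasSum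
  rw [mul_assoc, norm_mul, term_eq]
  gcongr
  exact Finset.single_le_sum (f := fun y => ‖s y‖) (fun _ _ => norm_nonneg _) (Finset.mem_univ _)

lemma isThetaExpansion_thetaSum (τ : ℍ) (s : ZMod n → ℂ) :
    IsThetaExpansion τ n (fun m => s m * thetaGauss τ n m) (thetaSum τ s) := by
  refine ⟨fun m => ?_, hasSum_thetaSum s⟩
  beta_reduce
  rw [thetaGauss_add, Int.cast_add, Int.cast_natCast, ZMod.natCast_self, add_zero, mul_left_comm]

lemma mem_thetaSpace_iff {θ : ℂ → ℂ} :
    θ ∈ thetaSpace τ n ↔ ∃ s : ZMod n → ℂ, θ = thetaSum τ s := by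
  constructor
  · rintro ⟨c, h⟩
    obtain ⟨s, hs⟩ := exists_eq_mul_thetaGauss h.1
    refine ⟨s, funext fun z => (h.2 z).unique ((hasSum_thetaSum s z).congr_fun fun m => ?_)⟩
    rw [hs]
  · rintro ⟨s, rfl⟩
    exact ⟨_, isThetaExpansion_thetaSum τ s⟩

lemma thetaCoeff_injective (τ : ℍ) (n : ℕ) [NeZero n] : Function.Injective (thetaCoeff τ n) := by
  rw [injective_iff_map_eq_zero]
  rintro ⟨θ, hθ⟩ h
  obtain ⟨s, rfl⟩ := mem_thetaSpace_iff.1 hθ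
  obtain rfl : s = 0 := by
    funext z
    have coeff_eq_zero := congrFun h ⟨z.val, ZMod.val_lt z⟩
    rw [thetaCoeff_apply (isThetaExpansion_thetaSum τ s)] at coeff_eq_zero
    simpa [thetaGauss_ne_zero] using coeff_eq_zero
  exact Subtype.ext (funext fun z => by simp [thetaSum])

lemma thetaCoeff_surjective (τ : ℍ) (n : ℕ) [NeZero n] : Function.Surjective (thetaCoeff τ n) := by
  intro a
  let s : ZMod n → ℂ := fun z => a ⟨z.val, ZMod.val_lt z⟩ / thetaGauss τ n (z.val : ℤ)
  refine ⟨⟨thetaSum τ s, _, isThetaExpansion_thetaSum τ s⟩, funext fun j => ?_⟩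
  rw [thetaCoeff_apply (isThetaExpansion_thetaSum τ s)]
  simp only [Int.cast_natCast, s, ZMod.val_natCast_of_lt j.2]
  exact div_mul_cancel₀ _ (thetaGauss_ne_zero _ _ _)

lemma mode_one_eq_thetaFactor_mul {γ : GaugePhase τ n} (hc : γ.c (latticePt τ 1 0) = 0)
    (hc' : γ.c (latticePt τ 0 1) = 0) (m : ℤ) (x : ℂ) :
    mode γ 1 m x = thetaFactor n x * (thetaGauss τ n m *
      Complex.exp (2 * Real.pi * Complex.I * m * (x / scale τ))) := by
  have n_ne_zero : (n : ℂ) ≠ 0 := NeZero.ne _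
  have scale_ne_zero : (scale τ : ℂ) ≠ 0 := Complex.ofReal_ne_zero.2 (scale_pos τ).ne'
  have scale_eq : (scale τ : ℂ) * scale τ * τ.im = 2 * Real.pi := by
    exact_mod_cast scale_mul_self_mul_im τ
  have momentum_eq : (momentum γ m : ℂ) = 2 * Real.pi * m / scale τ := by simp [momentum, hc]
  have momentum_sq : (momentum γ m : ℂ) ^ 2 = 2 * Real.pi * m ^ 2 * τ.im := by
    rw [momentum_eq, div_pow, div_eq_iff (pow_ne_zero 2 scale_ne_zero)]
    linear_combination (-2 * Real.pi * m ^ 2 : ℂ) * scale_eq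
  have wave_eq : 2 * Real.pi * Complex.I * m * (x / scale τ) =
      Complex.I * momentum γ m * (x.re + x.im * Complex.I) := by
    rw [Complex.re_add_im, momentum_eq]
    ring
  have tau_eq : (τ : ℂ) = τ.re + τ.im * Complex.I := (Complex.re_add_im (τ : ℂ)).symm
  rw [mode, thetaFactor, thetaGauss, Polynomial.eval_one, mul_one, ← Complex.exp_add,
    ← Complex.exp_add, wave_eq, tau_eq]
  congr 1
  simp only [modePhase, centeredIm, hc, hc']
  push_cast
  field_simp
  linear_combination (-1 : ℂ) * momentum_sq -
    (n * (x.im : ℂ) ^ 2 * n + 2 * n * momentum γ m * x.im + 2 * Real.pi * m ^ 2 * τ.im) *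
      Complex.I_sq

lemma modeSum_one_eq_thetaFactor_mul {γ : GaugePhase τ n} (hc : γ.c (latticePt τ 1 0) = 0)
    (hc' : γ.c (latticePt τ 0 1) = 0) (s : ZMod n → ℂ) (x : ℂ) :
    modeSum γ s 1 x = thetaFactor n x * thetaSum τ s (x / (scale τ : ℂ)) := by
  rw [modeSum, thetaSum, ← tsum_mul_left]
  refine tsum_congr fun m => ?_
  rw [mode_one_eq_thetaFactor_mul hc hc']
  ring

end Theta

/-! ### The spectral theorem for the magnetic Laplacian -/

section SpectralTheorem

variable {τ : ℍ} {n : ℕ} [NeZero n]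

lemma exists_isDiagonal_magneticLaplacian (γ : GaugePhase τ n) :
    ∃ b : HilbertBasis (ℕ × Fin n) ℂ (GaugeL2 γ),
      IsDiagonal (magneticLaplacian γ) b (fun i => (((2 * i.1 + 1) * n : ℝ) : ℂ)) ∧
      Submodule.span ℂ (Set.range fun l => b (0, l)) = (groundSpace γ).map (smoothToL2 γ) := by
  obtain ⟨b, e, hb, eigen, span_e⟩ := exists_eigenbasis γ
  refine ⟨b, isDiagonal_magneticLaplacian b e hb _ eigen, ?_⟩
  simp only [← span_e, hb, Submodule.map_span, ← Set.range_comp, Function.comp_def]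

lemma setOf_eigenvalue_eq (n : ℕ) [NeZero n] (m : ℕ) :
    {i : ℕ × Fin n | (((2 * i.1 + 1) * n : ℝ) : ℂ) = (2 * (m : ℂ) + 1) * n} =
      Set.range fun l => (m, l) := by
  ext ⟨k, l⟩
  have n_ne_zero : n ≠ 0 := NeZero.ne n
  simp [n_ne_zero, eq_comm]

lemma isSelfAdjoint_magneticLaplacian (γ : GaugePhase τ n) :
    IsSelfAdjoint (magneticLaplacian γ) := by
  obtain ⟨b, diagonal, -⟩ := exists_isDiagonal_magneticLaplacian γ
  exact diagonal.isSelfAdjoint fun i => Complex.conj_ofReal _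

lemma unboundedSpectrum_magneticLaplacian (γ : GaugePhase τ n) :
    unboundedSpectrum (magneticLaplacian γ) =
      Set.range fun m : ℕ => (2 * (m : ℂ) + 1) * (n : ℂ) := by
  obtain ⟨b, diagonal, -⟩ := exists_isDiagonal_magneticLaplacian γ
  have range_eq : Set.range (fun i : ℕ × Fin n => (((2 * i.1 + 1) * n : ℝ) : ℂ)) =
      Set.range fun m : ℕ => (2 * (m : ℂ) + 1) * (n : ℂ) := by
    simpa [Function.comp_def] using
      (Prod.fst_surjective (β := Fin n)).range_comp fun m : ℕ => (2 * (m : ℂ) + 1) * (n : ℂ)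
  have isClosed_range := isClosed_range_odd_mul (ν := n) (Nat.cast_pos.2 (NeZero.pos n))
  rw [Complex.ofReal_natCast] at isClosed_range
  rw [diagonal.unboundedSpectrum_eq_closure, range_eq, isClosed_range.closure_eq]

lemma finrank_eigenspace_magneticLaplacian (γ : GaugePhase τ n) (m : ℕ) :
    Module.finrank ℂ (eigenspace (magneticLaplacian γ) ((2 * (m : ℂ) + 1) * (n : ℂ))) = n := by
  obtain ⟨b, diagonal, -⟩ := exists_isDiagonal_magneticLaplacian γ
  rw [diagonal.finrank_eigenspace (setOf_eigenvalue_eq n m ▸ Set.finite_range _),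
    setOf_eigenvalue_eq, ← Set.image_univ,
    Set.ncard_image_of_injective _ (Prod.mk_right_injective m), Set.ncard_univ, Nat.card_fin]

lemma eigenspace_eq_map_groundSpace (γ : GaugePhase τ n) :
    eigenspace (magneticLaplacian γ) (n : ℂ) = (groundSpace γ).map (smoothToL2 γ) := by
  obtain ⟨b, diagonal, span_b⟩ := exists_isDiagonal_magneticLaplacian γ
  have n_eq : (n : ℂ) = (2 * ((0 : ℕ) : ℂ) + 1) * n := by simp
  rw [n_eq, diagonal.eigenspace_eq_span (setOf_eigenvalue_eq n 0 ▸ Set.finite_range _),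
    setOf_eigenvalue_eq, ← Set.range_comp, ← span_b, Function.comp_def]

lemma smoothToL2_groundMap_ae_eq {γ : GaugePhase τ n} (hc : γ.c (latticePt τ 1 0) = 0)
    (hc' : γ.c (latticePt τ 0 1) = 0) (s : ZMod n → ℂ) :
    (smoothToL2 γ (groundMap γ s)).1 =ᵐ[volume]
      fun x => thetaFactor n x * thetaSum τ s (x / (scale τ : ℂ)) :=
  (coeFn_smoothToL2 (groundMap γ s)).trans
    (.of_forall (modeSum_one_eq_thetaFactor_mul hc hc' s))

lemma exists_mem_eigenspace_ae_eq_iff {γ : GaugePhase τ n} (hc : γ.c (latticePt τ 1 0) = 0)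
    (hc' : γ.c (latticePt τ 0 1) = 0) (ψ : ℂ → ℂ) :
    (∃ u ∈ eigenspace (magneticLaplacian γ) (n : ℂ), ψ =ᵐ[volume] u.1) ↔
      ∃ θ ∈ thetaSpace τ n, ψ =ᵐ[volume] fun x => thetaFactor n x * θ (x / (scale τ : ℂ)) := by
  rw [eigenspace_eq_map_groundSpace]
  constructor
  · rintro ⟨_, ⟨_, ⟨s, rfl⟩, rfl⟩, h⟩
    exact ⟨_, mem_thetaSpace_iff.2 ⟨s, rfl⟩, h.trans (smoothToL2_groundMap_ae_eq hc hc' s)⟩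
  · rintro ⟨θ, hθ, h⟩
    obtain ⟨s, rfl⟩ := mem_thetaSpace_iff.1 hθ
    exact ⟨_, ⟨_, ⟨s, rfl⟩, rfl⟩, h.trans (smoothToL2_groundMap_ae_eq hc hc' s).symm⟩

end SpectralTheorem

end Landau

end

theorem mainTheorem9 (τ : ℍ) (n : ℕ) (hn : 0 < n) (γ : Landau.GaugePhase τ n) :
    -- `-Δ_{aⁿ}` is self-adjoint, and its domain is the gauge-periodic Sobolev space of order two
    IsSelfAdjoint (Landau.magneticLaplacian γ) ∧
    (∀ u : Landau.GaugeL2 γ, u ∈ (Landau.magneticLaplacian γ).domain ↔ Landau.MemH2Loc u.1) ∧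
    -- the spectrum and the multiplicities
    Landau.unboundedSpectrum (Landau.magneticLaplacian γ) =
      Set.range (fun m : ℕ => (2 * (m : ℂ) + 1) * (n : ℂ)) ∧
    (∀ m : ℕ, Module.finrank ℂ
      (Landau.eigenspace (Landau.magneticLaplacian γ) ((2 * (m : ℂ) + 1) * (n : ℂ))) = n) ∧
    -- the lowest eigenspace, when `c_t = 0` on the two basis vectors of the lattice
    (γ.c (Landau.latticePt τ 1 0) = 0 → γ.c (Landau.latticePt τ 0 1) = 0 →
      ∀ ψ : ℂ → ℂ,
        (∃ u ∈ Landau.eigenspace (Landau.magneticLaplacian γ) (n : ℂ), ψ =ᵐ[volume] u.1) ↔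
          ∃ θ ∈ Landau.thetaSpace τ n,
            ψ =ᵐ[volume] fun x => Landau.thetaFactor n x * θ (x / (Landau.scale τ : ℂ))) ∧
    -- theta functions are determined by `c_0, …, c_{n-1}`, which are arbitrary
    (∃ e : Landau.thetaSpace τ n ≃ₗ[ℂ] (Fin n → ℂ),
      ∀ (θ : Landau.thetaSpace τ n) (c : ℤ → ℂ), Landau.IsThetaExpansion τ n c θ →
        ∀ j : Fin n, e θ j = c ((j : ℕ) : ℤ)) ∧
    Module.finrank ℂ (Landau.thetaSpace τ n) = n := by
  have : NeZero n := ⟨hn.ne'⟩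
  let e := LinearEquiv.ofBijective (Landau.thetaCoeff τ n)
    ⟨Landau.thetaCoeff_injective τ n, Landau.thetaCoeff_surjective τ n⟩
  refine ⟨Landau.isSelfAdjoint_magneticLaplacian γ, Landau.mem_domain_iff_memH2Loc,
    Landau.unboundedSpectrum_magneticLaplacian γ, Landau.finrank_eigenspace_magneticLaplacian γ,
    Landau.exists_mem_eigenspace_ae_eq_iff, ⟨e, fun _ _ => Landau.thetaCoeff_apply⟩, ?_⟩
  rw [e.finrank_eq, Module.finrank_fin_fun]
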